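/- Let $\mathfrak h$ be a finite-dimensional complex vector space of dimension $r$, let $G\subseteq GL(\mathfrak h)$ be a finite group generated by (complex) reflections and acting irreducibly on $\mathfrak h$, let $\mathcal S\subseteq G$ be the set of reflections, $t\in\mathbb C$, and let $c:\mathcal S\to\mathbb C$ be invariant under conjugation. For $s\in\mathcal S$ let $\lambda_s$ be the nontrivial eigenvalue of $s$ on $\mathfrak h^*$, $d_s=(1-\lambda_s)/2$, and let $\alpha_s\in\mathfrak h^*$, $\alpha_s^\vee\in\mathfrak h$ be eigenvectors of $s$ for its nontrivial eigenvalues with $\alpha_s(\alpha_s^\vee)=2$. Let $H_{t,c}=H_{t,c}(G,\mathfrak h)$ be the rational Cherednik algebra: it is generated by $\mathfrak h$, $\mathfrak h^*$ and $\mathbb CG$ with the relations $[y,y']=[x,x']=0$, $gy=g(y)g$, $gx=g(x)g$ and $$[y,x]=t\,x(y)-\sum_{s\in\mathcal S}c(s)\,\alpha_s(y)\,x(\alpha_s^\vee)\,s\qquad(y,y'\in\mathfrak h,\ x,x'\in\mathfrak h^*,\ g\in G),$$ and it is graded by $\deg x=1$, $\deg y=-1$, $\deg g=0$. For an irreducible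 $G$-representation $\tau$ let $M_{t,c}(\tau)=H_{t,c}\otimes_{\mathbb C[\mathfrak h^*]\rtimes\mathbb CG}\tau$ (with $\mathfrak h$ acting by $0$ on $\tau$), graded with $\tau$ in degree $0$, and let $L_{t,c}(\tau)$ be its unique simple graded quotient (for $t\ne0$ this is the unique simple quotient of $M_{t,c}(\tau)$; for $t=0$ it is the simple quotient of the baby Verma module of $\tau$). Put $\mathrm{ch}(E,g,\mathbf q)=\sum_d\mathrm{tr}(g,E_d)\,\mathbf q^d$ for a graded $G$-representation $E=\bigoplus_d E_d$ with finite-dimensional components; the dual $E^*$ is graded by $(E^*)_d=(E_{-d})^*$. For irreducible $G$-representations $\sigma,\tau$ let $N_c(\sigma)$ be the scalar by which $\sum_s\frac{c(s)}{d_s}s$ acts on $\sigma$. Write $\sigma\sim\tau$ if: $N_c(\sigma)-N_c(\tau)\in t\,\mathbb Z$, when $t\neq0$ (same block); the centre of $H_{0,c}$ acts on $L_{0,c}(\sigma)$ and on $L_{0,c}(\tau)$ by the same character, when $t=0$ (same Calogero–Moser family). **Proposition.** Let $\tau$ be an irreducible $G$-representation. The module $L_{t,c}(\tau)$ is the direct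 sum of its homogeneous components, which are finite-dimensional, and it is finite-dimensional when $t=0$. There are finite-dimensional $\mathbb Z$-graded $G$-representations $i_{t,c}(\tau)^+$ and $i_{t,c}(\tau)^-$ such that $$\mathrm{ch}(L_{t,c}(\tau),g,\mathbf q)=\frac{\mathrm{ch}(i_{t,c}(\tau)^+,g,\mathbf q)-\mathrm{ch}(i_{t,c}(\tau)^-,g,\mathbf q)}{\det_{\mathfrak h^*}(1-g\mathbf q)}\qquad(g\in G)$$ and: 1. $\mathrm{Hom}_G(i_{t,c}(\tau)^+_d,\,i_{t,c}(\tau)^-_d)=0$ for every degree $d$; 2. every irreducible $G$-representation $\sigma$ that occurs in $i_{t,c}(\tau)^+$ or in $i_{t,c}(\tau)^-$ satisfies $\sigma\sim\tau$; 3. if $L_{t,c}(\tau)$ is finite-dimensional, then $\dim i_{t,c}(\tau)^+=\dim i_{t,c}(\tau)^-$. Moreover, with $\check c(s)=c(s^{-1})$, the module $L_{t,\check c}(\tau^*)$ of $H_{t,\check c}(G,\mathfrak h^*)$, the simple graded quotient of $\mathbb C[\mathfrak h^*]\otimes\tau^*$, is finite-dimensional; give it the grading with $\tau^*$ in degree $0$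 in which $\mathfrak h^*$ still has degree $1$ and $\mathfrak h$ degree $-1$ (so that it lives in degrees $\le0$). There are finite-dimensional $\mathbb Z$-graded $G$-representations $i_{t,\check c}(\tau^*)^\pm$ with $\mathrm{Hom}_G(i_{t,\check c}(\tau^*)^+_d,i_{t,\check c}(\tau^*)^-_d)=0$ for all $d$ and $$\mathrm{ch}(L_{t,\check c}(\tau^*),g,\mathbf q)=\frac{\mathrm{ch}(i_{t,\check c}(\tau^*)^+,g,\mathbf q)-\mathrm{ch}(i_{t,\check c}(\tau^*)^-,g,\mathbf q)}{\det_{\mathfrak h^*}(1-g\mathbf q)}\qquad(g\in G)$$ such that, for all $g\in G$, $$\mathrm{ch}\big((i_{t,c}(\tau)^{\pm})^*\otimes\det\nolimits_{\mathfrak h^*},g,\mathbf q\big)=\mathbf q^{-r}\,\mathrm{ch}(i_{t,\check c}(\tau^*)^{\pm},g,\mathbf q)\quad\text{if } r \text{ is even},$$ $$\mathrm{ch}\big((i_{t,c}(\tau)^{\pm})^*\otimes\det\nolimits_{\mathfrak h^*},g,\mathbf q\big)=\mathbf q^{-r}\,\mathrm{ch}(i_{t,\check c}(\tau^*)^{\mp},g,\mathbf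 q)\quad\text{if } r \text{ is odd}.$$ -/

import Mathlib

open scoped TensorProduct

noncomputable section

/-! ### Reflections -/

/-- `s` acts on `V` as a (complex) reflection: its fixed space has codimension one. -/
def IsReflection {G V : Type*} [Group G] [AddCommGroup V] [Module ℂ V]
    (ρ : Representation ℂ G V) (s : G) : Prop :=
  Module.finrank ℂ (LinearMap.range (ρ s - LinearMap.id)) = 1

/-- For a reflection `s`, the nontrivial eigenvalue `λ_s` of `s` on the dual space `V*`
(the other eigenvalues are `1`, so it is the determinant). -/
def reflEigenvalue {G V : Type*} [Group G] [AddCommGroup V] [Module ℂ V]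
    (ρ : Representation ℂ G V) (s : G) : ℂ :=
  LinearMap.det (ρ.dual s)

/-- `d_s = (1 - λ_s) / 2`. -/
def reflD {G V : Type*} [Group G] [AddCommGroup V] [Module ℂ V]
    (ρ : Representation ℂ G V) (s : G) : ℂ :=
  (1 - reflEigenvalue ρ s) / 2

/-- `d_s^∨ = (1 - λ_s⁻¹) / 2`. -/
def reflDCheck {G V : Type*} [Group G] [AddCommGroup V] [Module ℂ V]
    (ρ : Representation ℂ G V) (s : G) : ℂ :=
  (1 - (reflEigenvalue ρ s)⁻¹) / 2

/-- The number `α_s(y) x(α_s^∨)`, where `α_s ∈ V*`, `α_s^∨ ∈ V` are eigenvectors of the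
reflection `s` for its nontrivial eigenvalues, normalised by `α_s(α_s^∨) = 2`.  It is written
without a choice of these vectors; `reflForm_eq` shows that it is the same number
for every choice. -/
def reflForm {G V : Type*} [Group G] [AddCommGroup V] [Module ℂ V]
    (ρ : Representation ℂ G V) (s : G) (y : V) (x : Module.Dual ℂ V) : ℂ :=
  x (y - ρ s y) / reflDCheck ρ s

theorem reflForm_eq {G V : Type*} [Group G] [AddCommGroup V] [Module ℂ V]
    (ρ : Representation ℂ G V) (s : G) (hs : IsReflection ρ s)
    (h1 : reflEigenvalue ρ s ≠ 1) (h0 : reflEigenvalue ρ s ≠ 0)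
    (α : Module.Dual ℂ V) (αv : V)
    (hα : ρ.dual s α = reflEigenvalue ρ s • α)
    (hαv : ρ s αv = (reflEigenvalue ρ s)⁻¹ • αv) (h2 : α αv = 2)
    (y : V) (x : Module.Dual ℂ V) :
    reflForm ρ s y x = α y * x αv := by
  unfold reflForm reflDCheck
  set l := reflEigenvalue ρ s with hl
  have hli : (1 - l⁻¹) ≠ 0 := by
    intro h
    apply h1
    have : l⁻¹ = 1 := (sub_eq_zero.mp h).symm
    simpa using congrArg (·⁻¹) this
  have hαv0 : αv ≠ 0 := by
    rintro rfl
    simp at h2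
  have hmem : ∀ v : V, ρ s v - v ∈ LinearMap.range (ρ s - LinearMap.id) :=
    fun v => ⟨v, by simp⟩
  have hne : (⟨ρ s αv - αv, hmem αv⟩ : LinearMap.range (ρ s - LinearMap.id)) ≠ 0 := by
    intro h
    have h' : ρ s αv - αv = 0 := congrArg Subtype.val h
    rw [hαv] at h'
    have h'' : (l⁻¹ - 1) • αv = 0 := by rw [sub_smul, one_smul]; exact h'
    rcases smul_eq_zero.mp h'' with h3 | h3
    · exact hli (by rw [← neg_sub, h3, neg_zero])
    · exact hαv0 h3
  obtain ⟨k, hk⟩ := (finrank_eq_one_iff_of_nonzero' _ hne).mp hs ⟨ρ s y - y, hmem y⟩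
  have hk' : k • (ρ s αv - αv) = ρ s y - y := congrArg Subtype.val hk
  have hαs : ∀ v, α (ρ s v) = l⁻¹ * α v := by
    intro v
    have h3 := LinearMap.congr_fun hα (ρ s v)
    simp only [LinearMap.smul_apply, smul_eq_mul] at h3
    have h4 : (ρ.dual s α) (ρ s v) = α v := by
      simp [Representation.dual_apply, Module.Dual.transpose]
    rw [h4] at h3
    rw [h3, ← mul_assoc, inv_mul_cancel₀ h0, one_mul]
  have hky : k * 2 = α y := by
    have h3 := congrArg α hk'
    rw [map_smul, map_sub, map_sub, hαs, hαs, h2, smul_eq_mul] at h3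
    have h5 : (1 - l⁻¹) * (k * 2) = (1 - l⁻¹) * α y := by linear_combination -h3
    exact mul_left_cancel₀ hli h5
  have hxy : x (y - ρ s y) = k * ((1 - l⁻¹) * x αv) := by
    have h3 := congrArg x hk'
    rw [hαv] at h3
    simp only [map_smul, map_sub, smul_eq_mul] at h3
    rw [map_sub]
    linear_combination h3
  rw [hxy, ← hky, div_eq_iff (div_ne_zero hli two_ne_zero)]
  ring

/-! ### The rational Cherednik algebra -/

/-- Generators of the rational Cherednik algebra: vectors, covectors and group elements. -/
inductive CherednikGen (G V : Type*) [AddCommGroup V] [Module ℂ V]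
  | y (v : V)
  | x (f : Module.Dual ℂ V)
  | g (a : G)

open Classical in
/-- Defining relations of `H_{t,c}(G, V)`.  The first six families say that the generators form
the algebra generated by `V ⊕ V*` and `ℂ G`. -/
inductive CherednikRel {G V : Type*} [Group G] [Fintype G] [AddCommGroup V] [Module ℂ V]
    (ρ : Representation ℂ G V) (t : ℂ) (c : G → ℂ) :
    FreeAlgebra ℂ (CherednikGen G V) → FreeAlgebra ℂ (CherednikGen G V) → Prop
  | y_add (v w : V) : CherednikRel ρ t c (FreeAlgebra.ι ℂ (.y (v + w)))
      (FreeAlgebra.ι ℂ (.y v) + FreeAlgebra.ι ℂ (.y w))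
  | y_smul (a : ℂ) (v : V) : CherednikRel ρ t c (FreeAlgebra.ι ℂ (.y (a • v)))
      (a • FreeAlgebra.ι ℂ (.y v))
  | x_add (v w : Module.Dual ℂ V) : CherednikRel ρ t c (FreeAlgebra.ι ℂ (.x (v + w)))
      (FreeAlgebra.ι ℂ (.x v) + FreeAlgebra.ι ℂ (.x w))
  | x_smul (a : ℂ) (v : Module.Dual ℂ V) : CherednikRel ρ t c (FreeAlgebra.ι ℂ (.x (a • v)))
      (a • FreeAlgebra.ι ℂ (.x v))
  | g_one : CherednikRel ρ t c (FreeAlgebra.ι ℂ (.g 1)) 1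
  | g_mul (a b : G) : CherednikRel ρ t c (FreeAlgebra.ι ℂ (.g (a * b)))
      (FreeAlgebra.ι ℂ (.g a) * FreeAlgebra.ι ℂ (.g b))
  | y_comm (v w : V) : CherednikRel ρ t c
      (FreeAlgebra.ι ℂ (.y v) * FreeAlgebra.ι ℂ (.y w))
      (FreeAlgebra.ι ℂ (.y w) * FreeAlgebra.ι ℂ (.y v))
  | x_comm (v w : Module.Dual ℂ V) : CherednikRel ρ t c
      (FreeAlgebra.ι ℂ (.x v) * FreeAlgebra.ι ℂ (.x w))
      (FreeAlgebra.ι ℂ (.x w) * FreeAlgebra.ι ℂ (.x v))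
  | g_y (a : G) (v : V) : CherednikRel ρ t c
      (FreeAlgebra.ι ℂ (.g a) * FreeAlgebra.ι ℂ (.y v))
      (FreeAlgebra.ι ℂ (.y (ρ a v)) * FreeAlgebra.ι ℂ (.g a))
  | g_x (a : G) (f : Module.Dual ℂ V) : CherednikRel ρ t c
      (FreeAlgebra.ι ℂ (.g a) * FreeAlgebra.ι ℂ (.x f))
      (FreeAlgebra.ι ℂ (.x (ρ.dual a f)) * FreeAlgebra.ι ℂ (.g a))
  | y_x (v : V) (f : Module.Dual ℂ V) : CherednikRel ρ t c
      (FreeAlgebra.ι ℂ (.y v) * FreeAlgebra.ι ℂ (.x f)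
        - FreeAlgebra.ι ℂ (.x f) * FreeAlgebra.ι ℂ (.y v))
      ((t * f v) • 1
        - ∑ s : G with IsReflection ρ s, (c s * reflForm ρ s v f) • FreeAlgebra.ι ℂ (.g s))

/-- The rational Cherednik algebra `H_{t,c}(G, V)`. -/
def Cherednik {G V : Type*} [Group G] [Fintype G] [AddCommGroup V] [Module ℂ V]
    (ρ : Representation ℂ G V) (t : ℂ) (c : G → ℂ) : Type _ :=
  RingQuot (CherednikRel ρ t c)

instance {G V : Type*} [Group G] [Fintype G] [AddCommGroup V] [Module ℂ V]
    (ρ : Representation ℂ G V) (t : ℂ) (c : G → ℂ) : Ring (Cherednik ρ t c) :=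
  inferInstanceAs (Ring (RingQuot (CherednikRel ρ t c)))

instance {G V : Type*} [Group G] [Fintype G] [AddCommGroup V] [Module ℂ V]
    (ρ : Representation ℂ G V) (t : ℂ) (c : G → ℂ) : Algebra ℂ (Cherednik ρ t c) :=
  inferInstanceAs (Algebra ℂ (RingQuot (CherednikRel ρ t c)))

namespace Cherednik

variable {G V W : Type*} [Group G] [Fintype G] [AddCommGroup V] [Module ℂ V]
  [AddCommGroup W] [Module ℂ W]

/-- The quotient map from the free algebra. -/
def mk (ρ : Representation ℂ G V) (t : ℂ) (c : G → ℂ) :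
    FreeAlgebra ℂ (CherednikGen G V) →ₐ[ℂ] Cherednik ρ t c :=
  RingQuot.mkAlgHom ℂ (CherednikRel ρ t c)

theorem mk_rel (ρ : Representation ℂ G V) (t : ℂ) (c : G → ℂ)
    {a b : FreeAlgebra ℂ (CherednikGen G V)} (h : CherednikRel ρ t c a b) :
    mk ρ t c a = mk ρ t c b :=
  RingQuot.mkAlgHom_rel ℂ h

/-- The image of a generator in the algebra. -/
def of (ρ : Representation ℂ G V) (t : ℂ) (c : G → ℂ) (a : CherednikGen G V) :
    Cherednik ρ t c :=
  mk ρ t c (FreeAlgebra.ι ℂ a)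

theorem of_g_one (ρ : Representation ℂ G V) (t : ℂ) (c : G → ℂ) :
    of ρ t c (.g 1) = 1 := by
  unfold of
  rw [mk_rel ρ t c (CherednikRel.g_one (ρ := ρ) (t := t) (c := c)), map_one]

theorem of_g_mul (ρ : Representation ℂ G V) (t : ℂ) (c : G → ℂ) (a b : G) :
    of ρ t c (.g (a * b)) = of ρ t c (.g a) * of ρ t c (.g b) := by
  unfold of
  rw [mk_rel ρ t c (CherednikRel.g_mul (ρ := ρ) (t := t) (c := c) a b), map_mul]

theorem of_g_x (ρ : Representation ℂ G V) (t : ℂ) (c : G → ℂ) (a : G) (f : Module.Dual ℂ V) :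
    of ρ t c (.g a) * of ρ t c (.x f) = of ρ t c (.x (ρ.dual a f)) * of ρ t c (.g a) := by
  unfold of
  rw [← map_mul, mk_rel ρ t c (CherednikRel.g_x (ρ := ρ) (t := t) (c := c) a f),
    map_mul]

/-! ### Standard modules and their simple quotients -/

/-- The submodule of `H ⊗_ℂ W` generated by `g ⊗ w - 1 ⊗ g w` and `y ⊗ w`. -/
def stdRel (ρ : Representation ℂ G V) (t : ℂ) (c : G → ℂ) (τ : Representation ℂ G W) :
    Submodule (Cherednik ρ t c) (Cherednik ρ t c ⊗[ℂ] W) :=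
  Submodule.span (Cherednik ρ t c)
    ({m | ∃ (a : G) (w : W), m = of ρ t c (.g a) ⊗ₜ[ℂ] w - 1 ⊗ₜ[ℂ] (τ a w)} ∪
     {m | ∃ (v : V) (w : W), m = of ρ t c (.y v) ⊗ₜ[ℂ] w})

/-- The standard module `M_{t,c}(τ) = H ⊗_{ℂ[V*] ⋊ ℂ G} W`, where `V ⊆ ℂ[V*]` acts on `W`
by zero. -/
abbrev Std (ρ : Representation ℂ G V) (t : ℂ) (c : G → ℂ) (τ : Representation ℂ G W) : Type _ :=
  (Cherednik ρ t c ⊗[ℂ] W) ⧸ stdRel ρ t c τ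

/-- The degree `n` part of `M_{t,c}(τ)`: the span of all `x₁ ⋯ xₙ ⊗ w`. -/
def stdDeg (ρ : Representation ℂ G V) (t : ℂ) (c : G → ℂ) (τ : Representation ℂ G W) :
    ℕ → Submodule ℂ (Std ρ t c τ)
  | 0 => Submodule.span ℂ {m | ∃ w : W, m = Submodule.Quotient.mk (1 ⊗ₜ[ℂ] w)}
  | n + 1 => Submodule.span ℂ
      {m | ∃ (f : Module.Dual ℂ V) (m' : Std ρ t c τ),
        m' ∈ stdDeg ρ t c τ n ∧ m = of ρ t c (.x f) • m'}

/-- Graded submodules of `M_{t,c}(τ)`: those spanned by their homogeneous elements. -/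
def IsGradedSub (ρ : Representation ℂ G V) (t : ℂ) (c : G → ℂ) (τ : Representation ℂ G W)
    (N : Submodule (Cherednik ρ t c) (Std ρ t c τ)) : Prop :=
  N.restrictScalars ℂ = ⨆ n : ℕ, N.restrictScalars ℂ ⊓ stdDeg ρ t c τ n

/-- The largest proper graded submodule of `M_{t,c}(τ)` (for irreducible `τ`). -/
def stdRad (ρ : Representation ℂ G V) (t : ℂ) (c : G → ℂ) (τ : Representation ℂ G W) :
    Submodule (Cherednik ρ t c) (Std ρ t c τ) :=
  sSup {N | IsGradedSub ρ t c τ N ∧ N ≠ ⊤}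

/-- The module `L_{t,c}(τ)`: the unique simple graded quotient of `M_{t,c}(τ)`.  For `t ≠ 0` every
submodule of `M_{t,c}(τ)` is graded, and this is its unique simple quotient; for `t = 0` it is the
unique simple quotient of the baby Verma module of `τ`. -/
abbrev Simple (ρ : Representation ℂ G V) (t : ℂ) (c : G → ℂ) (τ : Representation ℂ G W) :
    Type _ :=
  Std ρ t c τ ⧸ stdRad ρ t c τ

/-- The degree `n` part of `L_{t,c}(τ)`. -/
def simpleDeg (ρ : Representation ℂ G V) (t : ℂ) (c : G → ℂ) (τ : Representation ℂ G W) (n : ℕ) :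
    Submodule ℂ (Simple ρ t c τ) :=
  (stdDeg ρ t c τ n).map ((stdRad ρ t c τ).mkQ.restrictScalars ℂ)

theorem g_smul_mem_stdDeg (ρ : Representation ℂ G V) (t : ℂ) (c : G → ℂ)
    (τ : Representation ℂ G W) (a : G) (n : ℕ) :
    ∀ m ∈ stdDeg ρ t c τ n, of ρ t c (.g a) • m ∈ stdDeg ρ t c τ n := by
  induction n with
  | zero =>
    intro m hm
    rw [stdDeg] at hm ⊢
    induction hm using Submodule.span_induction with
    | mem m hm =>
      obtain ⟨w, rfl⟩ := hm
      apply Submodule.subset_span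
      refine ⟨τ a w, ?_⟩
      rw [← Submodule.Quotient.mk_smul, Submodule.Quotient.eq, TensorProduct.smul_tmul',
        smul_eq_mul, mul_one]
      exact Submodule.subset_span (Or.inl ⟨a, w, rfl⟩)
    | zero => rw [smul_zero]; exact Submodule.zero_mem _
    | add m m' _ _ h h' => rw [smul_add]; exact Submodule.add_mem _ h h'
    | smul k m _ h => rw [smul_comm]; exact Submodule.smul_mem _ _ h
  | succ n ih =>
    intro m hm
    rw [stdDeg] at hm ⊢
    induction hm using Submodule.span_induction with
    | mem m hm =>
      obtain ⟨f, m', hm', rfl⟩ := hm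
      apply Submodule.subset_span
      refine ⟨ρ.dual a f, of ρ t c (.g a) • m', ih m' hm', ?_⟩
      rw [← mul_smul, ← mul_smul, of_g_x]
    | zero => rw [smul_zero]; exact Submodule.zero_mem _
    | add m m' _ _ h h' => rw [smul_add]; exact Submodule.add_mem _ h h'
    | smul k m _ h => rw [smul_comm]; exact Submodule.smul_mem _ _ h

theorem g_smul_mem_simpleDeg (ρ : Representation ℂ G V) (t : ℂ) (c : G → ℂ)
    (τ : Representation ℂ G W) (a : G) (n : ℕ) :
    ∀ m ∈ simpleDeg ρ t c τ n, of ρ t c (.g a) • m ∈ simpleDeg ρ t c τ n := by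
  rintro _ ⟨m, hm, rfl⟩
  exact ⟨of ρ t c (.g a) • m, g_smul_mem_stdDeg ρ t c τ a n m hm, rfl⟩

/-- The action of `g ∈ G` on the degree `n` part of `L_{t,c}(τ)`. -/
def simpleAct (ρ : Representation ℂ G V) (t : ℂ) (c : G → ℂ) (τ : Representation ℂ G W)
    (n : ℕ) (a : G) : simpleDeg ρ t c τ n →ₗ[ℂ] simpleDeg ρ t c τ n :=
  (Algebra.lsmul ℂ ℂ (Simple ρ t c τ) (of ρ t c (.g a))).restrict
    (g_smul_mem_simpleDeg ρ t c τ a n)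

/-- The graded character `ch(L_{t,c}(τ), g, q)`. -/
def simpleCh (ρ : Representation ℂ G V) (t : ℂ) (c : G → ℂ) (τ : Representation ℂ G W) (a : G) :
    LaurentSeries ℂ :=
  HahnSeries.ofPowerSeries ℤ ℂ
    (PowerSeries.mk fun n => LinearMap.trace ℂ _ (simpleAct ρ t c τ n a))

/-- The graded character of `L_{t,c}(τ)` when its degree `n` part is placed in degree `-n`
(used for finite-dimensional modules only). -/
def simpleChNeg (ρ : Representation ℂ G V) (t : ℂ) (c : G → ℂ) (τ : Representation ℂ G W)
    (a : G) : LaurentSeries ℂ :=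
  ∑ᶠ n : ℕ, HahnSeries.single (-(n : ℤ)) (LinearMap.trace ℂ _ (simpleAct ρ t c τ n a))

end Cherednik

/-! ### The relation `σ ∼ τ` -/

section Sim

variable {G V U W : Type*} [Group G] [Fintype G] [AddCommGroup V] [Module ℂ V]
  [AddCommGroup U] [Module ℂ U] [AddCommGroup W] [Module ℂ W]

open Classical in
/-- The action of `∑_s (c(s) / d_s) s` on the representation `σ`. -/
def omegaAct (ρ : Representation ℂ G V) (c : G → ℂ) (σ : Representation ℂ G U) : U →ₗ[ℂ] U :=
  ∑ s : G with IsReflection ρ s, (c s / reflD ρ s) • σ s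

/-- `N_c(σ) - N_c(τ) ∈ ℤ t`, where `N_c(σ)` is the scalar by which `∑_s (c(s) / d_s) s` acts. -/
def SameBlock (ρ : Representation ℂ G V) (t : ℂ) (c : G → ℂ) (σ : Representation ℂ G U)
    (τ : Representation ℂ G W) : Prop :=
  ∃ Nσ Nτ : ℂ, omegaAct ρ c σ = Nσ • LinearMap.id ∧ omegaAct ρ c τ = Nτ • LinearMap.id ∧
    ∃ k : ℤ, Nσ - Nτ = k * t

/-- `L_{t,c}(σ)` and `L_{t,c}(τ)` have the same central character. -/
def SameCentralChar (ρ : Representation ℂ G V) (t : ℂ) (c : G → ℂ) (σ : Representation ℂ G U)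
    (τ : Representation ℂ G W) : Prop :=
  ∀ z ∈ Subalgebra.center ℂ (Cherednik ρ t c), ∃ χ : ℂ,
    (∀ m : Cherednik.Simple ρ t c σ, z • m = χ • m) ∧
    (∀ m : Cherednik.Simple ρ t c τ, z • m = χ • m)

/-- `σ ∼ τ`: same block of category `𝒪` when `t ≠ 0`, same Calogero-Moser family when `t = 0`. -/
def Sim (ρ : Representation ℂ G V) (t : ℂ) (c : G → ℂ) (σ : Representation ℂ G U)
    (τ : Representation ℂ G W) : Prop :=
  (t ≠ 0 → SameBlock ρ t c σ τ) ∧ (t = 0 → SameCentralChar ρ t c σ τ)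

end Sim

/-! ### Finite-dimensional graded representations and characters -/

/-- Finite-dimensional `ℤ`-graded representations of `G`. -/
structure FinGradedRep (G : Type*) [Group G] where
  /-- the homogeneous components -/
  carrier : ℤ → Type
  [addCommGroup : ∀ d, AddCommGroup (carrier d)]
  [module : ∀ d, Module ℂ (carrier d)]
  [finiteDimensional : ∀ d, FiniteDimensional ℂ (carrier d)]
  /-- the action on the homogeneous components -/
  rep : ∀ d, Representation ℂ G (carrier d)
  finite_nontrivial : {d | Nontrivial (carrier d)}.Finite

attribute [instance] FinGradedRep.addCommGroup FinGradedRep.module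
  FinGradedRep.finiteDimensional

namespace FinGradedRep

variable {G : Type*} [Group G]

/-- The graded character `ch(E, g, q) = ∑_d tr(g, E_d) q^d`. -/
def ch (E : FinGradedRep G) (g : G) : LaurentSeries ℂ :=
  ∑ᶠ d : ℤ, HahnSeries.single d (LinearMap.trace ℂ (E.carrier d) (E.rep d g))

/-- The total dimension. -/
def dim (E : FinGradedRep G) : ℕ := ∑ᶠ d : ℤ, Module.finrank ℂ (E.carrier d)

/-- The graded dual: `(E*)_d = (E_{-d})*`. -/
def dual (E : FinGradedRep G) : FinGradedRep G where
  carrier d := Module.Dual ℂ (E.carrier (-d))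
  rep d := (E.rep (-d)).dual
  finite_nontrivial := by
    refine (E.finite_nontrivial.preimage (f := fun d : ℤ => -d)
      (neg_injective.injOn)).subset ?_
    intro d hd
    have hd' : Nontrivial (Module.Dual ℂ (E.carrier (-d))) := hd
    change Nontrivial (E.carrier (-d))
    by_contra h
    rw [not_nontrivial_iff_subsingleton] at h
    exact not_subsingleton (Module.Dual ℂ (E.carrier (-d))) inferInstance

/-- The tensor product with a one-dimensional representation, in degree zero. -/
def twist (E : FinGradedRep G) (χ : G →* ℂ) : FinGradedRep G where
  carrier := E.carrier
  rep d :=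
    { toFun := fun g => χ g • E.rep d g
      map_one' := by simp
      map_mul' := fun g h => by
        ext v
        simp [mul_smul, smul_comm (χ g) (χ h)] }
  finite_nontrivial := E.finite_nontrivial

/-- The irreducible representation `σ` occurs in `E`, in some degree. -/
def Occurs {U : Type*} [AddCommGroup U] [Module ℂ U] (σ : Representation ℂ G U)
    (E : FinGradedRep G) : Prop :=
  ∃ (d : ℤ) (f : Representation.IntertwiningMap σ (E.rep d)), f ≠ 0

/-- `Hom_G(E_d, F_d) = 0` for every degree `d`. -/
def Disjoint (E F : FinGradedRep G) : Prop :=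
  ∀ (d : ℤ) (f : Representation.IntertwiningMap (E.rep d) (F.rep d)), f = 0

end FinGradedRep

/-- The character `det_{V*}` of `G`. -/
def detDual {G V : Type*} [Group G] [AddCommGroup V] [Module ℂ V]
    (ρ : Representation ℂ G V) : G →* ℂ :=
  (LinearMap.det : (Module.Dual ℂ V →ₗ[ℂ] Module.Dual ℂ V) →* ℂ).comp ρ.dual

/-- `det_{V*}(1 - g q)`, as a polynomial in `q`. -/
def detPoly {G V : Type*} [Group G] [AddCommGroup V] [Module ℂ V]
    (ρ : Representation ℂ G V) (g : G) : Polynomial ℂ :=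
  LinearMap.det
    (LinearMap.id - (Polynomial.X : Polynomial ℂ) • (ρ.dual g).baseChange (Polynomial ℂ))

/-- `det_{V*}(1 - g q)`, as a Laurent series in `q`. -/
def detSeries {G V : Type*} [Group G] [AddCommGroup V] [Module ℂ V]
    (ρ : Representation ℂ G V) (g : G) : LaurentSeries ℂ :=
  HahnSeries.ofPowerSeries ℤ ℂ (detPoly ρ g : PowerSeries ℂ)

end

/-! The numerators come from approximating a graded module by standard modules from below. Let N be
a module over `Cherednik ρ t c`, graded in degrees ≥ 0 with finite-dimensional components, and let E
be its component of lowest degree n₀. Vectors of V lower the degree, so they kill E, and the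
inclusion of E extends to a map Φ from the standard module of E, shifted by n₀, to N. The kernel and
cokernel of Φ vanish in degrees ≤ n₀, and ch N = ch Std(E) − ch ker Φ + ch coker Φ. By Molien's
formula (`detPoly_mul_tr_polyDeg`) the product det(1 − gq) ch Std(E) is tr(g, E) q^{n₀}. Repeating
this for the kernel and the cokernel gains one degree each time, so every coefficient of det(1 − gq)
ch N is a difference of characters of G (`isVirtualChar_coeff_of_lt`). No finite length statement
about category 𝒪 is needed.

The same induction controls the constituents. If [z, x] = s x for all covectors x, then z acts on
the degree n part of L by l + ns, up to terms of higher degree. This passes to kernels and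
cokernels, and on a lowest component it says that an element of the group algebra, `constCoeff`,
acts by that scalar. For t ≠ 0 take for z the Euler element, with s = t. Constituents σ in degree d
then satisfy N_c(σ) − N_c(τ) = −dt, and only finitely many d occur, because an element of the group
algebra has finitely many eigenvalues. For t = 0 let z run through the centre, with s = 0; this
gives equality of central characters. There finiteness comes from finite-dimensionality of L:
invariant polynomials without constant term act into the radical, and every covector is integral
over them (`mulOp_pow_mem_polyRad`).

The explicit model behind this is ℂ[V] ⊗ W with Dunkl operators, identified with the standard module
in `exists_stdEquiv`. The radical consists of the m such that no element h of the algebra gives hm a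
nonzero constant term (`stdRad_eq`).

A pair of representations of minimal total dimension with a given difference of characters has no
common constituents, which gives disjointness. When L is finite-dimensional, the numerator at g = 1
is a polynomial multiple of (1 − q)^r with r > 0; its vanishing at q = 1 is the equality of
dimensions.

For the duality, exchanging vectors and covectors and inverting group elements is an
anti-homomorphism from `Cherednik ρ t c` to the algebra of the dual representation with parameter č.
It yields a contravariant pairing of the polynomial modules of τ and τ*, whose radicals are exactly
the kernels of the maps to the simple modules. Hence g has on the degree n part of L(τ*) the trace
of g⁻¹ on the degree n part of L(τ). Together with det(1 − gq) = (−q)^r det(g) det(1 − g⁻¹q⁻¹), this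
shows that dualising, twisting by det and shifting by r turns one numerator into the other, and the
sign (−1)^r decides whether + and − are exchanged. -/

noncomputable section

namespace Cherednik

/-! ### Reflections -/

section Reflections

variable {G V : Type*} [Group G] [AddCommGroup V] [Module ℂ V]

/-- The image of `1 - s` is a line spanned by `v`, and `α` is the coordinate on it. The pair is not
normalised by `α v = 2`; instead `1 - α v` is the determinant of `s` on `V`, hence nonzero.
Finiteness of `G` gives `α v ≠ 0`, since a transvection has infinite order in characteristic zero.
-/
theorem exists_sub_smul_of_isReflection [Finite G] [FiniteDimensional ℂ V]
    (ρ : Representation ℂ G V) {s : G} (hs : IsReflection ρ s) :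
    ∃ (α : Module.Dual ℂ V) (v : V), (∀ y, ρ s y = y - α y • v) ∧ α v ≠ 0 ∧ 1 - α v ≠ 0 ∧
      reflEigenvalue ρ s = (1 - α v)⁻¹ := by
  obtain ⟨⟨v, hv⟩, hv0, hspan⟩ := finrank_eq_one_iff'.mp hs
  have hv0' : v ≠ 0 := fun h => hv0 (Subtype.ext h)
  choose k hk using fun y : V => hspan ⟨y - ρ s y, ⟨-y, by simp [sub_eq_add_neg, add_comm]⟩⟩
  have hk' : ∀ y, k y • v = y - ρ s y := fun y => congrArg Subtype.val (hk y)
  let α : Module.Dual ℂ V :=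
    { toFun := k
      map_add' := fun x y => by
        apply smul_left_injective ℂ hv0'
        simp only [add_smul, hk', map_add]; abel
      map_smul' := fun a y => by
        apply smul_left_injective ℂ hv0'
        simp only [RingHom.id_apply, smul_assoc, hk', map_smul, smul_sub] }
  have hα : ∀ y, ρ s y = y - α y • v := fun y => by
    change _ = y - k y • v
    rw [hk', sub_sub_cancel]
  have hdet : LinearMap.det (ρ s) = 1 - α v := by
    have : ρ s = LinearMap.transvection α (-v) := by
      ext y; rw [hα]; simp [LinearMap.transvection, sub_eq_add_neg]
    rw [this, LinearMap.transvection.det, map_neg, sub_eq_add_neg]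
  have hmul : LinearMap.det (ρ s) * LinearMap.det (ρ s⁻¹) = 1 := by
    rw [← map_mul, ← map_mul, mul_inv_cancel, map_one, map_one]
  have hne : 1 - α v ≠ 0 := by
    rw [← hdet]; exact left_ne_zero_of_mul_eq_one hmul
  refine ⟨α, v, hα, ?_, hne, ?_⟩
  · intro h0
    have hpow : ∀ n : ℕ, ∀ y, ρ (s ^ n) y = y - (n * α y) • v := by
      intro n
      induction n with
      | zero => intro y; simp
      | succ n ih =>
        intro y
        rw [pow_succ', map_mul, Module.End.mul_apply, ih, map_sub, map_smul, hα, hα v, h0, zero_smul,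
          sub_zero]
        push_cast
        module
    apply hv0'
    obtain ⟨w, hw⟩ := hv
    have h1 := hpow (orderOf s) w
    have h2 : ((orderOf s : ℂ) * α w) • v = 0 := by
      rw [pow_orderOf_eq_one, map_one] at h1
      have : w = w - ((orderOf s : ℂ) * α w) • v := h1
      exact sub_eq_self.mp this.symm
    rcases smul_eq_zero.mp h2 with h3 | h3
    · rcases mul_eq_zero.mp h3 with h4 | h4
      · exact absurd (Nat.cast_eq_zero.mp h4) (orderOf_pos s).ne'
      · rw [← hw]; simp [hα w, h4]
    · exact h3
  · have : ρ.dual s = (ρ s⁻¹).dualMap := rfl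
    rw [reflEigenvalue, this, LinearMap.det_dualMap, ← hdet]
    exact eq_inv_of_mul_eq_one_right hmul

/-- Applying `α` to `y = s (s⁻¹ y)` gives `α y = (1 - α v) α (s⁻¹ y)`, and this turns the formula on
vectors into one on covectors. -/
theorem dual_apply_of_sub_smul (ρ : Representation ℂ G V) {s : G} {α : Module.Dual ℂ V} {v : V}
    (h : ∀ y, ρ s y = y - α y • v) (h1 : 1 - α v ≠ 0) (x : Module.Dual ℂ V) :
    ρ.dual s x = x + ((1 - α v)⁻¹ * x v) • α := by
  ext y
  have hy : ρ s (ρ s⁻¹ y) = y := by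
    rw [← Module.End.mul_apply, ← map_mul, mul_inv_cancel, map_one, Module.End.one_apply]
  have h2 := h (ρ s⁻¹ y)
  rw [hy] at h2
  have h3 : α y = (1 - α v) * α (ρ s⁻¹ y) := by
    have := congrArg α h2
    rw [map_sub, map_smul, smul_eq_mul] at this
    rw [this]; ring
  have h4 : ρ.dual s x y = x (ρ s⁻¹ y) := rfl
  have h5 := congrArg x h2
  rw [map_sub, map_smul, smul_eq_mul] at h5
  rw [h4, LinearMap.add_apply, LinearMap.smul_apply, smul_eq_mul, h3, h5]
  field_simp
  ring

theorem isReflection_conj (ρ : Representation ℂ G V) {s : G} (hs : IsReflection ρ s) (g : G) :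
    IsReflection ρ (g * s * g⁻¹) := by
  let e : V ≃ₗ[ℂ] V := LinearEquiv.ofLinearMap (ρ g) (ρ g⁻¹)
    (by rw [← Module.End.mul_eq_comp, ← map_mul, mul_inv_cancel]; simp; rfl)
    (by rw [← Module.End.mul_eq_comp, ← map_mul, inv_mul_cancel]; simp; rfl)
  have hconj : ρ (g * s * g⁻¹) - LinearMap.id =
      (e : V →ₗ[ℂ] V) ∘ₗ (ρ s - LinearMap.id) ∘ₗ (e.symm : V →ₗ[ℂ] V) := by
    ext y
    have : ρ g (ρ g⁻¹ y) = y := e.apply_symm_apply y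
    simp [e, map_mul, this]
  rw [IsReflection, hconj, LinearMap.range_comp, LinearMap.range_comp, LinearEquiv.range,
    Submodule.map_top]
  exact (LinearEquiv.finrank_map_eq e _).trans hs

theorem isReflection_conj_iff (ρ : Representation ℂ G V) (s g : G) :
    IsReflection ρ (g * s * g⁻¹) ↔ IsReflection ρ s := by
  refine ⟨fun h => ?_, fun h => isReflection_conj ρ h g⟩
  have := isReflection_conj ρ h g⁻¹
  simpa [mul_assoc] using this

theorem reflEigenvalue_conj (ρ : Representation ℂ G V) (s g : G) :
    reflEigenvalue ρ (g * s * g⁻¹) = reflEigenvalue ρ s := by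
  have h : LinearMap.det (ρ.dual g) * LinearMap.det (ρ.dual g⁻¹) = 1 := by
    rw [← map_mul, ← map_mul, mul_inv_cancel, map_one, map_one]
  rw [reflEigenvalue, map_mul, map_mul, map_mul, map_mul, reflEigenvalue]
  linear_combination LinearMap.det (ρ.dual s) * h

end Reflections

/-! ### The action of `G` on polynomials and divided differences -/

section Polynomials

variable {G V : Type*} [Group G] [AddCommGroup V] [Module ℂ V] {r : ℕ}
  (b : Module.Basis (Fin r) ℂ (Module.Dual ℂ V)) (ρ : Representation ℂ G V)

/-- A covector as a linear polynomial. -/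
def lin : Module.Dual ℂ V →ₗ[ℂ] MvPolynomial (Fin r) ℂ :=
  b.constr ℂ MvPolynomial.X

@[simp]
theorem lin_basis (i : Fin r) : lin b (b i) = MvPolynomial.X i := by
  simp [lin]

theorem lin_eq_sum (x : Module.Dual ℂ V) :
    lin b x = ∑ i, b.repr x i • (MvPolynomial.X i : MvPolynomial (Fin r) ℂ) := by
  simp [lin, Module.Basis.constr_apply_fintype]

theorem lin_injective : Function.Injective (lin b) := by
  intro x y h
  apply b.repr.injective
  ext i
  have := congrArg (MvPolynomial.coeff (Finsupp.single i 1)) h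
  simpa [lin_eq_sum, MvPolynomial.coeff_sum, MvPolynomial.coeff_X, Finsupp.single_left_inj,
    Finset.sum_ite_eq] using this

/-- The action of `G` on polynomial functions. -/
def polyAct (g : G) : MvPolynomial (Fin r) ℂ →ₐ[ℂ] MvPolynomial (Fin r) ℂ :=
  MvPolynomial.aeval fun i => lin b (ρ.dual g (b i))

theorem polyAct_lin (g : G) (x : Module.Dual ℂ V) :
    polyAct b ρ g (lin b x) = lin b (ρ.dual g x) := by
  have : (polyAct b ρ g).toLinearMap ∘ₗ lin b = lin b ∘ₗ ρ.dual g :=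
    b.ext fun i => by simp [polyAct]
  exact LinearMap.congr_fun this x

theorem polyAct_one : polyAct b ρ 1 = AlgHom.id ℂ _ := by
  ext i : 1
  rw [← lin_basis b, polyAct_lin, map_one]
  rfl

theorem polyAct_mul (g h : G) : polyAct b ρ (g * h) = (polyAct b ρ g).comp (polyAct b ρ h) := by
  ext i : 1
  rw [AlgHom.comp_apply, ← lin_basis b, polyAct_lin, polyAct_lin, polyAct_lin, map_mul]
  rfl

/-- Twisted divided differences attached to a reflection. -/
theorem exists_divided_difference [Finite G] [FiniteDimensional ℂ V] {s : G}
    (hs : IsReflection ρ s) (y : V) :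
    ∃ Δ : MvPolynomial (Fin r) ℂ →ₗ[ℂ] MvPolynomial (Fin r) ℂ,
      (∀ p, polyAct b ρ s p = p → Δ p = 0) ∧
      ∀ x p, Δ (lin b x * p) = lin b x * Δ p + x (y - ρ s y) • polyAct b ρ s p := by
  obtain ⟨α, v, h, h0, h1, -⟩ := exists_sub_smul_of_isReflection ρ hs
  have hα : lin b α ≠ 0 := fun h' => by
    rw [← map_zero (lin b)] at h'
    rw [lin_injective b h'] at h0
    exact h0 rfl
  let m := LinearMap.mulLeft ℂ (lin b α)
  have hm : Function.Injective m := mul_right_injective₀ hα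
  have hx : ∀ x : Module.Dual ℂ V,
      lin b x - polyAct b ρ s (lin b x) = lin b α * (-((1 - α v)⁻¹ * x v) • 1) := by
    intro x
    rw [polyAct_lin, dual_apply_of_sub_smul ρ h h1, map_add, map_smul]
    simp
  let d : MvPolynomial (Fin r) ℂ →ₗ[ℂ] MvPolynomial (Fin r) ℂ :=
    LinearMap.id - (polyAct b ρ s).toLinearMap
  -- Divisibility of `p - s p` by `α` spreads from covectors to all polynomials by the twisted
  -- Leibniz rule `p X - s(p) s(X) = (p - s p) X + s(p) (X - s X)`.
  have hd : ∀ p, d p ∈ LinearMap.range m := by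
    intro p
    induction p using MvPolynomial.induction_on with
    | C a => exact ⟨0, by simp [d, m, MvPolynomial.C_eq_smul_one]⟩
    | add p q hp hq => rw [map_add]; exact add_mem hp hq
    | mul_X p i hp =>
      obtain ⟨q, hq⟩ := hp
      refine ⟨q * MvPolynomial.X i + polyAct b ρ s p * (-((1 - α v)⁻¹ * (b i) v) • 1), ?_⟩
      have h2 := hx (b i)
      rw [lin_basis] at h2
      simp only [d, m, LinearMap.sub_apply, LinearMap.id_apply, AlgHom.toLinearMap_apply,
        LinearMap.mulLeft_apply] at hq ⊢
      rw [map_mul, mul_add, ← mul_assoc, hq, mul_left_comm, ← h2]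
      ring
  let Δ := (LinearEquiv.ofInjective m hm).symm.toLinearMap ∘ₗ d.codRestrict _ hd
  have hΔ : ∀ p, lin b α * Δ p = p - polyAct b ρ s p := by
    intro p
    have := LinearEquiv.apply_symm_apply (LinearEquiv.ofInjective m hm) (d.codRestrict _ hd p)
    exact congrArg Subtype.val this
  -- On a covector `x` the quotient `Δ` is `-(1 - α v)⁻¹ x(v)`; the scalar turns this into `α(y)
  -- x(v) = x (y - s y)`.
  refine ⟨(-(α y * (1 - α v))) • Δ, fun p hp => ?_, fun x p => ?_⟩
  · have h3 := hΔ p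
    rw [hp, sub_self] at h3
    simp [(mul_eq_zero.mp h3).resolve_left hα]
  · have h4 : Δ (lin b x * p) = lin b x * Δ p + (-((1 - α v)⁻¹ * x v) • 1) * polyAct b ρ s p := by
      apply mul_right_injective₀ hα
      have h5 := hΔ p
      have h6 := hx x
      change lin b α * Δ _ = lin b α * _
      rw [hΔ, map_mul, mul_add, ← mul_assoc, ← mul_assoc, ← h6, mul_comm (lin b α), mul_assoc, h5]
      ring
    rw [LinearMap.smul_apply, h4, LinearMap.smul_apply, smul_add, mul_smul_comm, smul_one_mul,
      smul_smul, h y]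
    congr 2
    simp only [sub_sub_cancel, map_smul, smul_eq_mul]
    field_simp

end Polynomials

end Cherednik

end
noncomputable section

namespace Cherednik

/-! ### Dunkl operators -/

section Dunkl

variable {G V W : Type*} [Group G] [AddCommGroup V] [Module ℂ V]
  [AddCommGroup W] [Module ℂ W] {r : ℕ}
  (b : Module.Basis (Fin r) ℂ (Module.Dual ℂ V)) (ρ : Representation ℂ G V)

/-- `ℂ[V] ⊗ W` is reached from the constants by multiplication with covectors alone. Most operator
identities below are checked this way: on constants, and through commutation with covectors. -/
theorem polyHom_ext {N : Type*} [AddCommGroup N] [Module ℂ N]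
    {A B : MvPolynomial (Fin r) ℂ ⊗[ℂ] W →ₗ[ℂ] N} (h1 : ∀ w, A (1 ⊗ₜ w) = B (1 ⊗ₜ w))
    (h2 : ∀ (x : Module.Dual ℂ V) m, A m = B m →
      A ((LinearMap.mulLeft ℂ (lin b x)).rTensor W m) =
        B ((LinearMap.mulLeft ℂ (lin b x)).rTensor W m)) : A = B := by
  refine TensorProduct.ext' fun p w => ?_
  induction p using MvPolynomial.induction_on with
  | C a =>
    rw [MvPolynomial.C_eq_smul_one, ← TensorProduct.smul_tmul', map_smul, map_smul, h1]
  | add p q hp hq => rw [TensorProduct.add_tmul, map_add, map_add, hp, hq]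
  | mul_X p i hp =>
    have := h2 (b i) _ hp
    simpa [mul_comm] using this

/-- Multiplication by a polynomial. -/
def mulOp (W : Type*) [AddCommGroup W] [Module ℂ W] (p : MvPolynomial (Fin r) ℂ) :
    Module.End ℂ (MvPolynomial (Fin r) ℂ ⊗[ℂ] W) :=
  (LinearMap.mulLeft ℂ p).rTensor W

@[simp]
theorem mulOp_tmul (p q : MvPolynomial (Fin r) ℂ) (w : W) :
    mulOp W p (q ⊗ₜ[ℂ] w) = (p * q) ⊗ₜ w := rfl

theorem mulOp_mul (p q : MvPolynomial (Fin r) ℂ) : mulOp W (p * q) = mulOp W p * mulOp W q :=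
  TensorProduct.ext' fun p w => by simp [mul_assoc]

theorem mulOp_comm (p q : MvPolynomial (Fin r) ℂ) : mulOp W p * mulOp W q = mulOp W q * mulOp W p := by
  rw [← mulOp_mul, mul_comm, mulOp_mul]

theorem mulOp_add (p q : MvPolynomial (Fin r) ℂ) : mulOp W (p + q) = mulOp W p + mulOp W q :=
  TensorProduct.ext' fun p w => by simp [add_mul, TensorProduct.add_tmul]

theorem mulOp_smul (a : ℂ) (q : MvPolynomial (Fin r) ℂ) : mulOp W (a • q) = a • mulOp W q :=
  TensorProduct.ext' fun p w => by simp [TensorProduct.smul_tmul']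

/-- The diagonal action of a group element. -/
def grpOp (τ : Representation ℂ G W) (g : G) : Module.End ℂ (MvPolynomial (Fin r) ℂ ⊗[ℂ] W) :=
  TensorProduct.map (polyAct b ρ g).toLinearMap (τ g)

@[simp]
theorem grpOp_tmul (τ : Representation ℂ G W) (g : G) (p : MvPolynomial (Fin r) ℂ) (w : W) :
    grpOp b ρ τ g (p ⊗ₜ w) = polyAct b ρ g p ⊗ₜ τ g w := rfl

theorem grpOp_one (τ : Representation ℂ G W) : grpOp b ρ τ 1 = 1 :=
  TensorProduct.ext' fun p w => by simp [polyAct_one]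

theorem grpOp_mul (τ : Representation ℂ G W) (g h : G) :
    grpOp b ρ τ (g * h) = grpOp b ρ τ g * grpOp b ρ τ h :=
  TensorProduct.ext' fun p w => by simp [polyAct_mul]

theorem grpOp_mulOp (τ : Representation ℂ G W) (g : G) (p : MvPolynomial (Fin r) ℂ) :
    grpOp b ρ τ g * mulOp W p = mulOp W (polyAct b ρ g p) * grpOp b ρ τ g :=
  TensorProduct.ext' fun p w => by simp

/-- An endomorphism that kills the constants and commutes with the linear polynomials, up to an
automorphism, vanishes. -/
theorem end_eq_zero {N : Type*} [AddCommGroup N] [Module ℂ N]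
    {A : MvPolynomial (Fin r) ℂ ⊗[ℂ] W →ₗ[ℂ] N}
    (X : Module.Dual ℂ V → (N →ₗ[ℂ] N)) (h1 : ∀ w, A (1 ⊗ₜ w) = 0)
    (h2 : ∀ x m, A (mulOp W (lin b x) m) = X x (A m)) : A = 0 :=
  polyHom_ext b (by simpa using h1) fun x m hm => by
    change A (mulOp W (lin b x) m) = _
    rw [h2, hm]
    simp

theorem reflForm_add (s : G) (y y' : V) (x : Module.Dual ℂ V) :
    reflForm ρ s (y + y') x = reflForm ρ s y x + reflForm ρ s y' x := by
  simp only [reflForm, map_add, map_sub]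
  ring

theorem reflForm_smul (s : G) (a : ℂ) (y : V) (x : Module.Dual ℂ V) :
    reflForm ρ s (a • y) x = a * reflForm ρ s y x := by
  simp only [reflForm, map_smul, map_sub, smul_eq_mul]
  ring

variable [Fintype G] [FiniteDimensional ℂ V]

open Classical in
/-- The divided difference of a reflection in the direction `y`, and `0` for other elements. -/
def divDiff (s : G) (y : V) : MvPolynomial (Fin r) ℂ →ₗ[ℂ] MvPolynomial (Fin r) ℂ :=
  if hs : IsReflection ρ s then (exists_divided_difference b ρ hs y).choose else 0

variable {ρ} in
theorem divDiff_of_fixed {s : G} (y : V) {p : MvPolynomial (Fin r) ℂ}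
    (hp : polyAct b ρ s p = p) : divDiff b ρ s y p = 0 := by
  unfold divDiff
  split_ifs with hs
  · exact (exists_divided_difference b ρ hs y).choose_spec.1 p hp
  · rfl

variable {ρ} in
theorem divDiff_lin_mul {s : G} (hs : IsReflection ρ s) (y : V) (x : Module.Dual ℂ V)
    (p : MvPolynomial (Fin r) ℂ) :
    divDiff b ρ s y (lin b x * p) =
      lin b x * divDiff b ρ s y p + x (y - ρ s y) • polyAct b ρ s p := by
  rw [divDiff, dif_pos hs]
  exact (exists_divided_difference b ρ hs y).choose_spec.2 x p

open Classical in
/-- The Dunkl operators. -/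
def dunkl (t : ℂ) (c : G → ℂ) (τ : Representation ℂ G W) (y : V) :
    Module.End ℂ (MvPolynomial (Fin r) ℂ ⊗[ℂ] W) :=
  t • (MvPolynomial.mkDerivation ℂ fun i =>
      (MvPolynomial.C (b i y) : MvPolynomial (Fin r) ℂ)).toLinearMap.rTensor W -
    ∑ s : G with IsReflection ρ s,
      (c s / reflDCheck ρ s) • TensorProduct.map (divDiff b ρ s y) (τ s)

variable {ρ} (t : ℂ) (c : G → ℂ) (τ : Representation ℂ G W)

theorem dunkl_one_tmul (y : V) (w : W) : dunkl b ρ t c τ y (1 ⊗ₜ w) = 0 := by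
  classical
  simp [dunkl, LinearMap.sum_apply, divDiff_of_fixed]

open Classical in
-- The derivation contributes `t x(y)`, and the twisted Leibniz rule of each divided difference
-- leaves the term `x (y - s y) s`. The factor `1 / reflDCheck` in `dunkl` turns the latter into
-- `reflForm`.
theorem dunkl_mulOp_lin (y : V) (x : Module.Dual ℂ V) :
    dunkl b ρ t c τ y * mulOp W (lin b x) - mulOp W (lin b x) * dunkl b ρ t c τ y =
      (t * x y) • 1 -
        ∑ s : G with IsReflection ρ s, (c s * reflForm ρ s y x) • grpOp b ρ τ s := by
  refine TensorProduct.ext' fun p w => ?_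
  have hder : MvPolynomial.mkDerivation ℂ (fun i =>
      (MvPolynomial.C (b i y) : MvPolynomial (Fin r) ℂ)) (lin b x) = MvPolynomial.C (x y) := by
    rw [lin_eq_sum, map_sum]
    simp only [Derivation.map_smul, MvPolynomial.mkDerivation_X]
    conv_rhs => rw [← b.sum_repr x, LinearMap.sum_apply, map_sum]
    simp [MvPolynomial.C_eq_smul_one, smul_smul]
  have hs : ∀ s ∈ Finset.univ.filter (fun s : G => IsReflection ρ s),
      ((c s / reflDCheck ρ s) • TensorProduct.map (divDiff b ρ s y) (τ s))
          ((lin b x * p) ⊗ₜ[ℂ] w) =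
        mulOp W (lin b x) (((c s / reflDCheck ρ s) •
          TensorProduct.map (divDiff b ρ s y) (τ s)) (p ⊗ₜ[ℂ] w)) +
        ((c s * reflForm ρ s y x) • grpOp b ρ τ s) (p ⊗ₜ[ℂ] w) := by
    intro s hs
    rw [LinearMap.smul_apply, TensorProduct.map_tmul,
      divDiff_lin_mul b (Finset.mem_filter.mp hs).2, TensorProduct.add_tmul, smul_add,
      LinearMap.smul_apply, TensorProduct.map_tmul, map_smul, mulOp_tmul, LinearMap.smul_apply,
      grpOp_tmul, ← TensorProduct.smul_tmul', smul_smul, reflForm,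
      div_mul_eq_mul_div, mul_div_assoc]
  have e1 : dunkl b ρ t c τ y ((lin b x * p) ⊗ₜ w) =
      mulOp W (lin b x) (dunkl b ρ t c τ y (p ⊗ₜ w)) + (t * x y) • (p ⊗ₜ w) -
      ∑ s : G with IsReflection ρ s,
        ((c s * reflForm ρ s y x) • grpOp b ρ τ s) (p ⊗ₜ[ℂ] w) := by
    rw [dunkl, LinearMap.sub_apply, LinearMap.sum_apply, Finset.sum_congr rfl hs,
      Finset.sum_add_distrib, LinearMap.sub_apply, LinearMap.sum_apply, map_sub, map_sum]
    simp only [LinearMap.smul_apply, LinearMap.rTensor_tmul, Derivation.coeFn_coe,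
      Derivation.leibniz, hder, TensorProduct.add_tmul, map_smul, mulOp_tmul, smul_eq_mul]
    have : (p * MvPolynomial.C (x y)) ⊗ₜ[ℂ] w = x y • (p ⊗ₜ[ℂ] w) := by
      rw [mul_comm, ← MvPolynomial.smul_eq_C_mul, TensorProduct.smul_tmul']
    rw [this, mul_smul, smul_add]
    abel
  rw [LinearMap.sub_apply, Module.End.mul_apply, Module.End.mul_apply, mulOp_tmul, e1,
    LinearMap.sub_apply, LinearMap.sum_apply, LinearMap.smul_apply, Module.End.one_apply]
  abel

open Classical in
theorem dunkl_mulOp_lin_apply (y : V) (x : Module.Dual ℂ V) (m : MvPolynomial (Fin r) ℂ ⊗[ℂ] W) :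
    dunkl b ρ t c τ y (mulOp W (lin b x) m) = mulOp W (lin b x) (dunkl b ρ t c τ y m) +
      (t * x y) • m -
        ∑ s : G with IsReflection ρ s, (c s * reflForm ρ s y x) • grpOp b ρ τ s m := by
  have h := LinearMap.congr_fun (dunkl_mulOp_lin b (ρ := ρ) t c τ y x) m
  simp only [LinearMap.sub_apply, Module.End.mul_apply, LinearMap.smul_apply,
    Module.End.one_apply, LinearMap.sum_apply] at h
  rw [add_sub_assoc, ← h]
  abel

/-- `divDiff` is chosen separately for each `y`, so additivity is not visible from the definition.
The defect kills the constants, and it commutes with covectors because the commutators are additive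
in `y`; hence it vanishes. -/
theorem dunkl_add (y y' : V) :
    dunkl b ρ t c τ (y + y') = dunkl b ρ t c τ y + dunkl b ρ t c τ y' := by
  classical
  rw [← sub_eq_zero]
  refine end_eq_zero b (fun x => mulOp W (lin b x)) (by simp [dunkl_one_tmul]) fun x m => ?_
  simp only [LinearMap.sub_apply, LinearMap.add_apply, dunkl_mulOp_lin_apply, map_add,
    reflForm_add, mul_add, add_smul, Finset.sum_add_distrib, map_sub]
  abel

theorem dunkl_smul (a : ℂ) (y : V) :
    dunkl b ρ t c τ (a • y) = a • dunkl b ρ t c τ y := by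
  classical
  rw [← sub_eq_zero]
  refine end_eq_zero b (fun x => mulOp W (lin b x)) (by simp [dunkl_one_tmul]) fun x m => ?_
  simp only [LinearMap.sub_apply, LinearMap.smul_apply, dunkl_mulOp_lin_apply, map_smul,
    reflForm_smul, smul_eq_mul, map_sub, smul_add, smul_sub, Finset.smul_sum, smul_smul]
  have h1 : t * (a * x y) = a * (t * x y) := by ring
  have h2 : ∀ s, c s * (a * reflForm ρ s y x) = a * (c s * reflForm ρ s y x) := fun s => by ring
  simp only [h1, h2]
  abel

variable {c} (hc : ∀ s g : G, IsReflection ρ s → c (g * s * g⁻¹) = c s)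

include hc in
theorem grpOp_dunkl (g : G) (y : V) :
    grpOp b ρ τ g * dunkl b ρ t c τ y = dunkl b ρ t c τ (ρ g y) * grpOp b ρ τ g := by
  classical
  rw [← sub_eq_zero]
  refine end_eq_zero b (fun x => mulOp W (lin b (ρ.dual g x)))
    (by simp [dunkl_one_tmul]) fun x m => ?_
  have hgm : ∀ m, grpOp b ρ τ g (mulOp W (lin b x) m) =
      mulOp W (lin b (ρ.dual g x)) (grpOp b ρ τ g m) := fun m => by
    have := LinearMap.congr_fun (grpOp_mulOp b ρ τ g (lin b x)) m
    rwa [polyAct_lin] at this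
  have hxg : ρ.dual g x (ρ g y) = x y := by
    change x (ρ g⁻¹ (ρ g y)) = x y
    rw [← Module.End.mul_apply, ← map_mul, inv_mul_cancel, map_one, Module.End.one_apply]
  -- Conjugation by `g` permutes the reflections and carries `reflForm` along; with the invariance
  -- of `c` the sum is only reindexed.
  have hsum : ∑ s : G with IsReflection ρ s,
        (c s * reflForm ρ s (ρ g y) (ρ.dual g x)) • grpOp b ρ τ s (grpOp b ρ τ g m) =
      ∑ s : G with IsReflection ρ s,
        (c s * reflForm ρ s y x) • grpOp b ρ τ g (grpOp b ρ τ s m) := by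
    refine (Finset.sum_bij (fun s _ => g * s * g⁻¹) ?_ ?_ ?_ ?_).symm
    · intro s hs
      simp only [Finset.mem_filter, Finset.mem_univ, true_and] at hs ⊢
      exact isReflection_conj ρ hs g
    · intro s _ s' _ h
      simpa using h
    · intro s hs
      simp only [Finset.mem_filter, Finset.mem_univ, true_and] at hs
      exact ⟨g⁻¹ * s * g, by simpa using isReflection_conj ρ hs g⁻¹, by group⟩
    · intro s hs
      simp only [Finset.mem_filter, Finset.mem_univ, true_and] at hs
      rw [hc s g hs, ← Module.End.mul_apply, ← grpOp_mul, ← Module.End.mul_apply, ← grpOp_mul,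
        inv_mul_cancel_right, reflForm, reflForm, reflDCheck, reflDCheck, reflEigenvalue_conj]
      congr 3
      change _ = x (ρ g⁻¹ _)
      have : ρ (g * s * g⁻¹) (ρ g y) = ρ g (ρ s y) := by
        simp only [← Module.End.mul_apply, ← map_mul, inv_mul_cancel_right]
      rw [this, ← map_sub, ← Module.End.mul_apply, ← map_mul, inv_mul_cancel, map_one,
        Module.End.one_apply]
  simp only [LinearMap.sub_apply, Module.End.mul_apply, dunkl_mulOp_lin_apply, hgm, map_sub,
    map_add, map_sum, map_smul, hxg, hsum]
  abel

include hc in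
-- By the Jacobi identity it is enough that `[D_y, [D_{y'}, x]]` is symmetric in `y` and `y'`. The
-- scalar part of the inner commutator drops out. For a reflection `s`, equivariance gives `[D_y, s]
-- = α(y) D_v s`, and the coefficient of `s` in the inner commutator is proportional to `α(y')`, so
-- each summand is symmetric.
theorem dunkl_comm (y y' : V) :
    dunkl b ρ t c τ y * dunkl b ρ t c τ y' = dunkl b ρ t c τ y' * dunkl b ρ t c τ y := by
  classical
  rw [← sub_eq_zero]
  refine end_eq_zero b (fun x => mulOp W (lin b x)) (by simp [dunkl_one_tmul]) fun x m => ?_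
  have hsym : ∀ y y' : V, ∀ s ∈ Finset.univ.filter (fun s : G => IsReflection ρ s),
      (c s * reflForm ρ s y' x) • dunkl b ρ t c τ y (grpOp b ρ τ s m) -
        (c s * reflForm ρ s y' x) • grpOp b ρ τ s (dunkl b ρ t c τ y m) =
      (c s * reflForm ρ s y x) • dunkl b ρ t c τ y' (grpOp b ρ τ s m) -
        (c s * reflForm ρ s y x) • grpOp b ρ τ s (dunkl b ρ t c τ y' m) := by
    intro y y' s hs
    obtain ⟨α, v, h, -⟩ := exists_sub_smul_of_isReflection ρ (Finset.mem_filter.mp hs).2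
    have key : ∀ y, dunkl b ρ t c τ y (grpOp b ρ τ s m) - grpOp b ρ τ s (dunkl b ρ t c τ y m) =
        α y • dunkl b ρ t c τ v (grpOp b ρ τ s m) := by
      intro y
      have := LinearMap.congr_fun (grpOp_dunkl b t τ hc s y) m
      rw [Module.End.mul_apply, Module.End.mul_apply] at this
      rw [this, h, sub_eq_add_neg y, ← neg_smul, dunkl_add, dunkl_smul]
      simp
    have hform : ∀ y, reflForm ρ s y x = α y * (x v / reflDCheck ρ s) := fun y => by
      rw [reflForm, h, sub_sub_cancel, map_smul, smul_eq_mul, mul_div_assoc]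
    refine (smul_sub _ _ _).symm.trans (Eq.trans ?_ (smul_sub _ _ _))
    rw [key, key, hform, hform, smul_smul, smul_smul]
    congr 1
    ring
  have hsum := Finset.sum_congr rfl (hsym y y')
  rw [Finset.sum_sub_distrib, Finset.sum_sub_distrib] at hsum
  simp only [LinearMap.sub_apply, Module.End.mul_apply, dunkl_mulOp_lin_apply,
    map_sub, map_add, map_sum, map_smul]
  rw [sub_eq_iff_eq_add] at hsum
  rw [hsum]
  abel

/-- The polynomial representation of the rational Cherednik algebra on `ℂ[V] ⊗ W`. -/
def polyRep : Cherednik ρ t c →ₐ[ℂ] Module.End ℂ (MvPolynomial (Fin r) ℂ ⊗[ℂ] W) :=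
  RingQuot.liftAlgHom ℂ ⟨FreeAlgebra.lift ℂ fun
    | .y v => dunkl b ρ t c τ v
    | .x f => mulOp W (lin b f)
    | .g a => grpOp b ρ τ a, by
    classical
    intro p q h
    induction h with
    | y_add v w => simp [dunkl_add]
    | y_smul a v => simp [dunkl_smul]
    | x_add v w => simp [mulOp_add]
    | x_smul a v => simp [mulOp_smul]
    | g_one => simp [grpOp_one]
    | g_mul a b => simp [grpOp_mul]
    | y_comm v w => simpa using dunkl_comm b t τ hc v w
    | x_comm v w => simpa using mulOp_comm _ _
    | g_y a v => simpa using grpOp_dunkl b t τ hc a v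
    | g_x a f => simpa [polyAct_lin] using grpOp_mulOp b ρ τ a (lin b f)
    | y_x v f =>
      rw [map_sub, map_mul, map_mul, map_sub, map_sum]
      simpa using dunkl_mulOp_lin b t c τ v f⟩

theorem polyRep_of (a : CherednikGen G V) : polyRep b t τ hc (of ρ t c a) =
    match a with
    | .y v => dunkl b ρ t c τ v
    | .x f => mulOp W (lin b f)
    | .g a => grpOp b ρ τ a := by
  have h : polyRep b t τ hc (of ρ t c a) = _ :=
    (RingQuot.liftAlgHom_mkAlgHom_apply ℂ _ _ _).trans (FreeAlgebra.lift_ι_apply _ _)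
  rw [h]

end Dunkl

end Cherednik

end
noncomputable section

/-! ### Eigenspace gradings and traces -/

namespace Cherednik

section Eigenspaces

variable {N : Type*} [AddCommGroup N] [Module ℂ N] (D : Module.End ℂ N)

theorem iSupIndep_eigenspace_nat : iSupIndep fun n : ℕ => D.eigenspace (n : ℂ) :=
  D.eigenspaces_iSupIndep.comp Nat.cast_injective

/-- A spanning family inside an independent one leaves no room for a strict inclusion. This
identifies components given by generators, or by images, with eigenspaces of a degree operator. -/
theorem eq_of_le_of_iSupIndep {ι : Type*} {A B : ι → Submodule ℂ N} (hAB : ∀ i, A i ≤ B i)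
    (hA : ⨆ i, A i = ⊤) (hB : iSupIndep B) (i : ι) : A i = B i := by
  refine le_antisymm (hAB i) fun x hx => ?_
  have h1 : x ∈ A i ⊔ ⨆ j, ⨆ (_ : j ≠ i), A j := by
    have : (⊤ : Submodule ℂ N) ≤ A i ⊔ ⨆ j, ⨆ (_ : j ≠ i), A j := by
      rw [← hA]
      refine iSup_le fun j => ?_
      by_cases hj : j = i
      · subst hj; exact le_sup_left
      · exact le_sup_of_le_right (le_iSup₂_of_le j hj le_rfl)
    exact this trivial
  obtain ⟨a, ha, a', ha', rfl⟩ := Submodule.mem_sup.mp h1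
  have h2 : a' ∈ B i := by simpa using sub_mem hx (hAB i ha)
  have h3 : a' ∈ ⨆ j, ⨆ (_ : j ≠ i), B j := iSup₂_mono (fun j _ => hAB j) ha'
  rw [Submodule.disjoint_def.mp (hB i) a' h2 h3, add_zero]
  exact ha

variable {D}

/-- Applying `D - φ a` removes the term of index `a` and rescales the others by nonzero factors, so
induction applies. It follows that subspaces stable under a degree operator are graded. -/
theorem mem_of_sum_mem {ι : Type*} {φ : ι → ℂ} (hφ : Function.Injective φ) {K : Submodule ℂ N}
    (hK : ∀ m ∈ K, D m ∈ K) (s : Finset ι) :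
    ∀ m : ι → N, (∀ i, m i ∈ D.eigenspace (φ i)) → ∑ i ∈ s, m i ∈ K → ∀ i ∈ s, m i ∈ K := by
  classical
  induction s using Finset.induction_on with
  | empty => simp
  | insert a s ha ih =>
    intro m hm hs
    have h1 : ∑ i ∈ s, (φ i - φ a) • m i ∈ K := by
      have h2 : D (∑ i ∈ insert a s, m i) - φ a • ∑ i ∈ insert a s, m i =
          ∑ i ∈ s, (φ i - φ a) • m i := by
        rw [map_sum, Finset.smul_sum, ← Finset.sum_sub_distrib, Finset.sum_insert ha]
        simp only [Module.End.mem_eigenspace_iff.mp (hm _), sub_smul, sub_self, zero_add]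
      rw [← h2]
      exact sub_mem (hK _ hs) (K.smul_mem _ hs)
    have h3 := ih (fun i => (φ i - φ a) • m i) (fun i => Submodule.smul_mem _ _ (hm i)) h1
    have h4 : ∀ i ∈ s, m i ∈ K := fun i hi => by
      have hne : φ i - φ a ≠ 0 := sub_ne_zero.mpr fun h => ha (hφ h ▸ hi)
      simpa [smul_smul, inv_mul_cancel₀ hne] using K.smul_mem (φ i - φ a)⁻¹ (h3 i hi)
    intro i hi
    rcases Finset.mem_insert.mp hi with rfl | hi
    · rw [Finset.sum_insert ha] at hs
      simpa using sub_mem hs (sum_mem h4)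
    · exact h4 i hi

theorem mem_iSup_inf_eigenspace {ι : Type*} {φ : ι → ℂ} (hφ : Function.Injective φ)
    {K : Submodule ℂ N} (hK : ∀ m ∈ K, D m ∈ K) {m : N} (hm : m ∈ K)
    (hm' : m ∈ ⨆ i, D.eigenspace (φ i)) : m ∈ ⨆ i, K ⊓ D.eigenspace (φ i) := by
  obtain ⟨f, hf, rfl⟩ := (Submodule.mem_iSup_iff_exists_finsupp _ _).mp hm'
  refine sum_mem fun i hi => Submodule.mem_iSup_of_mem i ⟨?_, hf i⟩
  exact mem_of_sum_mem hφ hK f.support (fun i => f i) hf hm i hi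

theorem map_eigenspace_of_injective {N' : Type*} [AddCommGroup N'] [Module ℂ N']
    {D' : Module.End ℂ N'} {f : N' →ₗ[ℂ] N} (hf : ∀ m, f (D' m) = D (f m))
    (hinj : Function.Injective f) (μ : ℂ) :
    (D'.eigenspace μ).map f = LinearMap.range f ⊓ D.eigenspace μ := by
  ext m
  simp only [Submodule.mem_map, Module.End.mem_eigenspace_iff, LinearMap.mem_range,
    Submodule.mem_inf]
  constructor
  · rintro ⟨a, ha, rfl⟩
    exact ⟨⟨a, rfl⟩, by rw [← hf, ha, map_smul]⟩
  · rintro ⟨⟨a, rfl⟩, h⟩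
    exact ⟨a, hinj (by rw [hf, h, map_smul]), rfl⟩

theorem mem_iSup_eigenspace_of_injective {N' : Type*} [AddCommGroup N'] [Module ℂ N']
    {D' : Module.End ℂ N'} {f : N' →ₗ[ℂ] N} (hf : ∀ m, f (D' m) = D (f m))
    (hinj : Function.Injective f) {ι : Type*} {φ : ι → ℂ} (hφ : Function.Injective φ) {m : N'}
    (hm : f m ∈ ⨆ i, D.eigenspace (φ i)) : m ∈ ⨆ i, D'.eigenspace (φ i) := by
  have hK : ∀ m ∈ LinearMap.range f, D m ∈ LinearMap.range f := by
    rintro _ ⟨m, rfl⟩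
    exact ⟨_, hf m⟩
  have h := mem_iSup_inf_eigenspace hφ hK ⟨m, rfl⟩ hm
  simp only [← map_eigenspace_of_injective hf hinj, ← Submodule.map_iSup] at h
  obtain ⟨m', hm', h⟩ := h
  rwa [← hinj h]

theorem map_mem_eigenspace {N' : Type*} [AddCommGroup N'] [Module ℂ N'] {D' : Module.End ℂ N'}
    {f : N →ₗ[ℂ] N'} (hf : ∀ m, f (D m) = D' (f m)) {μ : ℂ} {m : N} (hm : m ∈ D.eigenspace μ) :
    f m ∈ D'.eigenspace μ := by
  rw [Module.End.mem_eigenspace_iff] at hm ⊢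
  rw [← hf, hm, map_smul]

theorem map_mem_iSup_eigenspace {N' : Type*} [AddCommGroup N'] [Module ℂ N']
    {D' : Module.End ℂ N'} {f : N →ₗ[ℂ] N'} (hf : ∀ m, f (D m) = D' (f m)) {ι : Type*} {φ : ι → ℂ}
    {m : N} (hm : m ∈ ⨆ i, D.eigenspace (φ i)) : f m ∈ ⨆ i, D'.eigenspace (φ i) := by
  induction hm using Submodule.iSup_induction' with
  | mem i m hm => exact Submodule.mem_iSup_of_mem i (map_mem_eigenspace hf hm)
  | zero => rw [map_zero]; exact zero_mem _
  | add x y _ _ hx hy => rw [map_add]; exact add_mem hx hy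

theorem map_eigenspace_of_surjective {N' : Type*} [AddCommGroup N'] [Module ℂ N']
    {D' : Module.End ℂ N'} {f : N →ₗ[ℂ] N'} (hf : ∀ m, f (D m) = D' (f m))
    (hsurj : Function.Surjective f) (htop : ⨆ n : ℕ, D.eigenspace (n : ℂ) = ⊤) (n : ℕ) :
    (D.eigenspace (n : ℂ)).map f = D'.eigenspace (n : ℂ) := by
  refine eq_of_le_of_iSupIndep (A := fun n : ℕ => (D.eigenspace (n : ℂ)).map f) (fun i => ?_) ?_
    (iSupIndep_eigenspace_nat D') n
  · rintro _ ⟨m, hm, rfl⟩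
    exact map_mem_eigenspace hf hm
  · rw [← Submodule.map_iSup, htop, Submodule.map_top, LinearMap.range_eq_top.mpr hsurj]

theorem eigenspace_eq_span_of_basis {ι : Type*} (B : Module.Basis ι ℂ N) {d : ι → ℂ}
    (hB : ∀ i, D (B i) = d i • B i) (μ : ℂ) :
    D.eigenspace μ = Submodule.span ℂ (Set.range fun i : {i // d i = μ} => B i) := by
  have hrepr : ∀ m i, B.repr (D m) i = d i * B.repr m i := by
    intro m i
    have : (Finsupp.lapply i ∘ₗ B.repr.toLinearMap) ∘ₗ D =
        d i • (Finsupp.lapply i ∘ₗ B.repr.toLinearMap) := by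
      refine B.ext fun j => ?_
      simp only [LinearMap.comp_apply, hB, map_smul, LinearEquiv.coe_coe, Module.Basis.repr_self,
        Finsupp.lapply_apply, LinearMap.smul_apply, smul_eq_mul]
      by_cases hij : j = i
      · rw [hij]
      · simp [hij]
    exact LinearMap.congr_fun this m
  apply le_antisymm
  · intro m hm
    rw [← B.linearCombination_repr m]
    refine Submodule.sum_mem _ fun i hi => ?_
    refine Submodule.smul_mem _ _ (Submodule.subset_span ⟨⟨i, ?_⟩, rfl⟩)
    have h1 := hrepr m i
    rw [Module.End.mem_eigenspace_iff.mp hm, map_smul, Finsupp.smul_apply, smul_eq_mul] at h1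
    exact (mul_right_cancel₀ (Finsupp.mem_support_iff.mp hi) h1).symm
  · rw [Submodule.span_le]
    rintro _ ⟨⟨i, hi⟩, rfl⟩
    simp only [SetLike.mem_coe, Module.End.mem_eigenspace_iff]
    rw [hB, hi]

/-- The trace of a diagonal operator on an eigenspace of another diagonal operator. -/
theorem trace_restrict_eigenspace_of_basis {ι : Type*} (B : Module.Basis ι ℂ N) {d : ι → ℂ}
    (hB : ∀ i, D (B i) = d i • B i) (A : Module.End ℂ N) {κ : ι → ℂ}
    (hA : ∀ i, A (B i) = κ i • B i) (μ : ℂ) (hAμ : ∀ m ∈ D.eigenspace μ, A m ∈ D.eigenspace μ)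
    [Fintype {i // d i = μ}] :
    LinearMap.trace ℂ _ (A.restrict hAμ) = ∑ i : {i // d i = μ}, κ i := by
  classical
  have hli : LinearIndependent ℂ fun i : {i // d i = μ} => B i :=
    B.linearIndependent.comp _ Subtype.val_injective
  let B' : Module.Basis {i // d i = μ} ℂ (D.eigenspace μ) :=
    (Module.Basis.span hli).map (LinearEquiv.ofEq _ _ (eigenspace_eq_span_of_basis B hB μ).symm)
  have hB' : ∀ i, (B' i : N) = B i := fun i => by
    simp only [B', Module.Basis.map_apply, LinearEquiv.coe_ofEq_apply, Module.Basis.span_apply]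
  have hAB : ∀ i, A.restrict hAμ (B' i) = κ i • B' i := fun i => by
    apply Subtype.ext
    simp [hB', hA]
  rw [LinearMap.trace_eq_matrix_trace ℂ B', Matrix.trace]
  refine Finset.sum_congr rfl fun i _ => ?_
  rw [Matrix.diag_apply, LinearMap.toMatrix_apply, hAB]
  simp

end Eigenspaces

/-! ### Additivity of traces in exact sequences. -/

section Trace

variable {K A B C : Type*} [AddCommGroup A] [Module ℂ A] [AddCommGroup B] [Module ℂ B]
  [AddCommGroup C] [Module ℂ C] [AddCommGroup K] [Module ℂ K]
  [FiniteDimensional ℂ A] [FiniteDimensional ℂ B] [FiniteDimensional ℂ C] [FiniteDimensional ℂ K]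

/-- Split `q` by any linear section `σ`, which need not respect the operators. Then `i l + σ q = 1`
for some retraction `l`; inserting this under the trace and using cyclicity requires only the two
intertwining relations. -/
theorem trace_eq_add_of_exact {i : A →ₗ[ℂ] B} {q : B →ₗ[ℂ] C} (hi : Function.Injective i)
    (hq : Function.Surjective q) (hiq : LinearMap.ker q = LinearMap.range i)
    {a : Module.End ℂ A} {b : Module.End ℂ B} {c : Module.End ℂ C}
    (hab : b ∘ₗ i = i ∘ₗ a) (hbc : q ∘ₗ b = c ∘ₗ q) :
    LinearMap.trace ℂ B b = LinearMap.trace ℂ A a + LinearMap.trace ℂ C c := by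
  obtain ⟨σ, hσ⟩ := q.exists_rightInverse_of_surjective (LinearMap.range_eq_top.mpr hq)
  have hl : ∀ x, (LinearMap.id - σ ∘ₗ q : B →ₗ[ℂ] B) x ∈ LinearMap.range i := fun x => by
    rw [← hiq, LinearMap.mem_ker]
    have := LinearMap.congr_fun hσ (q x)
    simp only [LinearMap.comp_apply, LinearMap.id_apply] at this
    simp [this]
  let l : B →ₗ[ℂ] A := (LinearEquiv.ofInjective i hi).symm.toLinearMap ∘ₗ
    (LinearMap.id - σ ∘ₗ q : B →ₗ[ℂ] B).codRestrict _ hl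
  have hil : i ∘ₗ l + σ ∘ₗ q = LinearMap.id := by
    rw [← eq_sub_iff_add_eq]
    ext x
    have := LinearEquiv.apply_symm_apply (LinearEquiv.ofInjective i hi)
      ((LinearMap.id - σ ∘ₗ q : B →ₗ[ℂ] B).codRestrict _ hl x)
    exact congrArg Subtype.val this
  have hli : l ∘ₗ i = LinearMap.id := by
    ext x
    apply hi
    have h1 := LinearMap.congr_fun hil (i x)
    have h2 : q (i x) = 0 := by rw [← LinearMap.mem_ker, hiq]; exact ⟨x, rfl⟩
    simpa [h2] using h1
  calc LinearMap.trace ℂ B b = LinearMap.trace ℂ B (b ∘ₗ (i ∘ₗ l + σ ∘ₗ q)) := by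
        rw [hil, LinearMap.comp_id]
    _ = LinearMap.trace ℂ B ((i ∘ₗ a) ∘ₗ l) + LinearMap.trace ℂ B ((b ∘ₗ σ) ∘ₗ q) := by
        rw [LinearMap.comp_add, map_add, ← hab, LinearMap.comp_assoc, LinearMap.comp_assoc]
    _ = LinearMap.trace ℂ A (l ∘ₗ i ∘ₗ a) + LinearMap.trace ℂ C (q ∘ₗ b ∘ₗ σ) := by
        rw [LinearMap.trace_comp_comm', LinearMap.trace_comp_comm' (b ∘ₗ σ)]
    _ = _ := by
        rw [← LinearMap.comp_assoc, hli, LinearMap.id_comp, ← LinearMap.comp_assoc, hbc,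
          LinearMap.comp_assoc, hσ, LinearMap.comp_id]

/-- Cutting at the image of `f` gives two short exact sequences. This is the form needed for the
kernel and cokernel of a map out of a standard module. -/
theorem trace_add_eq_of_exact {i : K →ₗ[ℂ] A} {f : A →ₗ[ℂ] B} {q : B →ₗ[ℂ] C}
    (hi : Function.Injective i) (hif : LinearMap.ker f = LinearMap.range i)
    (hfq : LinearMap.ker q = LinearMap.range f) (hq : Function.Surjective q)
    {k : Module.End ℂ K} {a : Module.End ℂ A} {b : Module.End ℂ B} {c : Module.End ℂ C}
    (hk : a ∘ₗ i = i ∘ₗ k) (ha : f ∘ₗ a = b ∘ₗ f) (hb : q ∘ₗ b = c ∘ₗ q) :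
    LinearMap.trace ℂ B b =
      LinearMap.trace ℂ A a - LinearMap.trace ℂ K k + LinearMap.trace ℂ C c := by
  have hb' : ∀ x ∈ LinearMap.range f, b x ∈ LinearMap.range f := by
    rintro _ ⟨x, rfl⟩
    exact ⟨a x, LinearMap.congr_fun ha x⟩
  have h1 := trace_eq_add_of_exact (i := (LinearMap.range f).subtype) (q := q) (a := b.restrict hb')
    Subtype.val_injective hq (by rw [hfq, Submodule.range_subtype]) (by ext; rfl) hb
  have h2 := trace_eq_add_of_exact (i := i) (q := f.rangeRestrict) (c := b.restrict hb') hi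
    f.surjective_rangeRestrict (by rw [LinearMap.ker_rangeRestrict, hif]) hk
    (by ext x; exact LinearMap.congr_fun ha x)
  rw [h1, h2]
  ring

end Trace

end Cherednik

end
noncomputable section

namespace Cherednik

/-! ### Modules over the Cherednik algebra -/

section Generators

variable {G V : Type*} [Group G] [Fintype G] [AddCommGroup V] [Module ℂ V]
  {ρ : Representation ℂ G V} {t : ℂ} {c : G → ℂ}

theorem adjoin_of : Algebra.adjoin ℂ (Set.range (of ρ t c)) = ⊤ := by
  have h : Function.Surjective (mk ρ t c) := RingQuot.mkAlgHom_surjective ℂ _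
  rw [← AlgHom.range_eq_top] at h
  rw [← h, ← Algebra.map_top, ← FreeAlgebra.adjoin_range_ι, AlgHom.map_adjoin, ← Set.range_comp]
  rfl

@[elab_as_elim]
theorem gen_induction {P : Cherednik ρ t c → Prop} (hof : ∀ a, P (of ρ t c a))
    (hsc : ∀ a : ℂ, P (algebraMap ℂ _ a)) (hadd : ∀ p q, P p → P q → P (p + q))
    (hmul : ∀ p q, P p → P q → P (p * q)) (h : Cherednik ρ t c) : P h := by
  have hh : h ∈ Algebra.adjoin ℂ (Set.range (of ρ t c)) := by rw [adjoin_of]; trivial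
  induction hh using Algebra.adjoin_induction with
  | mem x hx => obtain ⟨a, rfl⟩ := hx; exact hof a
  | algebraMap r => exact hsc r
  | add x y _ _ hx hy => exact hadd x y hx hy
  | mul x y _ _ hx hy => exact hmul x y hx hy

variable (ρ t c) in
theorem of_x_add (f f' : Module.Dual ℂ V) :
    of ρ t c (.x (f + f')) = of ρ t c (.x f) + of ρ t c (.x f') := by
  unfold of
  rw [mk_rel ρ t c (CherednikRel.x_add f f'), map_add]

variable (ρ t c) in
theorem of_x_smul (a : ℂ) (f : Module.Dual ℂ V) :
    of ρ t c (.x (a • f)) = a • of ρ t c (.x f) := by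
  unfold of
  rw [mk_rel ρ t c (CherednikRel.x_smul a f), map_smul]

variable (ρ t c) in
theorem of_y_add (v v' : V) :
    of ρ t c (.y (v + v')) = of ρ t c (.y v) + of ρ t c (.y v') := by
  unfold of
  rw [mk_rel ρ t c (CherednikRel.y_add v v'), map_add]

variable (ρ t c) in
theorem of_y_smul (a : ℂ) (v : V) :
    of ρ t c (.y (a • v)) = a • of ρ t c (.y v) := by
  unfold of
  rw [mk_rel ρ t c (CherednikRel.y_smul a v), map_smul]

variable (ρ t c) in
theorem of_x_comm (f f' : Module.Dual ℂ V) :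
    of ρ t c (.x f) * of ρ t c (.x f') = of ρ t c (.x f') * of ρ t c (.x f) := by
  unfold of
  rw [← map_mul, mk_rel ρ t c (CherednikRel.x_comm f f'), map_mul]

variable (ρ t c) in
theorem of_y_comm (v v' : V) :
    of ρ t c (.y v) * of ρ t c (.y v') = of ρ t c (.y v') * of ρ t c (.y v) := by
  unfold of
  rw [← map_mul, mk_rel ρ t c (CherednikRel.y_comm v v'), map_mul]

variable (ρ t c) in
theorem of_g_y (a : G) (v : V) :
    of ρ t c (.g a) * of ρ t c (.y v) = of ρ t c (.y (ρ a v)) * of ρ t c (.g a) := by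
  unfold of
  rw [← map_mul, mk_rel ρ t c (CherednikRel.g_y a v), map_mul]

open Classical in
variable (ρ t c) in
theorem of_y_x (v : V) (f : Module.Dual ℂ V) :
    of ρ t c (.y v) * of ρ t c (.x f) = of ρ t c (.x f) * of ρ t c (.y v) + ((t * f v) • 1 -
      ∑ s : G with IsReflection ρ s, (c s * reflForm ρ s v f) • of ρ t c (.g s)) := by
  rw [← sub_eq_iff_eq_add']
  unfold of
  rw [← map_mul, ← map_mul, ← map_sub, mk_rel ρ t c (CherednikRel.y_x v f), map_sub, map_sum]
  simp only [map_smul, map_one]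

section

variable {M : Type*} [AddCommGroup M] [Module (Cherednik ρ t c) M]

theorem y_smul_x_smul (v : V) (f : Module.Dual ℂ V) (m : M) :
    of ρ t c (.y v) • of ρ t c (.x f) • m =
      of ρ t c (.x f) • of ρ t c (.y v) • m + ((t * f v) • 1 -
        ∑ s ∈ (Set.toFinite {s : G | IsReflection ρ s}).toFinset,
          (c s * reflForm ρ s v f) • of ρ t c (.g s)) • m := by
  classical
  rw [← mul_smul, of_y_x, add_smul, mul_smul]
  congr 6
  ext; simp

theorem g_smul_x_smul (a : G) (f : Module.Dual ℂ V) (m : M) :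
    of ρ t c (.g a) • of ρ t c (.x f) • m = of ρ t c (.x (ρ.dual a f)) • of ρ t c (.g a) • m := by
  rw [← mul_smul, of_g_x, mul_smul]

end

variable {M N : Type*} [AddCommGroup M] [Module ℂ M] [Module (Cherednik ρ t c) M]
  [IsScalarTower ℂ (Cherednik ρ t c) M] [AddCommGroup N] [Module ℂ N] [Module (Cherednik ρ t c) N]
  [IsScalarTower ℂ (Cherednik ρ t c) N]

theorem map_smul_of_gen (f : M →ₗ[ℂ] N) (hf : ∀ a m, f (of ρ t c a • m) = of ρ t c a • f m)
    (h : Cherednik ρ t c) : ∀ m, f (h • m) = h • f m := by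
  induction h using gen_induction with
  | hof a => exact hf a
  | hsc a => intro m; rw [algebraMap_smul, algebraMap_smul, map_smul]
  | hadd p q hp hq => intro m; rw [add_smul, map_add, hp, hq, add_smul]
  | hmul p q hp hq => intro m; rw [mul_smul, hp, hq, mul_smul]

/-- A `ℂ`-linear map that commutes with the generators is linear over the Cherednik algebra. -/
def linearOfGen (f : M →ₗ[ℂ] N) (hf : ∀ a m, f (of ρ t c a • m) = of ρ t c a • f m) :
    M →ₗ[Cherednik ρ t c] N where
  toFun := f
  map_add' := map_add f
  map_smul' h m := map_smul_of_gen f hf h m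

theorem mem_of_gen {K : Submodule ℂ M} (hK : ∀ a, ∀ m ∈ K, of ρ t c a • m ∈ K)
    (h : Cherednik ρ t c) : ∀ m ∈ K, h • m ∈ K := by
  induction h using gen_induction with
  | hof a => exact hK a
  | hsc a => intro m hm; rw [algebraMap_smul]; exact K.smul_mem _ hm
  | hadd p q hp hq => intro m hm; rw [add_smul]; exact add_mem (hp m hm) (hq m hm)
  | hmul p q hp hq => intro m hm; rw [mul_smul]; exact hp _ (hq m hm)

/-- A grading operator on a module over the Cherednik algebra. -/
structure IsGrading (ρ : Representation ℂ G V) (t : ℂ) (c : G → ℂ) {N : Type*} [AddCommGroup N]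
    [Module ℂ N] [Module (Cherednik ρ t c) N] (D : Module.End ℂ N) : Prop where
  x_smul : ∀ f m, D (of ρ t c (.x f) • m) = of ρ t c (.x f) • D m + of ρ t c (.x f) • m
  y_smul : ∀ v m, D (of ρ t c (.y v) • m) = of ρ t c (.y v) • D m - of ρ t c (.y v) • m
  g_smul : ∀ a m, D (of ρ t c (.g a) • m) = of ρ t c (.g a) • D m
  iSup_eq_top : ⨆ n : ℕ, D.eigenspace (n : ℂ) = ⊤
  finite : ∀ n : ℕ, FiniteDimensional ℂ (D.eigenspace (n : ℂ))

namespace IsGrading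

variable {D : Module.End ℂ N}

/-- Gradings pass to quotients. -/
theorem of_surjective (hD : IsGrading ρ t c D) {D' : Module.End ℂ M}
    (f : N →ₗ[Cherednik ρ t c] M) (hsurj : Function.Surjective f)
    (hf : ∀ m, f (D m) = D' (f m)) : IsGrading ρ t c D' := by
  have hf' : ∀ m, f.restrictScalars ℂ (D m) = D' (f.restrictScalars ℂ m) := hf
  have hmap := map_eigenspace_of_surjective hf' hsurj hD.iSup_eq_top
  refine ⟨fun x m => ?_, fun y m => ?_, fun a m => ?_, ?_, fun n => ?_⟩
  · obtain ⟨m, rfl⟩ := hsurj m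
    rw [← map_smul, ← hf, hD.x_smul, map_add, map_smul, hf]
  · obtain ⟨m, rfl⟩ := hsurj m
    rw [← map_smul, ← hf, hD.y_smul, map_sub, map_smul, hf]
  · obtain ⟨m, rfl⟩ := hsurj m
    rw [← map_smul, ← hf, hD.g_smul, map_smul, hf]
  · simp only [← hmap, ← Submodule.map_iSup, hD.iSup_eq_top, Submodule.map_top]
    exact LinearMap.range_eq_top.mpr hsurj
  · rw [← hmap]
    have := hD.finite n
    infer_instance

/-- Gradings pass to submodules. -/
theorem of_injective (hD : IsGrading ρ t c D) {D' : Module.End ℂ M}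
    (f : M →ₗ[Cherednik ρ t c] N) (hinj : Function.Injective f)
    (hf : ∀ m, f (D' m) = D (f m)) : IsGrading ρ t c D' := by
  have hf' : ∀ m, f.restrictScalars ℂ (D' m) = D (f.restrictScalars ℂ m) := hf
  refine ⟨fun x m => ?_, fun y m => ?_, fun a m => ?_, ?_, fun n => ?_⟩
  · apply hinj
    rw [hf, map_smul, hD.x_smul, map_add, map_smul, map_smul, hf]
  · apply hinj
    rw [hf, map_smul, hD.y_smul, map_sub, map_smul, map_smul, hf]
  · apply hinj
    rw [hf, map_smul, hD.g_smul, map_smul, hf]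
  · rw [eq_top_iff]
    intro m _
    refine mem_iSup_eigenspace_of_injective (φ := fun n : ℕ => (n : ℂ)) hf' hinj
      Nat.cast_injective ?_
    rw [hD.iSup_eq_top]
    trivial
  · have := hD.finite n
    have h2 := (map_eigenspace_of_injective hf' hinj (n : ℂ)).trans_le inf_le_right
    have h3 := Submodule.finiteDimensional_of_le h2
    exact LinearEquiv.finiteDimensional (Submodule.equivMapOfInjective
      (f.restrictScalars ℂ) hinj (D'.eigenspace (n : ℂ))).symm

theorem g_smul_mem (hD : IsGrading ρ t c D) (a : G) (μ : ℂ) :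
    ∀ m ∈ D.eigenspace μ, Algebra.lsmul ℂ ℂ N (of ρ t c (.g a)) m ∈ D.eigenspace μ := by
  intro m hm
  rw [Module.End.mem_eigenspace_iff] at hm ⊢
  rw [Algebra.lsmul_coe, hD.g_smul, hm, smul_comm]

/-- The trace of a group element on the component of degree `n`. -/
def tr (hD : IsGrading ρ t c D) (n : ℕ) (a : G) : ℂ :=
  LinearMap.trace ℂ (D.eigenspace (n : ℂ))
    ((Algebra.lsmul ℂ ℂ N (of ρ t c (.g a))).restrict (hD.g_smul_mem a n))

end IsGrading

end Generators

/-! ### The polynomial modules -/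

section Poly

variable {G V W : Type*} [Group G] [Fintype G] [AddCommGroup V] [Module ℂ V]
  [FiniteDimensional ℂ V] [AddCommGroup W] [Module ℂ W] {r : ℕ}
  (b : Module.Basis (Fin r) ℂ (Module.Dual ℂ V)) {ρ : Representation ℂ G V} (t : ℂ) {c : G → ℂ}
  (hc : ∀ s g : G, IsReflection ρ s → c (g * s * g⁻¹) = c s) (τ : Representation ℂ G W)

/-- The space `ℂ[V] ⊗ W` with the action of the Cherednik algebra by Dunkl operators. -/
@[nolint unusedArguments]
def Poly (_b : Module.Basis (Fin r) ℂ (Module.Dual ℂ V)) (_t : ℂ)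
    (_hc : ∀ s g : G, IsReflection ρ s → c (g * s * g⁻¹) = c s) (_τ : Representation ℂ G W) :
    Type _ :=
  MvPolynomial (Fin r) ℂ ⊗[ℂ] W

instance : AddCommGroup (Poly b t hc τ) :=
  inferInstanceAs (AddCommGroup (MvPolynomial (Fin r) ℂ ⊗[ℂ] W))

instance : Module ℂ (Poly b t hc τ) :=
  inferInstanceAs (Module ℂ (MvPolynomial (Fin r) ℂ ⊗[ℂ] W))

instance : Module (Cherednik ρ t c) (Poly b t hc τ) :=
  Module.compHom (MvPolynomial (Fin r) ℂ ⊗[ℂ] W) (polyRep b t τ hc).toRingHom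

theorem poly_smul_def (h : Cherednik ρ t c) (m : Poly b t hc τ) :
    h • m = polyRep b t τ hc h m := rfl

instance : IsScalarTower ℂ (Cherednik ρ t c) (Poly b t hc τ) :=
  ⟨fun a h m => by rw [poly_smul_def, map_smul]; rfl⟩

/-- The identification of `ℂ[V] ⊗ W` with the underlying space of the polynomial module. -/
def toPoly : MvPolynomial (Fin r) ℂ ⊗[ℂ] W ≃ₗ[ℂ] Poly b t hc τ := LinearEquiv.refl ℂ _

/-- The constants of the polynomial module. -/
def polyConst : W →ₗ[ℂ] Poly b t hc τ :=
  (toPoly b t hc τ).toLinearMap ∘ₗ TensorProduct.mk ℂ _ _ 1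

variable {b t hc τ}

theorem x_smul_toPoly (f : Module.Dual ℂ V) (m) :
    of ρ t c (.x f) • toPoly b t hc τ m = toPoly b t hc τ (mulOp W (lin b f) m) := by
  rw [poly_smul_def, polyRep_of]; rfl

theorem g_smul_toPoly (a : G) (m) :
    of ρ t c (.g a) • toPoly b t hc τ m = toPoly b t hc τ (grpOp b ρ τ a m) := by
  rw [poly_smul_def, polyRep_of]; rfl

theorem y_smul_toPoly (v : V) (m) :
    of ρ t c (.y v) • toPoly b t hc τ m = toPoly b t hc τ (dunkl b ρ t c τ v m) := by
  rw [poly_smul_def, polyRep_of]; rfl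

theorem g_smul_polyConst (a : G) (w : W) :
    of ρ t c (.g a) • polyConst b t hc τ w = polyConst b t hc τ (τ a w) := by
  rw [polyConst, LinearMap.comp_apply, LinearEquiv.coe_coe, g_smul_toPoly]
  simp

theorem y_smul_polyConst (v : V) (w : W) :
    of ρ t c (.y v) • polyConst b t hc τ w = 0 := by
  rw [polyConst, LinearMap.comp_apply, LinearEquiv.coe_coe, y_smul_toPoly]
  simp [dunkl_one_tmul]

theorem poly_ext {N : Type*} [AddCommGroup N] [Module ℂ N] {A B : Poly b t hc τ →ₗ[ℂ] N}
    (h1 : ∀ w, A (polyConst b t hc τ w) = B (polyConst b t hc τ w))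
    (h2 : ∀ f m, A m = B m → A (of ρ t c (.x f) • m) = B (of ρ t c (.x f) • m)) : A = B := by
  have : A ∘ₗ (toPoly b t hc τ).toLinearMap = B ∘ₗ (toPoly b t hc τ).toLinearMap := by
    refine polyHom_ext b h1 fun x m hm => ?_
    have := h2 x (toPoly b t hc τ m) hm
    rwa [x_smul_toPoly] at this
  ext m
  exact LinearMap.congr_fun this ((toPoly b t hc τ).symm m)

theorem poly_eq_top (K : Submodule ℂ (Poly b t hc τ))
    (h1 : ∀ w, polyConst b t hc τ w ∈ K) (h2 : ∀ f, ∀ m ∈ K, of ρ t c (.x f) • m ∈ K) : K = ⊤ := by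
  have : K.mkQ = 0 := by
    refine poly_ext (by simpa using h1) fun f m hm => ?_
    simp only [Submodule.mkQ_apply, LinearMap.zero_apply, Submodule.Quotient.mk_eq_zero] at hm ⊢
    exact h2 f m hm
  rw [← Submodule.ker_mkQ K, this, LinearMap.ker_zero]

open scoped IsMulCommutative in
omit [FiniteDimensional ℂ V] in
/-- The polynomial subalgebra of the Cherednik algebra. -/
theorem exists_symHom (b : Module.Basis (Fin r) ℂ (Module.Dual ℂ V)) (ρ : Representation ℂ G V)
    (t : ℂ) (c : G → ℂ) : ∃ F : MvPolynomial (Fin r) ℂ →ₐ[ℂ] Cherednik ρ t c,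
    ∀ f, F (lin b f) = of ρ t c (.x f) := by
  let s : Set (Cherednik ρ t c) := Set.range fun f : Module.Dual ℂ V => of ρ t c (.x f)
  have hs : ∀ a ∈ s, ∀ b ∈ s, a * b = b * a := by
    rintro _ ⟨f, rfl⟩ _ ⟨f', rfl⟩
    exact of_x_comm ρ t c f f'
  -- Evaluation of commutative polynomials needs a commutative target, so it goes through the
  -- subalgebra generated by the covectors.
  have := Algebra.isMulCommutative_adjoin ℂ hs
  let F : MvPolynomial (Fin r) ℂ →ₐ[ℂ] Cherednik ρ t c := (Algebra.adjoin ℂ s).val.comp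
    (MvPolynomial.aeval fun i => ⟨of ρ t c (.x (b i)), Algebra.subset_adjoin ⟨b i, rfl⟩⟩)
  have hX : ∀ i, F (MvPolynomial.X i) = of ρ t c (.x (b i)) := fun i => by
    simp [F]
  let ofx : Module.Dual ℂ V →ₗ[ℂ] Cherednik ρ t c :=
    { toFun := fun f => of ρ t c (.x f), map_add' := of_x_add ρ t c, map_smul' := of_x_smul ρ t c }
  refine ⟨F, fun f => ?_⟩
  have : F.toLinearMap ∘ₗ lin b = ofx := b.ext fun i => by
    rw [LinearMap.comp_apply, lin_basis]; exact hX i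
  exact LinearMap.congr_fun this f

variable {N : Type*} [AddCommGroup N] [Module ℂ N] [Module (Cherednik ρ t c) N]
  [IsScalarTower ℂ (Cherednik ρ t c) N]

/-- The universal property of the polynomial modules. -/
theorem exists_polyLift (e : W →ₗ[ℂ] N) (hg : ∀ a w, e (τ a w) = of ρ t c (.g a) • e w)
    (hy : ∀ v w, of ρ t c (.y v) • e w = 0) :
    ∃ Φ : Poly b t hc τ →ₗ[Cherednik ρ t c] N, ∀ w, Φ (polyConst b t hc τ w) = e w := by
  obtain ⟨F, hF⟩ := exists_symHom b ρ t c
  let φ : Poly b t hc τ →ₗ[ℂ] N := TensorProduct.lift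
    ((LinearMap.lcomp ℂ N e ∘ₗ (Algebra.lsmul ℂ ℂ N).toLinearMap) ∘ₗ F.toLinearMap) ∘ₗ
      (toPoly b t hc τ).symm.toLinearMap
  have hφ : ∀ p w, φ (toPoly b t hc τ (p ⊗ₜ w)) = F p • e w := fun p w => rfl
  have h1 : ∀ w, φ (polyConst b t hc τ w) = e w := fun w => by
    refine (hφ 1 w).trans ?_
    rw [map_one, one_smul]
  have hx : ∀ f m, φ (of ρ t c (.x f) • m) = of ρ t c (.x f) • φ m := fun f m => by
    have : φ ∘ₗ Algebra.lsmul ℂ ℂ (Poly b t hc τ) (of ρ t c (.x f)) ∘ₗ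
        (toPoly b t hc τ).toLinearMap =
        Algebra.lsmul ℂ ℂ N (of ρ t c (.x f)) ∘ₗ φ ∘ₗ (toPoly b t hc τ).toLinearMap := by
      refine TensorProduct.ext' fun p w => ?_
      simp only [LinearMap.comp_apply, Algebra.lsmul_coe, LinearEquiv.coe_coe, x_smul_toPoly,
        mulOp_tmul, hφ, map_mul, hF, mul_smul]
    exact LinearMap.congr_fun this ((toPoly b t hc τ).symm m)
  have hgs : ∀ a m, φ (of ρ t c (.g a) • m) = of ρ t c (.g a) • φ m := fun a m => by
    have : φ ∘ₗ Algebra.lsmul ℂ ℂ (Poly b t hc τ) (of ρ t c (.g a)) =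
        Algebra.lsmul ℂ ℂ N (of ρ t c (.g a)) ∘ₗ φ := by
      refine poly_ext (fun w => ?_) fun f m hm => ?_
      · simp [g_smul_polyConst, h1, hg]
      · simp only [LinearMap.comp_apply, Algebra.lsmul_coe] at hm ⊢
        rw [g_smul_x_smul, hx, hx, g_smul_x_smul, hm]
    exact LinearMap.congr_fun this m
  -- Moving `y` past `x` produces scalars and group elements, so compatibility with `y` needs
  -- compatibility with `g` first.
  have hys : ∀ v m, φ (of ρ t c (.y v) • m) = of ρ t c (.y v) • φ m := fun v m => by
    have : φ ∘ₗ Algebra.lsmul ℂ ℂ (Poly b t hc τ) (of ρ t c (.y v)) =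
        Algebra.lsmul ℂ ℂ N (of ρ t c (.y v)) ∘ₗ φ := by
      refine poly_ext (fun w => ?_) fun f m hm => ?_
      · simp [y_smul_polyConst, h1, hy]
      · simp only [LinearMap.comp_apply, Algebra.lsmul_coe] at hm ⊢
        rw [y_smul_x_smul, hx, y_smul_x_smul, map_add, hx, hm]
        simp only [sub_smul, Finset.sum_smul, smul_assoc, one_smul, map_sub, map_sum, map_smul, hgs]
    exact LinearMap.congr_fun this m
  refine ⟨linearOfGen φ fun a m => ?_, h1⟩
  cases a with
  | y v => exact hys v m
  | x f => exact hx f m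
  | g a => exact hgs a m

theorem polyHom_eq {Φ Ψ : Poly b t hc τ →ₗ[Cherednik ρ t c] N}
    (h : ∀ w, Φ (polyConst b t hc τ w) = Ψ (polyConst b t hc τ w)) : Φ = Ψ := by
  have : Φ.restrictScalars ℂ = Ψ.restrictScalars ℂ := poly_ext h fun f m hm => by
    simp only [LinearMap.coe_restrictScalars, map_smul] at hm ⊢
    rw [hm]
  ext m
  exact LinearMap.congr_fun this m

end Poly

end Cherednik

end
-- Terms of higher degree, and multiplication by covectors.
noncomputable section

namespace Cherednik

/-- The sum of the eigenspaces for the natural numbers greater than `k`. -/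
def gtDeg {N : Type*} [AddCommGroup N] [Module ℂ N] (D : Module.End ℂ N) (k : ℕ) :
    Submodule ℂ N :=
  ⨆ j : {j : ℕ // k < j}, D.eigenspace ((j : ℕ) : ℂ)

theorem eigenspace_le_gtDeg {N : Type*} [AddCommGroup N] [Module ℂ N] (D : Module.End ℂ N)
    {k j : ℕ} (h : k < j) : D.eigenspace (j : ℂ) ≤ gtDeg D k :=
  le_iSup (fun j : {j : ℕ // k < j} => D.eigenspace ((j : ℕ) : ℂ)) ⟨j, h⟩

section

variable {G V : Type*} [Group G] [Fintype G] [AddCommGroup V] [Module ℂ V]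
  {ρ : Representation ℂ G V} {t : ℂ} {c : G → ℂ}
  {N : Type*} [AddCommGroup N] [Module ℂ N] [Module (Cherednik ρ t c) N]
  [IsScalarTower ℂ (Cherednik ρ t c) N] {D : Module.End ℂ N}

theorem x_smul_mem_eigenspace (hD : ∀ (f : Module.Dual ℂ V) m,
    D (of ρ t c (.x f) • m) = of ρ t c (.x f) • D m + of ρ t c (.x f) • m)
    (f : Module.Dual ℂ V) {μ : ℂ} {m : N} (hm : m ∈ D.eigenspace μ) :
    of ρ t c (.x f) • m ∈ D.eigenspace (μ + 1) := by
  rw [Module.End.mem_eigenspace_iff] at hm ⊢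
  rw [hD, hm, smul_comm, add_smul, one_smul]

theorem x_smul_mem_iSup (hD : ∀ (f : Module.Dual ℂ V) m,
    D (of ρ t c (.x f) • m) = of ρ t c (.x f) • D m + of ρ t c (.x f) • m)
    (f : Module.Dual ℂ V) {ι κ : Type*} {φ : ι → ℂ} {ψ : κ → ℂ} (hφ : ∀ i, ∃ j, φ i + 1 = ψ j)
    {m : N} (hm : m ∈ ⨆ i, D.eigenspace (φ i)) :
    of ρ t c (.x f) • m ∈ ⨆ i, D.eigenspace (ψ i) := by
  induction hm using Submodule.iSup_induction' with
  | mem i m hm =>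
    obtain ⟨j, hj⟩ := hφ i
    have := x_smul_mem_eigenspace hD f hm
    rw [hj] at this
    exact Submodule.mem_iSup_of_mem j this
  | zero => rw [smul_zero]; exact zero_mem _
  | add x y _ _ hx hy => rw [smul_add]; exact add_mem hx hy

theorem x_smul_mem_gtDeg (hD : ∀ (f : Module.Dual ℂ V) m,
    D (of ρ t c (.x f) • m) = of ρ t c (.x f) • D m + of ρ t c (.x f) • m)
    (f : Module.Dual ℂ V) {k : ℕ} {m : N} (hm : m ∈ gtDeg D k) :
    of ρ t c (.x f) • m ∈ gtDeg D (k + 1) :=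
  x_smul_mem_iSup hD f (fun i => ⟨⟨i + 1, Nat.succ_lt_succ i.2⟩, by push_cast; rfl⟩) hm

end

/-! ### The grading of the polynomial modules -/

section Poly

variable {G V W : Type*} [Group G] [Fintype G] [AddCommGroup V] [Module ℂ V]
  [FiniteDimensional ℂ V] [AddCommGroup W] [Module ℂ W] {r : ℕ}
  (b : Module.Basis (Fin r) ℂ (Module.Dual ℂ V)) {ρ : Representation ℂ G V} (t : ℂ) {c : G → ℂ}
  (hc : ∀ s g : G, IsReflection ρ s → c (g * s * g⁻¹) = c s) (τ : Representation ℂ G W)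

/-- The Euler operator on polynomials. -/
def euler (r : ℕ) : Derivation ℂ (MvPolynomial (Fin r) ℂ) (MvPolynomial (Fin r) ℂ) :=
  MvPolynomial.mkDerivation ℂ MvPolynomial.X

theorem euler_monomial (a : Fin r →₀ ℕ) :
    euler r (MvPolynomial.monomial a 1) = (a.degree : ℂ) • MvPolynomial.monomial a 1 := by
  induction a using Finsupp.induction_linear with
  | zero => simp
  | add a a' h h' =>
    have : (MvPolynomial.monomial (a + a') 1 : MvPolynomial (Fin r) ℂ) =
        MvPolynomial.monomial a 1 * MvPolynomial.monomial a' 1 := by simp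
    rw [this, Derivation.leibniz, h, h', smul_eq_mul, smul_eq_mul, mul_smul_comm, mul_smul_comm,
      mul_comm (MvPolynomial.monomial a' 1), ← add_smul, map_add]
    push_cast
    rw [add_comm]
  | single i n =>
    rw [← MvPolynomial.X_pow_eq_monomial, Derivation.leibniz_pow, euler,
      MvPolynomial.mkDerivation_X, Finsupp.degree_single, smul_eq_mul]
    rcases n with _ | n
    · simp
    · rw [Nat.add_sub_cancel, ← pow_succ, Nat.cast_smul_eq_nsmul]

omit [FiniteDimensional ℂ V] in
theorem euler_lin (f : Module.Dual ℂ V) : euler r (lin b f) = lin b f := by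
  have : (euler r).toLinearMap ∘ₗ lin b = lin b := b.ext fun i => by simp [euler]
  exact LinearMap.congr_fun this f

/-- The degree operator of the polynomial module. -/
def polyDeg : Module.End ℂ (Poly b t hc τ) :=
  (toPoly b t hc τ).conj ((euler r).toLinearMap.rTensor W)

/-- The projection to the constants. -/
def polyPr : Poly b t hc τ →ₗ[ℂ] W :=
  (TensorProduct.lid ℂ W).toLinearMap ∘ₗ
    (MvPolynomial.aeval (fun _ => (0 : ℂ)) : MvPolynomial (Fin r) ℂ →ₐ[ℂ] ℂ).toLinearMap.rTensor W ∘ₗ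
      (toPoly b t hc τ).symm.toLinearMap

/-- The monomial basis. -/
def polyBasis {κ : Type*} (B : Module.Basis κ ℂ W) :
    Module.Basis ((Fin r →₀ ℕ) × κ) ℂ (Poly b t hc τ) :=
  ((MvPolynomial.basisMonomials (Fin r) ℂ).tensorProduct B).map (toPoly b t hc τ)

variable {b t hc τ}

omit [Fintype G] [FiniteDimensional ℂ V] in
theorem polyBasis_apply {κ : Type*} (B : Module.Basis κ ℂ W) (i) :
    polyBasis b t hc τ B i = toPoly b t hc τ (MvPolynomial.monomial i.1 1 ⊗ₜ B i.2) := by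
  rw [polyBasis, Module.Basis.map_apply, Module.Basis.tensorProduct_apply']
  simp

omit [Fintype G] [FiniteDimensional ℂ V] in
theorem polyDeg_toPoly_tmul (p : MvPolynomial (Fin r) ℂ) (w : W) :
    polyDeg b t hc τ (toPoly b t hc τ (p ⊗ₜ w)) = toPoly b t hc τ (euler r p ⊗ₜ w) := rfl

omit [Fintype G] [FiniteDimensional ℂ V] in
theorem polyDeg_polyBasis {κ : Type*} (B : Module.Basis κ ℂ W) (i) :
    polyDeg b t hc τ (polyBasis b t hc τ B i) =
      (i.1.degree : ℂ) • polyBasis b t hc τ B i := by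
  rw [polyBasis_apply, polyDeg_toPoly_tmul, euler_monomial, ← TensorProduct.smul_tmul', map_smul]

omit [Fintype G] [FiniteDimensional ℂ V] in
theorem polyDeg_polyConst (w : W) : polyDeg b t hc τ (polyConst b t hc τ w) = 0 := by
  refine (polyDeg_toPoly_tmul 1 w).trans ?_
  simp

theorem polyDeg_x_smul (f : Module.Dual ℂ V) (m : Poly b t hc τ) :
    polyDeg b t hc τ (of ρ t c (.x f) • m) =
      of ρ t c (.x f) • polyDeg b t hc τ m + of ρ t c (.x f) • m := by
  have : polyDeg b t hc τ ∘ₗ Algebra.lsmul ℂ ℂ (Poly b t hc τ) (of ρ t c (.x f)) ∘ₗ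
      (toPoly b t hc τ).toLinearMap =
      (Algebra.lsmul ℂ ℂ (Poly b t hc τ) (of ρ t c (.x f)) ∘ₗ polyDeg b t hc τ +
        Algebra.lsmul ℂ ℂ (Poly b t hc τ) (of ρ t c (.x f))) ∘ₗ (toPoly b t hc τ).toLinearMap := by
    refine TensorProduct.ext' fun p w => ?_
    simp only [LinearMap.comp_apply, LinearMap.add_apply, Algebra.lsmul_coe, LinearEquiv.coe_coe,
      x_smul_toPoly, mulOp_tmul, polyDeg_toPoly_tmul, Derivation.leibniz, euler_lin,
      TensorProduct.add_tmul, map_add, smul_eq_mul]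
    rw [mul_comm p]
  exact LinearMap.congr_fun this ((toPoly b t hc τ).symm m)

theorem polyDeg_g_smul (a : G) (m : Poly b t hc τ) :
    polyDeg b t hc τ (of ρ t c (.g a) • m) = of ρ t c (.g a) • polyDeg b t hc τ m := by
  have : polyDeg b t hc τ ∘ₗ Algebra.lsmul ℂ ℂ (Poly b t hc τ) (of ρ t c (.g a)) =
      Algebra.lsmul ℂ ℂ (Poly b t hc τ) (of ρ t c (.g a)) ∘ₗ polyDeg b t hc τ := by
    refine poly_ext (fun w => ?_) fun f m hm => ?_
    · simp [g_smul_polyConst, polyDeg_polyConst]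
    · simp only [LinearMap.comp_apply, Algebra.lsmul_coe] at hm ⊢
      rw [g_smul_x_smul, polyDeg_x_smul, polyDeg_x_smul, smul_add, g_smul_x_smul, g_smul_x_smul, hm]
  exact LinearMap.congr_fun this m

/-- The explicit Dunkl formula plays no role: `y` kills the constants, and the commutator of `y`
with a covector has degree zero, so the claim propagates along multiplication by covectors. -/
theorem polyDeg_y_smul (v : V) (m : Poly b t hc τ) :
    polyDeg b t hc τ (of ρ t c (.y v) • m) =
      of ρ t c (.y v) • polyDeg b t hc τ m - of ρ t c (.y v) • m := by
  have : polyDeg b t hc τ ∘ₗ Algebra.lsmul ℂ ℂ (Poly b t hc τ) (of ρ t c (.y v)) =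
      Algebra.lsmul ℂ ℂ (Poly b t hc τ) (of ρ t c (.y v)) ∘ₗ polyDeg b t hc τ -
        Algebra.lsmul ℂ ℂ (Poly b t hc τ) (of ρ t c (.y v)) := by
    refine poly_ext (fun w => ?_) fun f m hm => ?_
    · simp [y_smul_polyConst, polyDeg_polyConst]
    · simp only [LinearMap.comp_apply, LinearMap.sub_apply, Algebra.lsmul_coe] at hm ⊢
      rw [y_smul_x_smul, polyDeg_x_smul, map_add, smul_add, polyDeg_x_smul, hm, y_smul_x_smul,
        y_smul_x_smul, smul_sub]
      simp only [sub_smul, Finset.sum_smul, smul_assoc, one_smul, map_sub, map_sum, map_smul,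
        polyDeg_g_smul]
      abel
  exact LinearMap.congr_fun this m

theorem iSup_eigenspace_polyDeg : ⨆ n : ℕ, (polyDeg b t hc τ).eigenspace (n : ℂ) = ⊤ := by
  refine poly_eq_top _ (fun w => Submodule.mem_iSup_of_mem 0 ?_) fun f m hm => ?_
  · rw [Module.End.mem_eigenspace_iff, polyDeg_polyConst]; simp
  · exact x_smul_mem_iSup polyDeg_x_smul f (fun i => ⟨i + 1, by push_cast; rfl⟩) hm

theorem finite_degree_fiber {κ : Type*} [Finite κ] (n : ℕ) :
    Finite {i : (Fin r →₀ ℕ) × κ // (i.1.degree : ℂ) = n} := by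
  have : (Set.univ ∩ {a : Fin r →₀ ℕ | a.degree = n}).Finite := by
    refine (Finset.finite_toSet (Finset.univ.finsuppAntidiag n)).subset ?_
    rintro a ⟨-, ha⟩
    simp only [SetLike.mem_coe, Finset.mem_finsuppAntidiag]
    refine ⟨?_, by simp⟩
    rw [← ha, Finsupp.degree_eq_sum]
  rw [Set.univ_inter] at this
  have h2 := (this.prod (Set.finite_univ (α := κ))).to_subtype
  refine Finite.of_injective (β := ↥({a : Fin r →₀ ℕ | a.degree = n} ×ˢ (Set.univ : Set κ)))
    (fun i => ⟨i.1, ⟨by exact_mod_cast i.2, trivial⟩⟩) fun i j h => ?_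
  exact Subtype.ext (Subtype.mk.inj h)

omit [Fintype G] [FiniteDimensional ℂ V] in
theorem finite_eigenspace_polyDeg [FiniteDimensional ℂ W] (n : ℕ) :
    FiniteDimensional ℂ ((polyDeg b t hc τ).eigenspace (n : ℂ)) := by
  rw [eigenspace_eq_span_of_basis (polyBasis b t hc τ (Module.finBasis ℂ W))
    (polyDeg_polyBasis _)]
  have := finite_degree_fiber (r := r) (κ := Fin (Module.finrank ℂ W)) n
  exact FiniteDimensional.span_of_finite ℂ (Set.finite_range _)

theorem isGrading_polyDeg [FiniteDimensional ℂ W] : IsGrading ρ t c (polyDeg b t hc τ) where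
  x_smul := polyDeg_x_smul
  y_smul := polyDeg_y_smul
  g_smul := polyDeg_g_smul
  iSup_eq_top := iSup_eigenspace_polyDeg
  finite := finite_eigenspace_polyDeg

omit [Fintype G] [FiniteDimensional ℂ V] in
theorem polyPr_polyConst (w : W) : polyPr b t hc τ (polyConst b t hc τ w) = w := by
  change TensorProduct.lid ℂ W ((MvPolynomial.aeval (fun _ => (0 : ℂ)) 1) ⊗ₜ w) = w
  simp

theorem polyPr_x_smul (f : Module.Dual ℂ V) (m : Poly b t hc τ) :
    polyPr b t hc τ (of ρ t c (.x f) • m) = 0 := by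
  have h0 : MvPolynomial.aeval (fun _ => (0 : ℂ)) (lin b f) = 0 := by
    simp [lin_eq_sum]
  have : polyPr b t hc τ ∘ₗ Algebra.lsmul ℂ ℂ (Poly b t hc τ) (of ρ t c (.x f)) ∘ₗ
      (toPoly b t hc τ).toLinearMap = 0 := by
    refine TensorProduct.ext' fun p w => ?_
    simp only [LinearMap.comp_apply, Algebra.lsmul_coe, LinearEquiv.coe_coe, x_smul_toPoly,
      mulOp_tmul, polyPr, LinearEquiv.symm_apply_apply, LinearMap.rTensor_tmul,
      AlgHom.toLinearMap_apply, map_mul, h0]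
    simp
  exact LinearMap.congr_fun this ((toPoly b t hc τ).symm m)

theorem polyPr_g_smul (a : G) (m : Poly b t hc τ) :
    polyPr b t hc τ (of ρ t c (.g a) • m) = τ a (polyPr b t hc τ m) := by
  have : polyPr b t hc τ ∘ₗ Algebra.lsmul ℂ ℂ (Poly b t hc τ) (of ρ t c (.g a)) =
      τ a ∘ₗ polyPr b t hc τ := by
    refine poly_ext (fun w => ?_) fun f m hm => ?_
    · simp [g_smul_polyConst, polyPr_polyConst]
    · simp [g_smul_x_smul, polyPr_x_smul]
  exact LinearMap.congr_fun this m

theorem polyPr_polyDeg (m : Poly b t hc τ) : polyPr b t hc τ (polyDeg b t hc τ m) = 0 := by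
  have : polyPr b t hc τ ∘ₗ polyDeg b t hc τ = 0 := by
    refine poly_ext (fun w => ?_) fun f m hm => ?_
    · simp [polyDeg_polyConst]
    · simp [polyDeg_x_smul, polyPr_x_smul]
  exact LinearMap.congr_fun this m

theorem sub_polyConst_mem_gtDeg (m : Poly b t hc τ) :
    m - polyConst b t hc τ (polyPr b t hc τ m) ∈ gtDeg (polyDeg b t hc τ) 0 := by
  have : Submodule.mkQ (gtDeg (polyDeg b t hc τ) 0) ∘ₗ
      (LinearMap.id - polyConst b t hc τ ∘ₗ polyPr b t hc τ) = 0 := by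
    refine poly_ext (fun w => ?_) fun f m hm => ?_
    · simp [polyPr_polyConst]
    · simp only [LinearMap.comp_apply, LinearMap.sub_apply, LinearMap.id_apply, polyPr_x_smul,
        map_zero, sub_zero, LinearMap.zero_apply, Submodule.mkQ_apply,
        Submodule.Quotient.mk_eq_zero]
      refine x_smul_mem_iSup (φ := fun n : ℕ => (n : ℂ)) polyDeg_x_smul f
        (fun i => ⟨⟨i + 1, Nat.succ_pos i⟩, by push_cast; rfl⟩) ?_
      rw [iSup_eigenspace_polyDeg]
      trivial
  have := LinearMap.congr_fun this m
  simpa only [LinearMap.comp_apply, LinearMap.sub_apply, LinearMap.id_apply, LinearMap.zero_apply,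
    Submodule.mkQ_apply, Submodule.Quotient.mk_eq_zero] using this

theorem polyPr_eq_zero_iff (m : Poly b t hc τ) :
    polyPr b t hc τ m = 0 ↔ m ∈ gtDeg (polyDeg b t hc τ) 0 := by
  constructor
  · intro h
    have := sub_polyConst_mem_gtDeg m
    rwa [h, map_zero, sub_zero] at this
  · intro h
    induction h using Submodule.iSup_induction' with
    | mem i m hm =>
      have h1 := polyPr_polyDeg m
      rw [Module.End.mem_eigenspace_iff.mp hm, map_smul] at h1
      exact (smul_eq_zero.mp h1).resolve_left (Nat.cast_ne_zero.mpr i.2.ne')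
    | zero => rw [map_zero]
    | add x y _ _ hx hy => rw [map_add, hx, hy, add_zero]

theorem eq_polyConst_of_mem_eigenspace_zero {m : Poly b t hc τ}
    (hm : m ∈ (polyDeg b t hc τ).eigenspace 0) :
    m = polyConst b t hc τ (polyPr b t hc τ m) := by
  have h1 := sub_polyConst_mem_gtDeg m
  have h2 : polyConst b t hc τ (polyPr b t hc τ m) ∈ (polyDeg b t hc τ).eigenspace 0 := by
    rw [Module.End.mem_eigenspace_iff, polyDeg_polyConst, zero_smul]
  have h3 := (iSupIndep_eigenspace_nat (polyDeg b t hc τ)) 0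
  rw [Submodule.disjoint_def] at h3
  refine sub_eq_zero.mp (h3 _ (by simpa using sub_mem hm h2) ?_)
  refine (iSup_le fun j => ?_ : gtDeg (polyDeg b t hc τ) 0 ≤ _) h1
  exact le_iSup₂_of_le (j : ℕ) j.2.ne' le_rfl

/-! ### Comparison with the standard modules -/

variable (b t hc τ) in
/-- The canonical map from the standard module to the polynomial module. -/
def stdToPoly : Std ρ t c τ →ₗ[Cherednik ρ t c] Poly b t hc τ :=
  (stdRel ρ t c τ).liftQ (TensorProduct.AlgebraTensorModule.lift
    (LinearMap.toSpanSingleton (Cherednik ρ t c) (W →ₗ[ℂ] Poly b t hc τ) (polyConst b t hc τ))) <| by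
    rw [stdRel, Submodule.span_le]
    rintro _ (⟨a, w, rfl⟩ | ⟨v, w, rfl⟩)
    · simp [g_smul_polyConst]
    · simp [y_smul_polyConst]

theorem stdToPoly_mk (w : W) :
    stdToPoly b t hc τ (Submodule.Quotient.mk (1 ⊗ₜ[ℂ] w)) = polyConst b t hc τ w := by
  simp [stdToPoly]

omit [FiniteDimensional ℂ V] in
theorem std_hom_ext {N : Type*} [AddCommGroup N] [Module ℂ N] [Module (Cherednik ρ t c) N]
    [IsScalarTower ℂ (Cherednik ρ t c) N] {A B : Std ρ t c τ →ₗ[Cherednik ρ t c] N}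
    (h : ∀ w, A (Submodule.Quotient.mk (1 ⊗ₜ[ℂ] w)) = B (Submodule.Quotient.mk (1 ⊗ₜ[ℂ] w))) :
    A = B := by
  refine Submodule.linearMap_qext _ ?_
  refine TensorProduct.AlgebraTensorModule.ext fun x w => ?_
  have : x ⊗ₜ[ℂ] w = x • (1 ⊗ₜ[ℂ] w) := by rw [TensorProduct.smul_tmul', smul_eq_mul, mul_one]
  rw [this, map_smul, map_smul]
  congr 1
  exact h w

omit [FiniteDimensional ℂ V] in
theorem std_mk_g (a : G) (w : W) : (Submodule.Quotient.mk (1 ⊗ₜ[ℂ] τ a w) : Std ρ t c τ) =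
    of ρ t c (.g a) • Submodule.Quotient.mk (1 ⊗ₜ[ℂ] w) := by
  rw [← Submodule.Quotient.mk_smul, TensorProduct.smul_tmul', smul_eq_mul, mul_one]
  exact ((Submodule.Quotient.eq _).mpr (by
    rw [stdRel]; exact Submodule.subset_span (Or.inl ⟨a, w, rfl⟩))).symm

omit [FiniteDimensional ℂ V] in
theorem y_smul_std_mk (v : V) (w : W) :
    of ρ t c (.y v) • (Submodule.Quotient.mk (1 ⊗ₜ[ℂ] w) : Std ρ t c τ) = 0 := by
  rw [← Submodule.Quotient.mk_smul, TensorProduct.smul_tmul', smul_eq_mul, mul_one]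
  exact (Submodule.Quotient.mk_eq_zero _).mpr (by
    rw [stdRel]; exact Submodule.subset_span (Or.inr ⟨v, w, rfl⟩))

/-- This is the part of the PBW theorem that is needed. The map out of `Std` exists because the
Dunkl operators satisfy the relations and kill the constants; the map back is the universal property
of the polynomial module. The two are inverse to each other on generators. -/
theorem exists_stdEquiv : ∃ e : Std ρ t c τ ≃ₗ[Cherednik ρ t c] Poly b t hc τ,
    ∀ w, e (Submodule.Quotient.mk (1 ⊗ₜ[ℂ] w)) = polyConst b t hc τ w := by
  obtain ⟨Φ, hΦ⟩ := exists_polyLift (b := b) (hc := hc) (τ := τ) (N := Std ρ t c τ)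
    ((stdRel ρ t c τ).mkQ.restrictScalars ℂ ∘ₗ TensorProduct.mk ℂ _ _ 1) std_mk_g y_smul_std_mk
  refine ⟨LinearEquiv.ofLinearMap (stdToPoly b t hc τ) Φ ?_ ?_, stdToPoly_mk⟩
  · refine polyHom_eq fun w => ?_
    rw [LinearMap.comp_apply, hΦ, LinearMap.id_apply]
    exact stdToPoly_mk w
  · refine std_hom_ext fun w => ?_
    rw [LinearMap.comp_apply, stdToPoly_mk, hΦ]
    rfl

variable (b t hc τ) in
/-- The standard module is the polynomial module. -/
def stdEquiv : Std ρ t c τ ≃ₗ[Cherednik ρ t c] Poly b t hc τ :=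
  exists_stdEquiv.choose

theorem stdEquiv_mk (w : W) :
    stdEquiv b t hc τ (Submodule.Quotient.mk (1 ⊗ₜ[ℂ] w)) = polyConst b t hc τ w :=
  exists_stdEquiv.choose_spec w

theorem stdEquiv_symm_polyConst (w : W) :
    (stdEquiv b t hc τ).symm (polyConst b t hc τ w) = Submodule.Quotient.mk (1 ⊗ₜ[ℂ] w) := by
  rw [LinearEquiv.symm_apply_eq, stdEquiv_mk]

variable (b t hc τ) in
/-- The degree operator of the standard module. -/
def stdGr : Module.End ℂ (Std ρ t c τ) :=
  ((stdEquiv b t hc τ).symm.restrictScalars ℂ).conj (polyDeg b t hc τ)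

theorem stdEquiv_stdGr (m : Std ρ t c τ) :
    stdEquiv b t hc τ (stdGr b t hc τ m) = polyDeg b t hc τ (stdEquiv b t hc τ m) :=
  (stdEquiv b t hc τ).apply_symm_apply _

theorem isGrading_stdGr [FiniteDimensional ℂ W] : IsGrading ρ t c (stdGr b t hc τ) := by
  refine (isGrading_polyDeg (b := b) (hc := hc) (τ := τ)).of_surjective
    (stdEquiv b t hc τ).symm.toLinearMap (stdEquiv b t hc τ).symm.surjective fun m => ?_
  have := stdEquiv_stdGr (b := b) (hc := hc) ((stdEquiv b t hc τ).symm m)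
  rw [LinearEquiv.apply_symm_apply] at this
  rw [LinearEquiv.coe_coe, LinearEquiv.symm_apply_eq]
  exact this.symm

/-- The degree operator takes the value `n` on `n`-fold products of covectors with constants. These
products exhaust the module, so the eigenspaces contain nothing else. -/
theorem stdDeg_eq_eigenspace [FiniteDimensional ℂ W] (n : ℕ) :
    stdDeg ρ t c τ n = (stdGr b t hc τ).eigenspace (n : ℂ) := by
  refine eq_of_le_of_iSupIndep (fun i => ?_) ?_ (iSupIndep_eigenspace_nat _) n
  · induction i with
    | zero =>
      rw [stdDeg, Submodule.span_le]
      rintro _ ⟨w, rfl⟩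
      rw [SetLike.mem_coe, Module.End.mem_eigenspace_iff, ← (stdEquiv b t hc τ).injective.eq_iff,
        stdEquiv_stdGr, stdEquiv_mk, polyDeg_polyConst]
      simp
    | succ n ih =>
      rw [stdDeg, Submodule.span_le]
      rintro _ ⟨f, m, hm, rfl⟩
      have := x_smul_mem_eigenspace isGrading_stdGr.x_smul f (ih hm)
      exact_mod_cast this
  · have : (⨆ n, stdDeg ρ t c τ n).comap
        ((stdEquiv b t hc τ).symm.toLinearMap.restrictScalars ℂ) = ⊤ := by
      refine poly_eq_top _ (fun w => ?_) fun f m hm => ?_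
      · rw [Submodule.mem_comap]
        refine Submodule.mem_iSup_of_mem 0 ?_
        rw [stdDeg]
        exact Submodule.subset_span ⟨w, stdEquiv_symm_polyConst w⟩
      · rw [Submodule.mem_comap] at hm ⊢
        simp only [LinearMap.coe_restrictScalars, map_smul] at hm ⊢
        generalize (stdEquiv b t hc τ).symm m = m at hm ⊢
        change m ∈ _ at hm
        induction hm using Submodule.iSup_induction' with
        | mem i m hm =>
          refine Submodule.mem_iSup_of_mem (i + 1) ?_
          rw [stdDeg]
          exact Submodule.subset_span ⟨f, m, hm, rfl⟩
        | zero => rw [smul_zero]; exact zero_mem _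
        | add x y _ _ hx hy => rw [smul_add]; exact add_mem hx hy
    rw [eq_top_iff]
    intro m _
    have h : stdEquiv b t hc τ m ∈ (⨆ n, stdDeg ρ t c τ n).comap
        ((stdEquiv b t hc τ).symm.toLinearMap.restrictScalars ℂ) := by rw [this]; trivial
    rw [Submodule.mem_comap] at h
    simpa using h

end Poly

end Cherednik

end
noncomputable section

namespace Cherednik

/-! ### The radical and the simple quotient -/

theorem exists_end_of_surjective {M N : Type*} [AddCommGroup M] [Module ℂ M] [AddCommGroup N]
    [Module ℂ N] (D : Module.End ℂ N) {f : N →ₗ[ℂ] M} (hf : Function.Surjective f)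
    (h : ∀ m, f m = 0 → f (D m) = 0) : ∃ D' : Module.End ℂ M, ∀ m, f (D m) = D' (f m) := by
  obtain ⟨σ, hσ⟩ := f.exists_rightInverse_of_surjective (LinearMap.range_eq_top.mpr hf)
  refine ⟨f ∘ₗ D ∘ₗ σ, fun m => ?_⟩
  have h1 : f (σ (f m)) = f m := LinearMap.congr_fun hσ (f m)
  have h2 := h (m - σ (f m)) (by rw [map_sub, h1, sub_self])
  rw [map_sub, map_sub, sub_eq_zero] at h2
  exact h2

theorem exists_end_of_injective {M N : Type*} [AddCommGroup M] [Module ℂ M] [AddCommGroup N]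
    [Module ℂ N] (D : Module.End ℂ N) {f : M →ₗ[ℂ] N} (hf : Function.Injective f)
    (h : ∀ m, D (f m) ∈ LinearMap.range f) : ∃ D' : Module.End ℂ M, ∀ m, f (D' m) = D (f m) := by
  refine ⟨(LinearEquiv.ofInjective f hf).symm.toLinearMap ∘ₗ (D ∘ₗ f).codRestrict _ h,
    fun m => ?_⟩
  exact congrArg Subtype.val (LinearEquiv.apply_symm_apply (LinearEquiv.ofInjective f hf) _)

theorem trace_restrict_congr {N : Type*} [AddCommGroup N] [Module ℂ N] {p q : Submodule ℂ N}
    (h : p = q) (A : Module.End ℂ N) (hp : ∀ m ∈ p, A m ∈ p) (hq : ∀ m ∈ q, A m ∈ q) :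
    LinearMap.trace ℂ p (A.restrict hp) = LinearMap.trace ℂ q (A.restrict hq) := by
  subst h
  rfl

theorem submodule_eq_bot_or_top {G W : Type*} [Group G] [AddCommGroup W] [Module ℂ W]
    {τ : Representation ℂ G W} (hτ : τ.IsIrreducible) (U : Submodule ℂ W)
    (hU : ∀ a, ∀ w ∈ U, τ a w ∈ U) : U = ⊥ ∨ U = ⊤ := by
  rcases eq_bot_or_eq_top (⟨U, fun a w hw => hU a w hw⟩ : Subrepresentation τ) with h | h
  · exact Or.inl (congrArg Subrepresentation.toSubmodule h)
  · exact Or.inr (congrArg Subrepresentation.toSubmodule h)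

theorem nontrivial_of_isIrreducible {G W : Type*} [Group G] [AddCommGroup W] [Module ℂ W]
    {τ : Representation ℂ G W} (hτ : τ.IsIrreducible) : Nontrivial W := by
  by_contra h
  rw [not_nontrivial_iff_subsingleton] at h
  obtain ⟨a, b, hab⟩ := hτ.toNontrivial
  exact hab (Subrepresentation.toSubmodule_injective (Subsingleton.elim _ _))

section

variable {G V W : Type*} [Group G] [Fintype G] [AddCommGroup V] [Module ℂ V]
  [FiniteDimensional ℂ V] [AddCommGroup W] [Module ℂ W] {r : ℕ}
  {b : Module.Basis (Fin r) ℂ (Module.Dual ℂ V)} {ρ : Representation ℂ G V} {t : ℂ} {c : G → ℂ}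
  {hc : ∀ s g : G, IsReflection ρ s → c (g * s * g⁻¹) = c s} {τ : Representation ℂ G W}

omit [FiniteDimensional ℂ V] in
-- The commutator of the degree operator with the action of `h` is again the action of an element of
-- the algebra. This is what makes `polyRad` stable under the degree operator.
theorem IsGrading.exists_comm {N : Type*} [AddCommGroup N] [Module ℂ N]
    [Module (Cherednik ρ t c) N] [IsScalarTower ℂ (Cherednik ρ t c) N] {D : Module.End ℂ N}
    (hD : IsGrading ρ t c D) (h : Cherednik ρ t c) :
    ∃ h' : Cherednik ρ t c, ∀ m, h • D m = D (h • m) + h' • m := by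
  induction h using gen_induction with
  | hof a =>
    cases a with
    | x f => exact ⟨-of ρ t c (.x f), fun m => by rw [hD.x_smul, neg_smul]; abel⟩
    | y v => exact ⟨of ρ t c (.y v), fun m => by rw [hD.y_smul]; abel⟩
    | g a => exact ⟨0, fun m => by rw [hD.g_smul, zero_smul, add_zero]⟩
  | hsc a =>
    exact ⟨0, fun m => by rw [algebraMap_smul, algebraMap_smul, map_smul, zero_smul, add_zero]⟩
  | hadd p q hp hq =>
    obtain ⟨p', hp⟩ := hp
    obtain ⟨q', hq⟩ := hq
    exact ⟨p' + q', fun m => by rw [add_smul, hp, hq, add_smul, add_smul, map_add]; abel⟩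
  | hmul p q hp hq =>
    obtain ⟨p', hp⟩ := hp
    obtain ⟨q', hq⟩ := hq
    refine ⟨p' * q + p * q', fun m => ?_⟩
    rw [mul_smul, hq, smul_add, hp, add_smul, mul_smul, mul_smul, mul_smul, add_assoc]

variable (b t hc τ) in
/-- The largest submodule of the polynomial module without constants. -/
def polyRad : Submodule (Cherednik ρ t c) (Poly b t hc τ) where
  carrier := {m | ∀ h : Cherednik ρ t c, polyPr b t hc τ (h • m) = 0}
  add_mem' hm hm' h := by rw [smul_add, map_add, hm, hm', add_zero]
  zero_mem' h := by rw [smul_zero, map_zero]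
  smul_mem' h' m hm h := by rw [← mul_smul]; exact hm _

theorem mem_polyRad {m : Poly b t hc τ} :
    m ∈ polyRad b t hc τ ↔ ∀ h : Cherednik ρ t c, polyPr b t hc τ (h • m) = 0 := Iff.rfl

theorem polyDeg_mem_polyRad [FiniteDimensional ℂ W] {m : Poly b t hc τ}
    (hm : m ∈ polyRad b t hc τ) : polyDeg b t hc τ m ∈ polyRad b t hc τ := by
  intro h
  obtain ⟨h', hh⟩ := (isGrading_polyDeg (b := b) (hc := hc) (τ := τ)).exists_comm h
  rw [hh, map_add, polyPr_polyDeg, hm h', add_zero]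

/-- A proper graded submodule meets the constants in a `G`-stable subspace, which is zero by
irreducibility since the constants generate everything. Being graded, it then has no element with
nonzero constant term, and being a submodule it lies in `polyRad`. Conversely `polyRad` is graded
and contains no nonzero constant. -/
theorem stdRad_eq [FiniteDimensional ℂ W] (hτ : τ.IsIrreducible) :
    stdRad ρ t c τ = (polyRad b t hc τ).comap (stdEquiv b t hc τ).toLinearMap := by
  have hW := nontrivial_of_isIrreducible hτ
  apply le_antisymm
  · refine sSup_le fun N ⟨hN, hN'⟩ => ?_
    let U : Submodule ℂ W := (N.restrictScalars ℂ).comap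
      ((stdEquiv b t hc τ).symm.toLinearMap.restrictScalars ℂ ∘ₗ polyConst b t hc τ)
    have hmemU : ∀ w, w ∈ U ↔ (stdEquiv b t hc τ).symm (polyConst b t hc τ w) ∈ N :=
      fun w => Iff.rfl
    have hU : U = ⊥ := by
      refine (submodule_eq_bot_or_top hτ U fun a w hw => ?_).resolve_right fun h => hN' ?_
      · rw [hmemU, ← g_smul_polyConst, map_smul]
        exact N.smul_mem _ hw
      · have : (N.restrictScalars ℂ).comap
            ((stdEquiv b t hc τ).symm.toLinearMap.restrictScalars ℂ) = ⊤ := by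
          refine poly_eq_top _ (fun w => ?_) fun f m hm => ?_
          · exact (hmemU w).mp (by rw [h]; trivial)
          · simp only [Submodule.mem_comap, LinearMap.coe_restrictScalars, map_smul] at hm ⊢
            exact N.smul_mem _ hm
        rw [eq_top_iff]
        intro m _
        have h2 : stdEquiv b t hc τ m ∈ (N.restrictScalars ℂ).comap
            ((stdEquiv b t hc τ).symm.toLinearMap.restrictScalars ℂ) := by rw [this]; trivial
        simpa using h2
    have key : ∀ m ∈ N, polyPr b t hc τ (stdEquiv b t hc τ m) = 0 := by
      intro m hm
      have hm' : m ∈ N.restrictScalars ℂ := hm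
      rw [hN] at hm'
      clear hm
      induction hm' using Submodule.iSup_induction' with
      | mem n m hm =>
        obtain ⟨hm1, hm2⟩ := hm
        rw [stdDeg_eq_eigenspace (b := b) (hc := hc)] at hm2
        have h1 : stdEquiv b t hc τ m ∈ (polyDeg b t hc τ).eigenspace (n : ℂ) :=
          map_mem_eigenspace (f := (stdEquiv b t hc τ).toLinearMap.restrictScalars ℂ)
            stdEquiv_stdGr hm2
        rcases n with _ | n
        · rw [Nat.cast_zero] at h1
          have h2 := eq_polyConst_of_mem_eigenspace_zero h1
          have h3 : polyPr b t hc τ (stdEquiv b t hc τ m) ∈ U := by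
            rw [hmemU, ← h2, LinearEquiv.symm_apply_apply]
            exact hm1
          rwa [hU, Submodule.mem_bot] at h3
        · exact (polyPr_eq_zero_iff _).mpr (eigenspace_le_gtDeg _ (Nat.succ_pos n) h1)
      | zero => rw [map_zero, map_zero]
      | add x y _ _ hx hy => rw [map_add, map_add, hx, hy, add_zero]
    intro m hm h
    change polyPr b t hc τ (h • stdEquiv b t hc τ m) = 0
    rw [← map_smul]
    exact key _ (N.smul_mem _ hm)
  · refine le_sSup ⟨?_, fun h => ?_⟩
    · apply le_antisymm
      · intro m hm
        simp only [stdDeg_eq_eigenspace (b := b) (hc := hc)]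
        refine mem_iSup_inf_eigenspace (φ := fun n : ℕ => (n : ℂ)) Nat.cast_injective ?_ hm ?_
        · intro m hm
          change stdEquiv b t hc τ _ ∈ polyRad b t hc τ
          rw [stdEquiv_stdGr]
          exact polyDeg_mem_polyRad hm
        · rw [(isGrading_stdGr (b := b) (hc := hc)).iSup_eq_top]
          trivial
      · exact iSup_le fun n => inf_le_left
    · obtain ⟨w, hw⟩ := exists_ne (0 : W)
      have h1 : (stdEquiv b t hc τ).symm (polyConst b t hc τ w) ∈
          (polyRad b t hc τ).comap (stdEquiv b t hc τ).toLinearMap := by rw [h]; trivial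
      have h2 := mem_polyRad.mp h1 1
      rw [one_smul, LinearEquiv.coe_coe, LinearEquiv.apply_symm_apply, polyPr_polyConst] at h2
      exact hw h2

variable (b t hc τ) in
/-- The simple module as a quotient of the polynomial module. -/
def polyToSimple : Poly b t hc τ →ₗ[Cherednik ρ t c] Simple ρ t c τ :=
  (stdRad ρ t c τ).mkQ ∘ₗ (stdEquiv b t hc τ).symm.toLinearMap

theorem polyToSimple_surjective : Function.Surjective (polyToSimple b t hc τ) :=
  (Submodule.mkQ_surjective _).comp (stdEquiv b t hc τ).symm.surjective

theorem polyToSimple_eq_zero_iff [FiniteDimensional ℂ W] (hτ : τ.IsIrreducible)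
    {m : Poly b t hc τ} : polyToSimple b t hc τ m = 0 ↔ m ∈ polyRad b t hc τ := by
  rw [polyToSimple, LinearMap.comp_apply, Submodule.mkQ_apply, Submodule.Quotient.mk_eq_zero,
    stdRad_eq (b := b) (hc := hc) hτ, Submodule.mem_comap, LinearEquiv.coe_coe, LinearEquiv.coe_coe,
    LinearEquiv.apply_symm_apply]

theorem exists_simpleGr [FiniteDimensional ℂ W] (b : Module.Basis (Fin r) ℂ (Module.Dual ℂ V))
    (hc : ∀ s g : G, IsReflection ρ s → c (g * s * g⁻¹) = c s) (hτ : τ.IsIrreducible) :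
    ∃ D : Module.End ℂ (Simple ρ t c τ), IsGrading ρ t c D ∧
      (∀ m, polyToSimple b t hc τ (polyDeg b t hc τ m) = D (polyToSimple b t hc τ m)) ∧
      ∀ n, simpleDeg ρ t c τ n = D.eigenspace (n : ℂ) := by
  obtain ⟨D, hD⟩ := exists_end_of_surjective (polyDeg b t hc τ)
    (f := (polyToSimple b t hc τ).restrictScalars ℂ) polyToSimple_surjective fun m hm => by
      rw [LinearMap.coe_restrictScalars, polyToSimple_eq_zero_iff hτ] at hm ⊢
      exact polyDeg_mem_polyRad hm
  have hgr : ∀ m, (stdRad ρ t c τ).mkQ.restrictScalars ℂ (stdGr b t hc τ m) =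
      D ((stdRad ρ t c τ).mkQ.restrictScalars ℂ m) := fun m => by
    have h1 := hD (stdEquiv b t hc τ m)
    rw [← stdEquiv_stdGr] at h1
    simp only [polyToSimple, LinearMap.coe_restrictScalars, LinearMap.comp_apply,
      LinearEquiv.coe_coe, LinearEquiv.symm_apply_apply] at h1
    exact h1
  have hmap := map_eigenspace_of_surjective hgr (Submodule.mkQ_surjective (stdRad ρ t c τ))
    (isGrading_stdGr (b := b) (hc := hc) (τ := τ)).iSup_eq_top
  refine ⟨D, (isGrading_polyDeg (b := b) (hc := hc) (τ := τ)).of_surjective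
    (polyToSimple b t hc τ) polyToSimple_surjective hD, hD, fun n => ?_⟩
  rw [simpleDeg, stdDeg_eq_eigenspace (b := b) (hc := hc), hmap]

omit [FiniteDimensional ℂ V] in
theorem trace_simpleAct {D : Module.End ℂ (Simple ρ t c τ)} (hD : IsGrading ρ t c D)
    (h : ∀ n, simpleDeg ρ t c τ n = D.eigenspace (n : ℂ)) (n : ℕ) (a : G) :
    LinearMap.trace ℂ _ (simpleAct ρ t c τ n a) = hD.tr n a :=
  trace_restrict_congr (h n) _ _ _

/-! ### Finite-dimensionality at `t = 0` -/

/-- The rule for `divDiff` concerns multiplication by covectors only, so linearity over the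
invariants of `s` is proved by induction on the other factor. -/
theorem divDiff_mul_of_fixed {s : G} (hs : IsReflection ρ s) (y : V)
    {p : MvPolynomial (Fin r) ℂ} (hp : polyAct b ρ s p = p) (q : MvPolynomial (Fin r) ℂ) :
    divDiff b ρ s y (p * q) = p * divDiff b ρ s y q := by
  induction q using MvPolynomial.induction_on with
  | C a =>
    rw [MvPolynomial.C_eq_smul_one, mul_smul_comm, mul_one, map_smul, map_smul,
      divDiff_of_fixed b y hp, divDiff_of_fixed b y (map_one _)]
    simp
  | add q q' hq hq' => rw [mul_add, map_add, hq, hq', map_add, mul_add]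
  | mul_X q i hq =>
    have h1 : p * (q * MvPolynomial.X i) = lin b (b i) * (p * q) := by
      rw [lin_basis]; ring
    rw [h1, divDiff_lin_mul b hs, hq, map_mul, hp, mul_comm q, ← lin_basis b i,
      divDiff_lin_mul b hs, mul_add, mul_smul_comm]
    ring

/-- At `t = 0` the derivation disappears from the Dunkl operators, and divided differences are
linear over invariants. So multiplication by an invariant polynomial is an endomorphism of the
module. -/
theorem smul_mulOp_of_invariant (hc : ∀ s g : G, IsReflection ρ s → c (g * s * g⁻¹) = c s)
    {p : MvPolynomial (Fin r) ℂ} (hp : ∀ a, polyAct b ρ a p = p) (h : Cherednik ρ 0 c) (m) :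
    h • toPoly b 0 hc τ (mulOp W p m) =
      toPoly b 0 hc τ (mulOp W p ((toPoly b 0 hc τ).symm (h • toPoly b 0 hc τ m))) := by
  let P : Module.End ℂ (Poly b 0 hc τ) := (toPoly b 0 hc τ).conj (mulOp W p)
  have hP : ∀ m, P (toPoly b 0 hc τ m) = toPoly b 0 hc τ (mulOp W p m) := fun m => rfl
  refine (map_smul_of_gen P (fun a m => ?_) h (toPoly b 0 hc τ m)).symm
  obtain ⟨m, rfl⟩ := (toPoly b 0 hc τ).surjective m
  cases a with
  | x f =>
    rw [x_smul_toPoly, hP, hP, x_smul_toPoly, ← Module.End.mul_apply, mulOp_comm]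
    rfl
  | g a =>
    rw [g_smul_toPoly, hP, hP, g_smul_toPoly, ← Module.End.mul_apply (grpOp b ρ τ a), grpOp_mulOp,
      hp]
    rfl
  | y v =>
    rw [y_smul_toPoly, hP, hP, y_smul_toPoly]
    congr 1
    have : mulOp W p * dunkl b ρ 0 c τ v = dunkl b ρ 0 c τ v * mulOp W p := by
      classical
      refine TensorProduct.ext' fun q w => ?_
      rw [Module.End.mul_apply, Module.End.mul_apply, mulOp_tmul, dunkl, zero_smul,
        LinearMap.sub_apply, LinearMap.sum_apply, LinearMap.sub_apply, LinearMap.sum_apply, map_sub,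
        map_sum, LinearMap.zero_apply, LinearMap.zero_apply, map_zero]
      congr 1
      refine Finset.sum_congr rfl fun s hs => ?_
      rw [LinearMap.smul_apply, LinearMap.smul_apply,
        map_smul, TensorProduct.map_tmul, mulOp_tmul, TensorProduct.map_tmul,
        divDiff_mul_of_fixed (Finset.mem_filter.mp hs).2 v (hp s)]
    exact LinearMap.congr_fun this m

omit [Fintype G] [FiniteDimensional ℂ V] in
theorem polyPr_mulOp (p : MvPolynomial (Fin r) ℂ) (m) :
    polyPr b t hc τ (toPoly b t hc τ (mulOp W p m)) =
      MvPolynomial.aeval (fun _ => (0 : ℂ)) p • polyPr b t hc τ (toPoly b t hc τ m) := by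
  induction m using TensorProduct.induction_on with
  | zero => simp
  | tmul q w =>
    simp only [polyPr, mulOp_tmul, LinearMap.comp_apply, LinearEquiv.coe_coe,
      LinearEquiv.symm_apply_apply, LinearMap.rTensor_tmul, AlgHom.toLinearMap_apply, map_mul,
      TensorProduct.lid_tmul, smul_smul]
  | add x y hx hy => rw [map_add, map_add, map_add, hx, hy, map_add, map_add, smul_add]

theorem mulOp_mem_polyRad {p : MvPolynomial (Fin r) ℂ} (hp : ∀ a, polyAct b ρ a p = p)
    (hp0 : MvPolynomial.aeval (fun _ => (0 : ℂ)) p = 0) (m) :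
    toPoly b 0 hc τ (mulOp W p m) ∈ polyRad b 0 hc τ := by
  intro h
  rw [smul_mulOp_of_invariant hc hp, polyPr_mulOp, hp0, zero_smul]

/-- The covector `f` is a root of the monic polynomial `∏ (X - a f)` over `a ∈ G`. Its coefficients
are invariant, and all but the leading one have no constant term. So `f ^ |G|` lies in the ideal
generated by invariants without constant term, and these map everything into the radical by
`mulOp_mem_polyRad`. -/
theorem mulOp_pow_mem_polyRad (f : Module.Dual ℂ V) (m) :
    toPoly b 0 hc τ (mulOp W (lin b f ^ Fintype.card G) m) ∈ polyRad b 0 hc τ := by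
  let Q : Polynomial (MvPolynomial (Fin r) ℂ) :=
    ∏ a : G, (Polynomial.X - Polynomial.C (polyAct b ρ a (lin b f)))
  have hQ : Q.Monic := Polynomial.monic_prod_of_monic _ _ fun a _ => Polynomial.monic_X_sub_C _
  have hdeg : Q.natDegree = Fintype.card G := by
    rw [Polynomial.natDegree_prod_of_monic _ _ fun a _ => Polynomial.monic_X_sub_C _]
    simp
  have hroot : Q.eval (lin b f) = 0 := by
    rw [Polynomial.eval_prod]
    refine Finset.prod_eq_zero (Finset.mem_univ (1 : G)) ?_
    simp [polyAct_one]
  have hinv : ∀ a k, polyAct b ρ a (Q.coeff k) = Q.coeff k := by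
    intro a k
    have : Q.map (polyAct b ρ a).toRingHom = Q := by
      rw [Polynomial.map_prod]
      refine Fintype.prod_equiv (Equiv.mulLeft a) _ _ fun g => ?_
      simp [polyAct_mul]
    conv_rhs => rw [← this, Polynomial.coeff_map]
    rfl
  have hconst : ∀ k < Fintype.card G,
      MvPolynomial.aeval (fun _ => (0 : ℂ)) (Q.coeff k) = 0 := by
    intro k hk
    have h0 : ∀ a : G, MvPolynomial.aeval (fun _ => (0 : ℂ)) (polyAct b ρ a (lin b f)) = 0 := by
      intro a
      rw [polyAct_lin, lin_eq_sum]
      simp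
    have : Q.map (MvPolynomial.aeval (fun _ => (0 : ℂ)) :
        MvPolynomial (Fin r) ℂ →ₐ[ℂ] ℂ).toRingHom = Polynomial.X ^ Fintype.card G := by
      rw [Polynomial.map_prod, ← Finset.card_univ, ← Finset.prod_const]
      refine Finset.prod_congr rfl fun a _ => ?_
      rw [Polynomial.map_sub, Polynomial.map_X, Polynomial.map_C]
      refine (congrArg (fun z => Polynomial.X - Polynomial.C z) (h0 a)).trans ?_
      rw [map_zero, sub_zero]
    have h2 := congrArg (fun P => Polynomial.coeff P k) this
    simp only [Polynomial.coeff_map, Polynomial.coeff_X_pow, hk.ne, if_false] at h2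
    exact h2
  rw [Polynomial.eval_eq_sum_range, hdeg, Finset.sum_range_succ, ← hdeg, hQ.coeff_natDegree,
    one_mul, hdeg] at hroot
  rw [eq_neg_of_add_eq_zero_right hroot]
  have hsum : mulOp W (-∑ k ∈ Finset.range (Fintype.card G), Q.coeff k * lin b f ^ k) m =
      -∑ k ∈ Finset.range (Fintype.card G),
        mulOp W (Q.coeff k) (mulOp W (lin b f ^ k) m) := by
    let mu : MvPolynomial (Fin r) ℂ →ₗ[ℂ] MvPolynomial (Fin r) ℂ ⊗[ℂ] W :=
      { toFun := fun p => mulOp W p m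
        map_add' := fun p q => by rw [mulOp_add]; rfl
        map_smul' := fun a p => by rw [mulOp_smul]; rfl }
    change mu _ = _
    rw [map_neg, map_sum]
    congr 1
    refine Finset.sum_congr rfl fun k _ => ?_
    change mulOp W _ m = _
    rw [mulOp_mul]
    rfl
  rw [hsum, map_neg, map_sum]
  refine neg_mem (sum_mem fun k hk => ?_)
  exact mulOp_mem_polyRad (fun a => hinv a k) (hconst k (Finset.mem_range.mp hk)) _

/-- The `|G|`-th power of each coordinate acts as zero on the quotient, so monomials with all
exponents at most `|G|` span it; the bound is not meant to be sharp. -/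
theorem finiteDimensional_simple_zero [FiniteDimensional ℂ W]
    (hc : ∀ s g : G, IsReflection ρ s → c (g * s * g⁻¹) = c s) (hτ : τ.IsIrreducible) :
    FiniteDimensional ℂ (Simple ρ 0 c τ) := by
  let b := Module.finBasis ℂ (Module.Dual ℂ V)
  let B := polyBasis b 0 hc τ (Module.finBasis ℂ W)
  let q := (polyToSimple b 0 hc τ).restrictScalars ℂ
  let N : Fin (Module.finrank ℂ (Module.Dual ℂ V)) →₀ ℕ :=
    Finsupp.equivFunOnFinite.symm fun _ => Fintype.card G
  have hfin : (Set.Iic N ×ˢ (Set.univ : Set (Fin (Module.finrank ℂ W)))).Finite :=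
    (Set.finite_Iic N).prod Set.finite_univ
  refine Module.finite_def.mpr (Submodule.fg_def.mpr ⟨_, hfin.image (fun i => q (B i)), ?_⟩)
  rw [eq_top_iff, ← LinearMap.range_eq_top.mpr
    (show Function.Surjective q from polyToSimple_surjective), LinearMap.range_eq_map, ← B.span_eq,
    Submodule.map_span, Submodule.span_le]
  rintro _ ⟨_, ⟨i, rfl⟩, rfl⟩
  by_cases hi : i.1 ≤ N
  · exact Submodule.subset_span ⟨i, ⟨hi, trivial⟩, rfl⟩
  · obtain ⟨k, hk⟩ : ∃ k, Fintype.card G < i.1 k := by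
      by_contra! h
      exact hi fun k => h k
    have h0 : q (B i) = 0 := by
      refine (polyToSimple_eq_zero_iff hτ).mpr ?_
      have hmon : (MvPolynomial.monomial i.1 1 : MvPolynomial _ ℂ) =
          lin b (b k) ^ Fintype.card G *
            MvPolynomial.monomial (i.1 - Finsupp.single k (Fintype.card G)) 1 := by
        rw [lin_basis, MvPolynomial.X_pow_eq_monomial, MvPolynomial.monomial_mul, one_mul,
          add_tsub_cancel_of_le (Finsupp.single_le_iff.mpr hk.le)]
      have hB : B i = toPoly b 0 hc τ (mulOp W (lin b (b k) ^ Fintype.card G)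
          (MvPolynomial.monomial (i.1 - Finsupp.single k (Fintype.card G)) 1 ⊗ₜ
            Module.finBasis ℂ W i.2)) := by
        rw [mulOp_tmul, ← hmon]
        exact polyBasis_apply _ _
      rw [hB]
      exact mulOp_pow_mem_polyRad _ _
    rw [h0]
    exact zero_mem _

end

end Cherednik

end
noncomputable section

namespace Cherednik

/-! ### Graded traces -/

theorem exists_mem_eigenspace_of_mem_range {N N' : Type*} [AddCommGroup N] [Module ℂ N]
    [AddCommGroup N'] [Module ℂ N'] {D : Module.End ℂ N} {D' : Module.End ℂ N'}
    {f : N →ₗ[ℂ] N'} (hf : ∀ m, f (D m) = D' (f m))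
    (htop : ⨆ n : ℕ, D.eigenspace (n : ℂ) = ⊤) {n : ℕ} {m : N'} (hm : m ∈ LinearMap.range f)
    (hm' : m ∈ D'.eigenspace (n : ℂ)) : ∃ x ∈ D.eigenspace (n : ℂ), f x = m := by
  have hr : ∀ m ∈ LinearMap.range f, D' m ∈ LinearMap.range f := by
    rintro _ ⟨m, rfl⟩
    exact ⟨_, hf m⟩
  have h := map_eigenspace_of_surjective (f := f.rangeRestrict) (D' := D'.restrict hr)
    (fun m => Subtype.ext (hf m)) f.surjective_rangeRestrict htop n
  have h1 : (⟨m, hm⟩ : LinearMap.range f) ∈ Module.End.eigenspace (D'.restrict hr) (n : ℂ) := by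
    rw [Module.End.mem_eigenspace_iff] at hm' ⊢
    exact Subtype.ext hm'
  rw [← h] at h1
  obtain ⟨x, hx, hxm⟩ := h1
  exact ⟨x, hx, congrArg Subtype.val hxm⟩

section

variable {G V : Type*} [Group G] [Fintype G] [AddCommGroup V] [Module ℂ V]
  {ρ : Representation ℂ G V} {t : ℂ} {c : G → ℂ}
  {K M N C : Type*} [AddCommGroup K] [Module ℂ K] [Module (Cherednik ρ t c) K]
  [IsScalarTower ℂ (Cherednik ρ t c) K] [AddCommGroup M] [Module ℂ M] [Module (Cherednik ρ t c) M]
  [IsScalarTower ℂ (Cherednik ρ t c) M] [AddCommGroup N] [Module ℂ N] [Module (Cherednik ρ t c) N]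
  [IsScalarTower ℂ (Cherednik ρ t c) N] [AddCommGroup C] [Module ℂ C] [Module (Cherednik ρ t c) C]
  [IsScalarTower ℂ (Cherednik ρ t c) C] {DK : Module.End ℂ K} {DM : Module.End ℂ M}
  {DN : Module.End ℂ N} {DC : Module.End ℂ C}

/-- Exactness survives in each degree because a homogeneous element in the image of a graded map has
a homogeneous preimage of the same degree. -/
theorem IsGrading.tr_exact (hK : IsGrading ρ t c DK) (hM : IsGrading ρ t c DM)
    (hN : IsGrading ρ t c DN) (hC : IsGrading ρ t c DC) {i : K →ₗ[Cherednik ρ t c] M}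
    {f : M →ₗ[Cherednik ρ t c] N} {q : N →ₗ[Cherednik ρ t c] C}
    (hi : Function.Injective i) (hif : LinearMap.ker f = LinearMap.range i)
    (hfq : LinearMap.ker q = LinearMap.range f) (hq : Function.Surjective q)
    (hDi : ∀ m, i (DK m) = DM (i m)) (hDf : ∀ m, f (DM m) = DN (f m))
    (hDq : ∀ m, q (DN m) = DC (q m)) (n : ℕ) (a : G) :
    hN.tr n a = hM.tr n a - hK.tr n a + hC.tr n a := by
  have := hK.finite n
  have := hM.finite n
  have := hN.finite n
  have := hC.finite n
  have hDi' : ∀ m, i.restrictScalars ℂ (DK m) = DM (i.restrictScalars ℂ m) := hDi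
  have hDf' : ∀ m, f.restrictScalars ℂ (DM m) = DN (f.restrictScalars ℂ m) := hDf
  have hDq' : ∀ m, q.restrictScalars ℂ (DN m) = DC (q.restrictScalars ℂ m) := hDq
  refine trace_add_eq_of_exact
    (i := (i.restrictScalars ℂ).restrict fun _ => map_mem_eigenspace hDi')
    (f := (f.restrictScalars ℂ).restrict fun _ => map_mem_eigenspace hDf')
    (q := (q.restrictScalars ℂ).restrict fun _ => map_mem_eigenspace hDq')
    (fun x y h => Subtype.ext (hi (congrArg Subtype.val h))) ?_ ?_ ?_ ?_ ?_ ?_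
  · ext x
    constructor
    · intro h
      have h1 : f x = 0 := congrArg Subtype.val h
      have h2 : (x : M) ∈ LinearMap.range (i.restrictScalars ℂ) := by
        rw [← LinearMap.mem_ker, hif] at h1
        exact h1
      obtain ⟨y, hy, hyx⟩ := exists_mem_eigenspace_of_mem_range hDi' hK.iSup_eq_top h2 x.2
      exact ⟨⟨y, hy⟩, Subtype.ext hyx⟩
    · rintro ⟨y, rfl⟩
      have : i y ∈ LinearMap.ker f := hif ▸ ⟨_, rfl⟩
      exact Subtype.ext this
  · ext x
    constructor
    · intro h
      have h1 : q x = 0 := congrArg Subtype.val h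
      have h2 : (x : N) ∈ LinearMap.range (f.restrictScalars ℂ) := by
        rw [← LinearMap.mem_ker, hfq] at h1
        exact h1
      obtain ⟨y, hy, hyx⟩ := exists_mem_eigenspace_of_mem_range hDf' hM.iSup_eq_top h2 x.2
      exact ⟨⟨y, hy⟩, Subtype.ext hyx⟩
    · rintro ⟨y, rfl⟩
      have : f y ∈ LinearMap.ker q := hfq ▸ ⟨_, rfl⟩
      exact Subtype.ext this
  · intro x
    obtain ⟨y, hy, hyx⟩ := exists_mem_eigenspace_of_mem_range hDq' hN.iSup_eq_top
      (m := (x : C)) (hq x) x.2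
    exact ⟨⟨y, hy⟩, Subtype.ext hyx⟩
  all_goals
    ext x
    simp

/-- The four-term sequence with zero modules at both ends. -/
theorem IsGrading.tr_eq_of_bijective (hM : IsGrading ρ t c DM) (hN : IsGrading ρ t c DN)
    {f : M →ₗ[Cherednik ρ t c] N} (hf : Function.Bijective f) (hDf : ∀ m, f (DM m) = DN (f m))
    (n : ℕ) (a : G) : hM.tr n a = hN.tr n a := by
  have hP : IsGrading ρ t c (0 : Module.End ℂ PUnit.{1}) :=
    ⟨fun _ _ => rfl, fun _ _ => rfl, fun _ _ => rfl, Subsingleton.elim _ _, fun _ => inferInstance⟩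
  have h0 : hP.tr n a = 0 := by
    rw [tr, Subsingleton.elim (LinearMap.restrict _ _) 0, map_zero]
  have h := hP.tr_exact hM hN hP (i := 0) (f := f) (q := 0) (fun _ _ _ => rfl)
    (by rw [LinearMap.range_zero, LinearMap.ker_eq_bot.mpr hf.1])
    (by rw [LinearMap.ker_zero, LinearMap.range_eq_top.mpr hf.2]) (fun _ => ⟨0, rfl⟩)
    (fun m => by simp) hDf (fun m => by simp) n a
  rw [h, h0, sub_zero, add_zero]

end

/-! ### Molien's formula -/

/-- `X ^ n - 1` is separable in characteristic zero, so an operator of finite order is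
diagonalisable. Character identities concern one group element at a time, so an eigenbasis for that
element is enough. -/
theorem exists_eigenbasis {W : Type*} [AddCommGroup W] [Module ℂ W] [FiniteDimensional ℂ W] {m : ℕ}
    (hm : Module.finrank ℂ W = m) {f : Module.End ℂ W} {n : ℕ} (hn : n ≠ 0) (hf : f ^ n = 1) :
    ∃ (B : Module.Basis (Fin m) ℂ W) (κ : Fin m → ℂ), ∀ i, f (B i) = κ i • B i := by
  have hsep : (Polynomial.X ^ n - Polynomial.C (1 : ℂ)).Separable :=
    Polynomial.separable_X_pow_sub_C 1 (Nat.cast_ne_zero.mpr hn) one_ne_zero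
  have hss : f.IsSemisimple := Module.End.isSemisimple_of_squarefree_aeval_eq_zero hsep.squarefree
    (by simp [hf])
  have htop := hss.iSup_eigenspace_eq_top
  let s : Set W := {v | ∃ μ : ℂ, f v = μ • v}
  have hs : ⊤ ≤ Submodule.span ℂ s := by
    rw [← htop]
    exact iSup_le fun μ v hv => Submodule.subset_span ⟨μ, Module.End.mem_eigenspace_iff.mp hv⟩
  let B := Module.Basis.ofSpan hs
  have : Fintype _ := FiniteDimensional.fintypeBasisIndex B
  let e := Fintype.equivFinOfCardEq ((Module.finrank_eq_card_basis B).symm.trans hm)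
  have hB : ∀ i, ∃ μ : ℂ, f (B.reindex e i) = μ • B.reindex e i := fun i => by
    rw [Module.Basis.reindex_apply]
    exact Module.Basis.ofSpan_subset hs ⟨_, rfl⟩
  choose κ hκ using hB
  exact ⟨_, κ, hκ⟩

theorem exists_eigenbasis_rep {G W : Type*} [Group G] [Finite G] [AddCommGroup W] [Module ℂ W]
    [FiniteDimensional ℂ W] (τ : Representation ℂ G W) (g : G) {m : ℕ}
    (hm : Module.finrank ℂ W = m) :
    ∃ (B : Module.Basis (Fin m) ℂ W) (κ : Fin m → ℂ), ∀ i, τ g (B i) = κ i • B i := by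
  refine exists_eigenbasis hm (n := orderOf g) (orderOf_pos g).ne' ?_
  rw [← map_pow, pow_orderOf_eq_one, map_one]

theorem detPoly_eq_prod {G V : Type*} [Group G] [AddCommGroup V] [Module ℂ V]
    {ρ : Representation ℂ G V} {g : G} {r : ℕ} (b : Module.Basis (Fin r) ℂ (Module.Dual ℂ V))
    {κ : Fin r → ℂ} (hκ : ∀ i, ρ.dual g (b i) = κ i • b i) :
    detPoly ρ g = ∏ i, (1 - Polynomial.C (κ i) * Polynomial.X) := by
  let b' := b.baseChange (Polynomial ℂ)
  rw [detPoly, ← LinearMap.det_toMatrix b']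
  have : LinearMap.toMatrix b' b' (LinearMap.id - (Polynomial.X : Polynomial ℂ) •
      (ρ.dual g).baseChange (Polynomial ℂ)) =
      Matrix.diagonal fun i => 1 - Polynomial.C (κ i) * Polynomial.X := by
    have h1 : ∀ j, (ρ.dual g).baseChange (Polynomial ℂ) (b' j) = Polynomial.C (κ j) • b' j := by
      intro j
      rw [Module.Basis.baseChange_apply, LinearMap.baseChange_tmul, hκ, TensorProduct.tmul_smul,
        ← algebraMap_smul (Polynomial ℂ) (κ j)]
      rfl
    have h2 : ∀ j, (LinearMap.id - (Polynomial.X : Polynomial ℂ) •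
        (ρ.dual g).baseChange (Polynomial ℂ) : _ →ₗ[Polynomial ℂ] _) (b' j) =
        (1 - Polynomial.C (κ j) * Polynomial.X) • b' j := by
      intro j
      have h3 : b' j - (Polynomial.X : Polynomial ℂ) • (ρ.dual g).baseChange (Polynomial ℂ) (b' j) =
          (1 - Polynomial.C (κ j) * Polynomial.X) • b' j := by
        rw [h1, smul_smul, mul_comm]
        refine Eq.trans ?_ (sub_smul 1 (Polynomial.C (κ j) * Polynomial.X) (b' j)).symm
        rw [one_smul]
      exact h3
    ext1 i j
    rw [LinearMap.toMatrix_apply, h2, map_smul, Module.Basis.repr_self]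
    by_cases h : i = j
    · subst h
      simp
    · simp [h]
  rw [this, Matrix.det_diagonal]

theorem det_eq_prod {G V : Type*} [Group G] [AddCommGroup V] [Module ℂ V]
    {ρ : Representation ℂ G V} {g : G} {r : ℕ} (b : Module.Basis (Fin r) ℂ (Module.Dual ℂ V))
    {κ : Fin r → ℂ} (hκ : ∀ i, ρ.dual g (b i) = κ i • b i) :
    detDual ρ g = ∏ i, κ i := by
  change LinearMap.det (ρ.dual g) = _
  rw [← LinearMap.det_toMatrix b]
  have : LinearMap.toMatrix b b (ρ.dual g) = Matrix.diagonal κ := by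
    ext i j
    rw [LinearMap.toMatrix_apply, hκ]
    by_cases h : i = j
    · subst h
      simp
    · simp [h]
  rw [this, Matrix.det_diagonal]

theorem trace_eq_sum_of_basis {W : Type*} [AddCommGroup W] [Module ℂ W] {m : ℕ}
    (B : Module.Basis (Fin m) ℂ W) {f : Module.End ℂ W} {κ : Fin m → ℂ}
    (hκ : ∀ i, f (B i) = κ i • B i) : LinearMap.trace ℂ W f = ∑ i, κ i := by
  rw [LinearMap.trace_eq_matrix_trace ℂ B, Matrix.trace]
  refine Finset.sum_congr rfl fun i _ => ?_
  rw [Matrix.diag_apply, LinearMap.toMatrix_apply, hκ]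
  simp

theorem one_sub_mul_mk_pow (a : ℂ) :
    (1 - PowerSeries.C a * PowerSeries.X) * PowerSeries.mk (fun n => a ^ n) = 1 := by
  ext n
  rw [sub_mul, one_mul, map_sub, mul_assoc, PowerSeries.coeff_C_mul]
  rcases n with _ | n
  · simp
  · rw [PowerSeries.coeff_succ_X_mul]
    simp [pow_succ', PowerSeries.coeff_one]

section

variable {G V W : Type*} [Group G] [Fintype G] [AddCommGroup V] [Module ℂ V]
  [FiniteDimensional ℂ V] [AddCommGroup W] [Module ℂ W] [FiniteDimensional ℂ W] {r : ℕ}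
  {b : Module.Basis (Fin r) ℂ (Module.Dual ℂ V)} {ρ : Representation ℂ G V} {t : ℂ} {c : G → ℂ}
  {hc : ∀ s g : G, IsReflection ρ s → c (g * s * g⁻¹) = c s} {τ : Representation ℂ G W}

omit [FiniteDimensional ℂ W] in
theorem g_smul_polyBasis {g : G} {κ : Fin r → ℂ} (hκ : ∀ i, ρ.dual g (b i) = κ i • b i) {m : ℕ}
    (B : Module.Basis (Fin m) ℂ W) {η : Fin m → ℂ} (hη : ∀ i, τ g (B i) = η i • B i) (i) :
    of ρ t c (.g g) • polyBasis b t hc τ B i =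
      ((∏ k, κ k ^ i.1 k) * η i.2) • polyBasis b t hc τ B i := by
  have hX : ∀ k, polyAct b ρ g (MvPolynomial.X k) = κ k • MvPolynomial.X k := fun k => by
    rw [← lin_basis b, polyAct_lin, hκ, map_smul]
  have hmon : polyAct b ρ g (MvPolynomial.monomial i.1 1) =
      (∏ k, κ k ^ i.1 k) • MvPolynomial.monomial i.1 1 := by
    have h1 : (MvPolynomial.monomial i.1 (1 : ℂ)) = ∏ k, MvPolynomial.X k ^ i.1 k := by
      rw [MvPolynomial.monomial_eq, map_one, one_mul, Finsupp.prod_fintype]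
      simp
    rw [h1, map_prod]
    simp only [map_pow, hX, smul_pow]
    rw [Finset.prod_smul]
  rw [polyBasis_apply, g_smul_toPoly, grpOp_tmul, hmon, hη, TensorProduct.tmul_smul,
    ← TensorProduct.smul_tmul', smul_smul, map_smul, mul_comm]

theorem tr_polyDeg_eq_sum {g : G} {κ : Fin r → ℂ}
    (hκ : ∀ i, ρ.dual g (b i) = κ i • b i) (hD : IsGrading ρ t c (polyDeg b t hc τ)) (n : ℕ) :
    hD.tr n g = (∑ a ∈ Finset.univ.finsuppAntidiag n, ∏ k, κ k ^ a k) *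
      LinearMap.trace ℂ W (τ g) := by
  have := finite_degree_fiber (r := r) (κ := Fin (Module.finrank ℂ W)) n
  have := Fintype.ofFinite
    {i : (Fin r →₀ ℕ) × Fin (Module.finrank ℂ W) // (i.1.degree : ℂ) = n}
  obtain ⟨B, η, hη⟩ := exists_eigenbasis_rep τ g rfl
  rw [IsGrading.tr, trace_restrict_eigenspace_of_basis (polyBasis b t hc τ B)
    (polyDeg_polyBasis B) (Algebra.lsmul ℂ ℂ _ (of ρ t c (.g g))) (g_smul_polyBasis hκ B hη), trace_eq_sum_of_basis B hη,
    Finset.sum_mul_sum, ← Finset.sum_product', eq_comm]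
  refine Finset.sum_subtype _ (fun x => ?_)
    (fun x : (Fin r →₀ ℕ) × Fin (Module.finrank ℂ W) => (∏ k, κ k ^ x.1 k) * η x.2)
  simp only [Finset.mem_product, Finset.mem_univ, and_true, Finset.mem_finsuppAntidiag,
    Finset.subset_univ, Nat.cast_inj, Finsupp.degree_eq_sum]

/-- In an eigenbasis of `g` on the dual space, the trace on degree `n` polynomials is the complete
homogeneous symmetric function of the eigenvalues. Its generating series is a product of geometric
series, which the determinant cancels factor by factor. -/
theorem detPoly_mul_tr_polyDeg (hD : IsGrading ρ t c (polyDeg b t hc τ)) (g : G) :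
    (detPoly ρ g : PowerSeries ℂ) * PowerSeries.mk (fun n => hD.tr n g) =
      PowerSeries.C (LinearMap.trace ℂ W (τ g)) := by
  obtain ⟨b', κ, hκ⟩ := exists_eigenbasis_rep ρ.dual g
    ((Module.finrank_eq_card_basis b).trans (Fintype.card_fin r))
  have hD' : IsGrading ρ t c (polyDeg b' t hc τ) := isGrading_polyDeg
  -- The polynomial module depends on the basis; replacing it by an eigenbasis of `g` goes through
  -- the standard module, whose components do not.
  have htr : ∀ n, hD.tr n g = hD'.tr n g := by
    intro n
    have h1 := isGrading_stdGr (b := b) (hc := hc) (τ := τ) (t := t)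
    have h2 := isGrading_stdGr (b := b') (hc := hc) (τ := τ) (t := t)
    rw [← h1.tr_eq_of_bijective hD (f := (stdEquiv b t hc τ).toLinearMap)
      (stdEquiv b t hc τ).bijective stdEquiv_stdGr, ← h2.tr_eq_of_bijective hD'
      (f := (stdEquiv b' t hc τ).toLinearMap) (stdEquiv b' t hc τ).bijective stdEquiv_stdGr]
    exact trace_restrict_congr (by rw [← stdDeg_eq_eigenspace, ← stdDeg_eq_eigenspace]) _ _ _
  have hmk : PowerSeries.mk (fun n => hD.tr n g) =
      (∏ i, PowerSeries.mk fun n => κ i ^ n) * PowerSeries.C (LinearMap.trace ℂ W (τ g)) := by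
    ext n
    rw [PowerSeries.coeff_mk, htr, tr_polyDeg_eq_sum hκ, PowerSeries.coeff_mul_C,
      PowerSeries.coeff_prod]
    simp only [PowerSeries.coeff_mk]
  rw [hmk, detPoly_eq_prod b' hκ, ← mul_assoc]
  have : ((∏ i, (1 - Polynomial.C (κ i) * Polynomial.X) : Polynomial ℂ) : PowerSeries ℂ) =
      ∏ i, (1 - PowerSeries.C (κ i) * PowerSeries.X) := by
    rw [← Polynomial.coeToPowerSeries.ringHom_apply, map_prod]
    simp
  rw [this, ← Finset.prod_mul_distrib]
  simp only [one_sub_mul_mk_pow, Finset.prod_const_one, one_mul]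

end

end Cherednik

end
noncomputable section

namespace Cherednik

/-! ### Virtual characters -/

section VirtualCharacters

/-- The action of an element of the group algebra. -/
def coeffAct {G W : Type*} [Group G] [Fintype G] [AddCommGroup W] [Module ℂ W] (a : G → ℂ)
    (E : Representation ℂ G W) : Module.End ℂ W :=
  ∑ g, a g • E g

variable {G : Type*} [Group G]

/-- The representation on a coordinate space obtained from a choice of basis. -/
def finRep {W : Type*} [AddCommGroup W] [Module ℂ W] [FiniteDimensional ℂ W]
    (E : Representation ℂ G W) : Representation ℂ G (Fin (Module.finrank ℂ W) → ℂ) where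
  toFun g := (Module.finBasis ℂ W).equivFun.conj (E g)
  map_one' := by rw [map_one]; exact LinearEquiv.conj_id _
  map_mul' g h := by rw [map_mul]; exact LinearEquiv.conj_comp _ _ _

theorem equivFun_finRep {W : Type*} [AddCommGroup W] [Module ℂ W] [FiniteDimensional ℂ W]
    (E : Representation ℂ G W) (g : G) (w : W) :
    (Module.finBasis ℂ W).equivFun (E g w) = finRep E g ((Module.finBasis ℂ W).equivFun w) := by
  simp [finRep, LinearEquiv.conj_apply]

theorem trace_finRep {W : Type*} [AddCommGroup W] [Module ℂ W] [FiniteDimensional ℂ W]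
    (E : Representation ℂ G W) (g : G) :
    LinearMap.trace ℂ _ (finRep E g) = LinearMap.trace ℂ W (E g) :=
  LinearMap.trace_conj' _ _

variable [Fintype G]

theorem coeffAct_apply {W : Type*} [AddCommGroup W] [Module ℂ W] (a : G → ℂ)
    (E : Representation ℂ G W) (w : W) : coeffAct a E w = ∑ g, a g • E g w := by
  simp [coeffAct]

theorem map_coeffAct {U W : Type*} [AddCommGroup W] [Module ℂ W] [AddCommGroup U] [Module ℂ U]
    {E : Representation ℂ G W} {F : Representation ℂ G U} {f : W →ₗ[ℂ] U}
    (hf : ∀ g w, f (E g w) = F g (f w)) (a : G → ℂ) (w : W) :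
    f (coeffAct a E w) = coeffAct a F (f w) := by
  simp [coeffAct_apply, hf]

theorem coeffAct_finRep {W : Type*} [AddCommGroup W] [Module ℂ W] [FiniteDimensional ℂ W]
    {E : Representation ℂ G W} {a : G → ℂ} {μ : ℂ} (h : ∀ w, coeffAct a E w = μ • w) (w) :
    coeffAct a (finRep E) w = μ • w := by
  obtain ⟨w, rfl⟩ := (Module.finBasis ℂ W).equivFun.surjective w
  rw [← LinearEquiv.coe_coe, ← map_coeffAct (E := E) (equivFun_finRep E), h, map_smul]

/-- Differences of characters of representations on which the given elements of the group
algebra act by the given scalars. -/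
def IsVirtualChar {ι : Type*} (a : ι → G → ℂ) (μ : ι → ℂ) (χ : G → ℂ) : Prop :=
  ∃ (m n : ℕ) (E : Representation ℂ G (Fin m → ℂ)) (F : Representation ℂ G (Fin n → ℂ)),
    (∀ i w, coeffAct (a i) E w = μ i • w) ∧ (∀ i w, coeffAct (a i) F w = μ i • w) ∧
    ∀ g, χ g = LinearMap.trace ℂ _ (E g) - LinearMap.trace ℂ _ (F g)

variable {ι : Type*} {a : ι → G → ℂ} {μ : ι → ℂ}

theorem isVirtualChar_of_rep {U W : Type*} [AddCommGroup W] [Module ℂ W] [FiniteDimensional ℂ W]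
    [AddCommGroup U] [Module ℂ U] [FiniteDimensional ℂ U]
    {E : Representation ℂ G W} {F : Representation ℂ G U}
    (hE : ∀ i w, coeffAct (a i) E w = μ i • w) (hF : ∀ i w, coeffAct (a i) F w = μ i • w) :
    IsVirtualChar a μ fun g => LinearMap.trace ℂ _ (E g) - LinearMap.trace ℂ _ (F g) :=
  ⟨_, _, finRep E, finRep F, fun i => coeffAct_finRep (hE i), fun i => coeffAct_finRep (hF i),
    fun g => by rw [trace_finRep, trace_finRep]⟩

theorem coeffAct_prod {U W : Type*} [AddCommGroup W] [Module ℂ W]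
    [AddCommGroup U] [Module ℂ U]
    {E : Representation ℂ G W} {F : Representation ℂ G U} {a : G → ℂ} {μ : ℂ}
    (hE : ∀ w, coeffAct a E w = μ • w) (hF : ∀ w, coeffAct a F w = μ • w) (w) :
    coeffAct a (E.prod F) w = μ • w := by
  apply Prod.ext
  · refine (map_coeffAct (E := E.prod F) (F := E) (f := LinearMap.fst ℂ W U)
      (fun _ _ => rfl) a w).trans ?_
    rw [hE]
    rfl
  · refine (map_coeffAct (E := E.prod F) (F := F) (f := LinearMap.snd ℂ W U)
      (fun _ _ => rfl) a w).trans ?_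
    rw [hF]
    rfl

theorem IsVirtualChar.add {χ χ' : G → ℂ} (h : IsVirtualChar a μ χ) (h' : IsVirtualChar a μ χ') :
    IsVirtualChar a μ fun g => χ g + χ' g := by
  obtain ⟨m, n, E, F, hE, hF, h⟩ := h
  obtain ⟨m', n', E', F', hE', hF', h'⟩ := h'
  have := isVirtualChar_of_rep (fun i => coeffAct_prod (hE i) (hE' i))
    (fun i => coeffAct_prod (hF i) (hF' i))
  convert this using 2 with g
  rw [h, h']
  have h1 := LinearMap.trace_prodMap' (R := ℂ) (E g) (E' g)
  have h2 := LinearMap.trace_prodMap' (R := ℂ) (F g) (F' g)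
  refine Eq.trans ?_ (congrArg₂ (· - ·) h1.symm h2.symm)
  ring

theorem IsVirtualChar.neg {χ : G → ℂ} (h : IsVirtualChar a μ χ) :
    IsVirtualChar a μ fun g => -χ g := by
  obtain ⟨m, n, E, F, hE, hF, h⟩ := h
  exact ⟨n, m, F, E, hF, hE, fun g => by simp only [h, neg_sub]⟩

theorem IsVirtualChar.sub {χ χ' : G → ℂ} (h : IsVirtualChar a μ χ) (h' : IsVirtualChar a μ χ') :
    IsVirtualChar a μ fun g => χ g - χ' g := by
  simpa only [sub_eq_add_neg] using h.add h'.neg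

theorem isVirtualChar_zero : IsVirtualChar a μ fun _ : G => 0 := by
  have h : ∀ i w, coeffAct (a i) (Representation.trivial ℂ G PUnit.{1}) w = μ i • w :=
    fun _ _ => rfl
  simpa using isVirtualChar_of_rep h h

theorem isVirtualChar_trace {W : Type*} [AddCommGroup W] [Module ℂ W] [FiniteDimensional ℂ W]
    {E : Representation ℂ G W} (hE : ∀ i w, coeffAct (a i) E w = μ i • w) :
    IsVirtualChar a μ fun g => LinearMap.trace ℂ _ (E g) := by
  have h : ∀ i w, coeffAct (a i) (Representation.trivial ℂ G PUnit.{1}) w = μ i • w :=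
    fun _ _ => rfl
  simpa using isVirtualChar_of_rep hE h

end VirtualCharacters

/-! ### Quasi-central elements -/

theorem eigenspace_eq_bot_of_forall_ne {N : Type*} [AddCommGroup N] [Module ℂ N]
    {D : Module.End ℂ N} (htop : ⨆ n : ℕ, D.eigenspace (n : ℂ) = ⊤) {μ : ℂ}
    (hμ : ∀ n : ℕ, μ ≠ n) : D.eigenspace μ = ⊥ := by
  have h := D.eigenspaces_iSupIndep μ
  refine (Submodule.eq_bot_iff _).mpr fun x hx => Submodule.disjoint_def.mp h x hx ?_
  have : x ∈ ⨆ n : ℕ, D.eigenspace (n : ℂ) := by rw [htop]; trivial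
  exact (iSup_le fun n => le_iSup₂_of_le (n : ℂ) (hμ n).symm le_rfl :
    (⨆ n : ℕ, D.eigenspace (n : ℂ)) ≤ _) this

theorem eq_zero_of_mem_eigenspace_of_mem_gtDeg {N : Type*} [AddCommGroup N] [Module ℂ N]
    {D : Module.End ℂ N} {n : ℕ} {m : N} (h : m ∈ D.eigenspace (n : ℂ)) (h' : m ∈ gtDeg D n) :
    m = 0 := by
  refine Submodule.disjoint_def.mp (iSupIndep_eigenspace_nat D n) m h ?_
  exact (iSup_le fun j => le_iSup₂_of_le (j : ℕ) j.2.ne' le_rfl : gtDeg D n ≤ _) h'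

section

variable {G V : Type*} [Group G] [Fintype G] [AddCommGroup V] [Module ℂ V]
  {ρ : Representation ℂ G V} {t : ℂ} {c : G → ℂ}

/-- Elements that commute with the covectors up to a scalar multiple of these. -/
def IsQuasiCentral (z : Cherednik ρ t c) (s : ℂ) : Prop :=
  ∀ f : Module.Dual ℂ V, z * of ρ t c (.x f) = of ρ t c (.x f) * z + s • of ρ t c (.x f)

section

variable {N M : Type*} [AddCommGroup N] [Module ℂ N] [Module (Cherednik ρ t c) N]
  [IsScalarTower ℂ (Cherednik ρ t c) N] [AddCommGroup M] [Module ℂ M] [Module (Cherednik ρ t c) M]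
  [IsScalarTower ℂ (Cherednik ρ t c) M]

/-- The element `z` acts on the component of degree `n` by the scalar `l + n * s`, up to terms of
higher degree. -/
def ActsBy (D : Module.End ℂ N) (z : Cherednik ρ t c) (l s : ℂ) : Prop :=
  ∀ n : ℕ, ∀ m ∈ D.eigenspace (n : ℂ), z • m - (l + n * s) • m ∈ gtDeg D n

theorem ActsBy.of_injective {D : Module.End ℂ N} {D' : Module.End ℂ M} {z : Cherednik ρ t c}
    {l s : ℂ} (h : ActsBy D z l s) {f : M →ₗ[Cherednik ρ t c] N} (hinj : Function.Injective f)
    (hf : ∀ m, f (D' m) = D (f m)) : ActsBy D' z l s := by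
  have hf' : ∀ m, f.restrictScalars ℂ (D' m) = D (f.restrictScalars ℂ m) := hf
  intro n m hm
  refine mem_iSup_eigenspace_of_injective (φ := fun j : {j : ℕ // n < j} => ((j : ℕ) : ℂ)) hf'
    hinj (Nat.cast_injective.comp Subtype.val_injective) ?_
  have := h n (f m) (map_mem_eigenspace hf' hm)
  rw [← map_smul, ← LinearMap.map_smul_of_tower, ← map_sub] at this
  exact this

theorem ActsBy.of_surjective {D : Module.End ℂ N} {D' : Module.End ℂ M} {z : Cherednik ρ t c}
    {l s : ℂ} (h : ActsBy D z l s) (htop : ⨆ n : ℕ, D.eigenspace (n : ℂ) = ⊤)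
    {f : N →ₗ[Cherednik ρ t c] M} (hsurj : Function.Surjective f)
    (hf : ∀ m, f (D m) = D' (f m)) : ActsBy D' z l s := by
  have hf' : ∀ m, f.restrictScalars ℂ (D m) = D' (f.restrictScalars ℂ m) := hf
  intro n m hm
  rw [← map_eigenspace_of_surjective hf' hsurj htop n] at hm
  obtain ⟨m, hm, rfl⟩ := hm
  have := map_mem_iSup_eigenspace hf' (h n m hm)
  have h2 : f.restrictScalars ℂ (z • m - (l + n * s) • m) = z • f m - (l + n * s) • f m := by
    rw [map_sub, (f.restrictScalars ℂ).map_smul]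
    exact congrArg (· - _) (f.map_smul z m)
  rwa [h2] at this

end

/-- The regular representation. -/
def regRep (G : Type*) [Group G] : Representation ℂ G (G → ℂ) where
  toFun g := LinearMap.funLeft ℂ ℂ (g⁻¹ * ·)
  map_one' := by ext; simp [LinearMap.funLeft]
  map_mul' g h := by
    refine LinearMap.ext fun φ => funext fun k => ?_
    simp [LinearMap.funLeft_apply, mul_assoc]

variable [FiniteDimensional ℂ V] {r : ℕ}
  (b : Module.Basis (Fin r) ℂ (Module.Dual ℂ V))
  (hc : ∀ s g : G, IsReflection ρ s → c (g * s * g⁻¹) = c s)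

/-- The coefficients of the group elements in the normally ordered form of `z`. -/
def constCoeff (z : Cherednik ρ t c) : G → ℂ := by
  classical
  exact polyPr b t hc (regRep G) (z • polyConst b t hc (regRep G) (Pi.single 1 1))

/-- The regular representation is the universal case: `φ ↦ ∑ φ(h) h w` is equivariant, sends the
delta function at `1` to `w`, and extends to the polynomial modules compatibly with the projections
to constants. Thus one element of the group algebra, depending only on `z`, describes the
lowest-degree effect of `z` for every `E`. -/
theorem polyPr_smul_polyConst {W : Type*} [AddCommGroup W] [Module ℂ W] (E : Representation ℂ G W)
    (z : Cherednik ρ t c) (w : W) :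
    polyPr b t hc E (z • polyConst b t hc E w) = coeffAct (constCoeff b hc z) E w := by
  classical
  let e : (G → ℂ) →ₗ[ℂ] W := ∑ h, (LinearMap.proj h).smulRight (E h w)
  have he : ∀ φ, e φ = ∑ h, φ h • E h w := fun φ => by simp [e]
  have heq : ∀ g φ, e (regRep G g φ) = E g (e φ) := fun g φ => by
    rw [he, he, map_sum]
    refine (Fintype.sum_equiv (Equiv.mulLeft g) _ _ fun k => ?_).symm
    simp [regRep, LinearMap.funLeft_apply]
  obtain ⟨Φ, hΦ⟩ := exists_polyLift (b := b) (hc := hc) (τ := regRep G) (N := Poly b t hc E)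
    (polyConst b t hc E ∘ₗ e)
    (fun a φ => by
      rw [LinearMap.comp_apply, LinearMap.comp_apply, heq, g_smul_polyConst])
    fun v φ => y_smul_polyConst ..
  have hpr : polyPr b t hc E ∘ₗ Φ.restrictScalars ℂ = e ∘ₗ polyPr b t hc (regRep G) := by
    refine poly_ext (fun φ => ?_) fun f m hm => ?_
    · simp [hΦ, polyPr_polyConst]
    · simp [polyPr_x_smul]
  have h1 : e (Pi.single 1 1) = w := by
    rw [he, Finset.sum_eq_single 1]
    · simp
    · intro h _ hh
      simp [hh]
    · simp
  have h2 := LinearMap.congr_fun hpr (z • polyConst b t hc (regRep G) (Pi.single 1 1))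
  simp only [LinearMap.comp_apply, LinearMap.coe_restrictScalars, map_smul, hΦ, h1] at h2
  rw [h2, he, coeffAct_apply]
  rfl

variable {b hc}

/-- Once the scalar is right on the constants, quasi-centrality propagates it to all degrees. The
constants sit in degree `k` after the shift, which explains `l + k * s`. -/
theorem actsBy_poly {W : Type*} [AddCommGroup W] [Module ℂ W] {E : Representation ℂ G W}
    {z : Cherednik ρ t c} {s l : ℂ} (hz : IsQuasiCentral z s) (k : ℕ)
    (hE : ∀ w, coeffAct (constCoeff b hc z) E w = (l + k * s) • w) :
    ActsBy (polyDeg b t hc E + (k : ℂ) • 1) z l s := by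
  set D := polyDeg b t hc E + (k : ℂ) • 1 with hD
  have hDa : ∀ m, D m = polyDeg b t hc E m + (k : ℂ) • m := fun m => rfl
  have hshift : ∀ μ : ℂ, (polyDeg b t hc E).eigenspace μ = D.eigenspace (μ + k) := fun μ => by
    ext m
    rw [Module.End.mem_eigenspace_iff, Module.End.mem_eigenspace_iff, hDa, add_smul,
      add_left_inj]
  have hx : ∀ f m, D (of ρ t c (.x f) • m) = of ρ t c (.x f) • D m + of ρ t c (.x f) • m := by
    intro f m
    rw [hDa, hDa, polyDeg_x_smul, smul_add, smul_comm (k : ℂ)]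
    abel
  -- `T` is the error term. Passing a covector across `z` costs `s` times that covector, exactly
  -- what it costs across `s D`, so `T` commutes with covectors.
  let T : Module.End ℂ (Poly b t hc E) := Algebra.lsmul ℂ ℂ _ z - l • 1 - s • D
  have hTa : ∀ m, T m = z • m - l • m - s • D m := fun m => rfl
  have hTx : ∀ f m, T (of ρ t c (.x f) • m) = of ρ t c (.x f) • T m := by
    intro f m
    rw [hTa, hTa, hx, ← mul_smul, hz f, add_smul, mul_smul, smul_sub, smul_sub, smul_add, smul_assoc,
      smul_comm l, smul_comm s (of ρ t c (.x f)) (D m)]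
    abel
  have htop : ⨆ n : ℕ, D.eigenspace (n : ℂ) ⊓ (gtDeg D n).comap T = ⊤ := by
    refine poly_eq_top _ (fun w => ?_) fun f m hm => ?_
    · refine Submodule.mem_iSup_of_mem k ⟨?_, ?_⟩
      · rw [← zero_add (k : ℂ), SetLike.mem_coe, ← hshift, Module.End.mem_eigenspace_iff,
          polyDeg_polyConst, zero_smul]
      · have h1 := sub_polyConst_mem_gtDeg (z • polyConst b t hc E w)
        rw [polyPr_smul_polyConst, hE] at h1
        have h2 : T (polyConst b t hc E w) =
            z • polyConst b t hc E w - polyConst b t hc E ((l + k * s) • w) := by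
          rw [hTa, hDa, polyDeg_polyConst, zero_add, map_smul, add_smul, smul_smul, mul_comm s]
          abel
        rw [SetLike.mem_coe, Submodule.mem_comap, h2]
        refine (iSup_le fun j => ?_ : gtDeg (polyDeg b t hc E) 0 ≤ gtDeg D k) h1
        rw [hshift, ← Nat.cast_add]
        exact eigenspace_le_gtDeg D (Nat.lt_add_of_pos_left j.2)
    · induction hm using Submodule.iSup_induction' with
      | mem n m hm =>
        refine Submodule.mem_iSup_of_mem (n + 1) ⟨?_, ?_⟩
        · rw [Nat.cast_add, Nat.cast_one]
          exact x_smul_mem_eigenspace hx f hm.1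
        · rw [SetLike.mem_coe, Submodule.mem_comap, hTx]
          exact x_smul_mem_gtDeg hx f hm.2
      | zero => rw [smul_zero]; exact zero_mem _
      | add x y _ _ hx hy => rw [smul_add]; exact add_mem hx hy
  intro n m hm
  -- The homogeneous elements that `T` moves to higher degree already span, so there are no others.
  rw [← eq_of_le_of_iSupIndep (fun _ => inf_le_left) htop (iSupIndep_eigenspace_nat D) n] at hm
  have h1 : T m ∈ gtDeg D n := hm.2
  rw [hTa, Module.End.mem_eigenspace_iff.mp hm.1, smul_smul, sub_sub, ← add_smul, mul_comm s] at h1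
  exact h1

end

end Cherednik

end
noncomputable section

namespace Cherednik

/-! ### Numerators of graded characters -/

section

variable {G V : Type*} [Group G] [Fintype G] [AddCommGroup V] [Module ℂ V]
  {ρ : Representation ℂ G V} {t : ℂ} {c : G → ℂ}
  {N : Type*} [AddCommGroup N] [Module ℂ N] [Module (Cherednik ρ t c) N]
  [IsScalarTower ℂ (Cherednik ρ t c) N] {D : Module.End ℂ N}

/-- The representation of `G` on a homogeneous component. -/
def IsGrading.degRep (hD : IsGrading ρ t c D) (n : ℕ) :
    Representation ℂ G (D.eigenspace (n : ℂ)) where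
  toFun g := (Algebra.lsmul ℂ ℂ N (of ρ t c (.g g))).restrict (hD.g_smul_mem g n)
  map_one' := by
    ext m
    simp [of_g_one]
  map_mul' g h := by
    ext m
    simp [of_g_mul]

theorem IsGrading.tr_eq_zero (hD : IsGrading ρ t c D) {n : ℕ} (h : D.eigenspace (n : ℂ) = ⊥)
    (g : G) : hD.tr n g = 0 := by
  have : Subsingleton (D.eigenspace (n : ℂ)) := by rw [h]; infer_instance
  rw [tr, Subsingleton.elim (LinearMap.restrict _ _) 0, map_zero]

omit [Fintype G] [Module (Cherednik ρ t c) N] [IsScalarTower ℂ (Cherednik ρ t c) N] in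
theorem eigenspace_add_smul_one (D : Module.End ℂ N) (k μ : ℂ) :
    (D + k • (1 : Module.End ℂ N)).eigenspace (μ + k) = D.eigenspace μ := by
  ext m
  rw [Module.End.mem_eigenspace_iff, Module.End.mem_eigenspace_iff, add_smul,
    LinearMap.add_apply, LinearMap.smul_apply, Module.End.one_apply, add_left_inj]

omit [Fintype G] [Module (Cherednik ρ t c) N] [IsScalarTower ℂ (Cherednik ρ t c) N] in
theorem eigenspace_add_smul_one_eq_bot {D : Module.End ℂ N}
    (htop : ⨆ n : ℕ, D.eigenspace (n : ℂ) = ⊤) {k n : ℕ} (h : n < k) :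
    (D + (k : ℂ) • (1 : Module.End ℂ N)).eigenspace (n : ℂ) = ⊥ := by
  have h1 : (n : ℂ) = (n - k) + k := by ring
  rw [h1, eigenspace_add_smul_one]
  refine eigenspace_eq_bot_of_forall_ne htop fun j hj => ?_
  rw [sub_eq_iff_eq_add] at hj
  have : n = j + k := by exact_mod_cast hj
  omega

omit [Fintype G] [Module (Cherednik ρ t c) N] [IsScalarTower ℂ (Cherednik ρ t c) N] in
theorem gtDeg_zero_le_gtDeg_add_smul_one (D : Module.End ℂ N) (k : ℕ) :
    gtDeg D 0 ≤ gtDeg (D + (k : ℂ) • (1 : Module.End ℂ N)) k := by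
  refine iSup_le fun j => ?_
  rw [← eigenspace_add_smul_one _ (k : ℂ), ← Nat.cast_add]
  exact eigenspace_le_gtDeg _ (Nat.lt_add_of_pos_left j.2)

/-- Gradings can be shifted. -/
theorem IsGrading.shift (hD : IsGrading ρ t c D) (k : ℕ) :
    IsGrading ρ t c (D + (k : ℂ) • (1 : Module.End ℂ N)) where
  x_smul f m := by
    simp only [LinearMap.add_apply, LinearMap.smul_apply, Module.End.one_apply]
    rw [hD.x_smul, smul_add, smul_comm (k : ℂ)]
    abel
  y_smul f m := by
    simp only [LinearMap.add_apply, LinearMap.smul_apply, Module.End.one_apply]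
    rw [hD.y_smul, smul_add, smul_comm (k : ℂ)]
    abel
  g_smul f m := by
    simp only [LinearMap.add_apply, LinearMap.smul_apply, Module.End.one_apply]
    rw [hD.g_smul, smul_add, smul_comm (k : ℂ)]
  iSup_eq_top := by
    rw [eq_top_iff, ← hD.iSup_eq_top]
    refine iSup_le fun n => le_iSup_of_le (n + k) ?_
    rw [Nat.cast_add, eigenspace_add_smul_one]
  finite n := by
    rcases lt_or_ge n k with h | h
    · rw [eigenspace_add_smul_one_eq_bot hD.iSup_eq_top h]
      infer_instance
    · obtain ⟨j, rfl⟩ := Nat.exists_eq_add_of_le' h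
      rw [Nat.cast_add, eigenspace_add_smul_one]
      exact hD.finite j

theorem IsGrading.tr_shift_add (hD : IsGrading ρ t c D) (k n : ℕ) (g : G) :
    (hD.shift k).tr (n + k) g = hD.tr n g :=
  trace_restrict_congr (by rw [Nat.cast_add, eigenspace_add_smul_one]) _ _ _

theorem IsGrading.tr_shift_of_lt (hD : IsGrading ρ t c D) {k n : ℕ} (h : n < k) (g : G) :
    (hD.shift k).tr n g = 0 :=
  (hD.shift k).tr_eq_zero (eigenspace_add_smul_one_eq_bot hD.iSup_eq_top h) g

theorem mk_tr_shift (hD : IsGrading ρ t c D) (k : ℕ) (g : G) :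
    PowerSeries.mk (fun n => (hD.shift k).tr n g) =
      PowerSeries.X ^ k * PowerSeries.mk fun n => hD.tr n g := by
  ext n
  rw [PowerSeries.coeff_X_pow_mul', PowerSeries.coeff_mk]
  split_ifs with h
  · obtain ⟨j, rfl⟩ := Nat.exists_eq_add_of_le' h
    rw [hD.tr_shift_add, Nat.add_sub_cancel, PowerSeries.coeff_mk]
  · exact hD.tr_shift_of_lt (not_le.mp h) g

end

/-! ### Coefficients of the numerator as virtual characters. -/

section

variable {G : Type*} {V : Type*} [Group G] [Fintype G] [AddCommGroup V] [Module ℂ V]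
  [FiniteDimensional ℂ V] {ρ : Representation ℂ G V} {t : ℂ} {c : G → ℂ} {r : ℕ}

/-- The coefficients of the numerator of the character of a graded module are virtual characters
on which quasi-central elements act by the expected scalars. -/
theorem isVirtualChar_coeff_of_lt (b : Module.Basis (Fin r) ℂ (Module.Dual ℂ V))
    (hc : ∀ s g : G, IsReflection ρ s → c (g * s * g⁻¹) = c s)
    {ι : Type*} {z : ι → Cherednik ρ t c} {s l : ι → ℂ} (hz : ∀ i, IsQuasiCentral (z i) (s i))
    (k : ℕ) : ∀ (n₀ : ℕ) (N : Type*) [AddCommGroup N] [Module ℂ N] [Module (Cherednik ρ t c) N]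
    [IsScalarTower ℂ (Cherednik ρ t c) N] (D : Module.End ℂ N) (hD : IsGrading ρ t c D)
    (_ : ∀ i, ActsBy D (z i) (l i) (s i)) (_ : ∀ n < n₀, D.eigenspace (n : ℂ) = ⊥)
    (d : ℕ) (_ : d < n₀ + k),
    IsVirtualChar (fun i => constCoeff b hc (z i)) (fun i => l i + d * s i) fun g =>
      PowerSeries.coeff d
        ((detPoly ρ g : PowerSeries ℂ) * PowerSeries.mk (fun n => hD.tr n g)) := by
  induction k with
  | zero =>
    intro n₀ N _ _ _ _ D hD _ hn d hd
    have : ∀ g, PowerSeries.coeff d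
        ((detPoly ρ g : PowerSeries ℂ) * PowerSeries.mk (fun n => hD.tr n g)) = 0 := by
      intro g
      rw [PowerSeries.coeff_mul]
      refine Finset.sum_eq_zero fun p hp => ?_
      rw [PowerSeries.coeff_mk, hD.tr_eq_zero (hn _ ?_), mul_zero]
      have := Finset.HasAntidiagonal.mem_antidiagonal.mp hp
      omega
    simp only [this]
    exact isVirtualChar_zero
  | succ k ih =>
    intro n₀ N _ _ _ _ D hD hact hn d hd
    have := hD.finite n₀
    let E := hD.degRep n₀
    -- Degree `n₀ - 1` is empty: by hypothesis if `n₀ > 0`, and for `n₀ = 0` because `-1` is not a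
    -- natural number.
    have hy : ∀ v, ∀ m ∈ D.eigenspace (n₀ : ℂ), of ρ t c (.y v) • m = 0 := by
      intro v m hm
      have h1 : of ρ t c (.y v) • m ∈ D.eigenspace ((n₀ : ℂ) - 1) := by
        rw [Module.End.mem_eigenspace_iff] at hm ⊢
        rw [hD.y_smul, hm, smul_comm, sub_smul, one_smul]
      have h2 : D.eigenspace ((n₀ : ℂ) - 1) = ⊥ := by
        rcases n₀ with _ | n₀
        · refine eigenspace_eq_bot_of_forall_ne hD.iSup_eq_top fun n h => ?_
          rw [sub_eq_iff_eq_add] at h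
          norm_cast at h
        · rw [Nat.cast_add, Nat.cast_one, add_sub_cancel_right]
          exact hn n₀ (Nat.lt_succ_self _)
      rwa [h2, Submodule.mem_bot] at h1
    obtain ⟨Φ, hΦ⟩ := exists_polyLift (b := b) (hc := hc) (τ := E) (N := N)
      (D.eigenspace (n₀ : ℂ)).subtype (fun _ _ => rfl) (fun v w => hy v w w.2)
    have hP₀ := isGrading_polyDeg (t := t) (b := b) (hc := hc) (τ := E)
    have hP := hP₀.shift n₀
    set DP := polyDeg b t hc E + (n₀ : ℂ) • 1 with hDP
    have hDΦ : ∀ m, Φ (DP m) = D (Φ m) := by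
      have : Φ.restrictScalars ℂ ∘ₗ DP = D ∘ₗ Φ.restrictScalars ℂ := by
        refine poly_ext (fun w => ?_) fun f m hm => ?_
        · have h1 := Module.End.mem_eigenspace_iff.mp w.2
          have h2 : DP (polyConst b t hc E w) = (n₀ : ℂ) • polyConst b t hc E w := by
            rw [hDP, LinearMap.add_apply, polyDeg_polyConst, zero_add]
            rfl
          rw [LinearMap.comp_apply, LinearMap.comp_apply, h2, map_smul,
            LinearMap.coe_restrictScalars, hΦ]
          exact h1.symm
        · simp only [LinearMap.comp_apply, LinearMap.coe_restrictScalars] at hm ⊢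
          rw [hP.x_smul, map_add, map_smul, map_smul, hm, hD.x_smul]
      exact LinearMap.congr_fun this
    -- Up to higher degree, `z i` acts on the lowest component by the given scalar by assumption on
    -- `N`, and by `constCoeff` through `Φ`. Both values lie in degree `n₀`, so they agree.
    have hE : ∀ i w, coeffAct (constCoeff b hc (z i)) E w = (l i + n₀ * s i) • w := by
      intro i w
      have h1 := hact i n₀ w w.2
      have h2 := sub_polyConst_mem_gtDeg (z i • polyConst b t hc E w)
      rw [polyPr_smul_polyConst] at h2
      have h3 : Φ (z i • polyConst b t hc E w - polyConst b t hc E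
          (coeffAct (constCoeff b hc (z i)) E w)) ∈ gtDeg D n₀ := by
        have h4 : z i • polyConst b t hc E w - polyConst b t hc E
            (coeffAct (constCoeff b hc (z i)) E w) ∈ gtDeg DP n₀ :=
          gtDeg_zero_le_gtDeg_add_smul_one _ n₀ h2
        exact map_mem_iSup_eigenspace (f := Φ.restrictScalars ℂ) hDΦ h4
      rw [map_sub, map_smul, hΦ, hΦ] at h3
      have h5 := sub_mem h1 h3
      rw [Submodule.subtype_apply, Submodule.subtype_apply, sub_sub_sub_cancel_left] at h5
      have h6 := eq_zero_of_mem_eigenspace_of_mem_gtDeg (sub_mem (Subtype.property _)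
        (Submodule.smul_mem _ _ w.2)) h5
      exact Subtype.ext (sub_eq_zero.mp h6)
    have hactP : ∀ i, ActsBy DP (z i) (l i) (s i) := fun i => actsBy_poly (hz i) n₀ (hE i)
    -- the kernel
    obtain ⟨DK, hDK⟩ := exists_end_of_injective DP
      (f := (LinearMap.ker Φ).subtype.restrictScalars ℂ) Subtype.val_injective fun m =>
        ⟨⟨DP m, by
          rw [LinearMap.mem_ker, hDΦ, LinearMap.mem_ker.mp m.2, map_zero]⟩, rfl⟩
    have hK := hP.of_injective (LinearMap.ker Φ).subtype Subtype.val_injective hDK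
    -- In degree `n₀` the source of `Φ` consists of the constants, on which `Φ` is the inclusion of
    -- the lowest component.
    have hKn : ∀ n < n₀ + 1, DK.eigenspace (n : ℂ) = ⊥ := by
      intro n hn'
      refine (Submodule.eq_bot_iff _).mpr fun m hm => ?_
      have h1 : (m : Poly b t hc E) ∈ DP.eigenspace (n : ℂ) :=
        map_mem_eigenspace (f := (LinearMap.ker Φ).subtype.restrictScalars ℂ) hDK hm
      rcases Nat.lt_succ_iff_lt_or_eq.mp hn' with h | rfl
      · rw [hDP, eigenspace_add_smul_one_eq_bot hP₀.iSup_eq_top h] at h1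
        exact Subtype.ext h1
      · have h0 := eigenspace_add_smul_one (polyDeg b t hc E) n 0
        rw [zero_add] at h0
        rw [hDP, h0] at h1
        have h2 := eq_polyConst_of_mem_eigenspace_zero h1
        have h3 := LinearMap.mem_ker.mp m.2
        rw [h2, hΦ] at h3
        have h4 : polyPr b t hc E m = 0 := Subtype.ext h3
        rw [h4, map_zero] at h2
        exact Subtype.ext h2
    have hKact : ∀ i, ActsBy DK (z i) (l i) (s i) := fun i =>
      (hactP i).of_injective (f := (LinearMap.ker Φ).subtype) Subtype.val_injective hDK
    -- the cokernel
    obtain ⟨DC, hDC⟩ := exists_end_of_surjective D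
      (f := (LinearMap.range Φ).mkQ.restrictScalars ℂ)
      (Submodule.mkQ_surjective (LinearMap.range Φ)) fun m hm => by
        have hm' : m ∈ LinearMap.ker (LinearMap.range Φ).mkQ := hm
        rw [Submodule.ker_mkQ] at hm'
        obtain ⟨m, rfl⟩ := hm'
        have h1 : D (Φ m) ∈ LinearMap.ker (LinearMap.range Φ).mkQ := by
          rw [Submodule.ker_mkQ]
          exact ⟨_, hDΦ m⟩
        exact h1
    have hqs := Submodule.mkQ_surjective (LinearMap.range Φ)
    have hC := hD.of_surjective (LinearMap.range Φ).mkQ hqs hDC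
    have hCn : ∀ n < n₀ + 1, DC.eigenspace (n : ℂ) = ⊥ := by
      intro n hn'
      rw [← map_eigenspace_of_surjective hDC hqs hD.iSup_eq_top n]
      rcases Nat.lt_succ_iff_lt_or_eq.mp hn' with h | rfl
      · rw [hn n h, Submodule.map_bot]
      · rw [eq_bot_iff]
        rintro _ ⟨m, hm, rfl⟩
        exact (Submodule.Quotient.mk_eq_zero _).mpr ⟨_, hΦ ⟨m, hm⟩⟩
    have hCact : ∀ i, ActsBy DC (z i) (l i) (s i) := fun i =>
      (hact i).of_surjective hD.iSup_eq_top (f := (LinearMap.range Φ).mkQ) hqs hDC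
    -- conclusion
    have htr : ∀ g, PowerSeries.mk (fun n => hD.tr n g) =
        PowerSeries.mk (fun n => hP.tr n g) - PowerSeries.mk (fun n => hK.tr n g) +
          PowerSeries.mk (fun n => hC.tr n g) := by
      intro g
      ext n
      simp only [map_add, map_sub, PowerSeries.coeff_mk]
      exact hK.tr_exact hP hD hC (i := (LinearMap.ker Φ).subtype) (f := Φ)
        (q := (LinearMap.range Φ).mkQ) Subtype.val_injective (Submodule.range_subtype _).symm
        (Submodule.ker_mkQ _) hqs hDK hDΦ hDC n g
    simp only [htr, mul_add, mul_sub, map_add, map_sub]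
    have hd' : d < n₀ + 1 + k := by omega
    -- Kernel and cokernel start one degree higher, so `n₀ + 1` and `k` replace `n₀` and `k + 1`
    -- with the same bound on `d`.
    refine IsVirtualChar.add (IsVirtualChar.sub ?_ (ih _ _ DK hK hKact hKn d hd'))
      (ih _ _ DC hC hCact hCn d hd')
    have hM : ∀ g, PowerSeries.coeff d
        ((detPoly ρ g : PowerSeries ℂ) * PowerSeries.mk (fun n => hP.tr n g)) =
        if d = n₀ then LinearMap.trace ℂ _ (E g) else 0 := by
      intro g
      rw [mk_tr_shift hP₀, mul_left_comm, detPoly_mul_tr_polyDeg, mul_comm,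
        PowerSeries.coeff_C_mul, PowerSeries.coeff_X_pow]
      split_ifs <;> simp
    simp only [hM]
    split_ifs with h
    · subst h
      exact isVirtualChar_trace hE
    · exact isVirtualChar_zero

theorem isVirtualChar_coeff (b : Module.Basis (Fin r) ℂ (Module.Dual ℂ V))
    (hc : ∀ s g : G, IsReflection ρ s → c (g * s * g⁻¹) = c s)
    {ι : Type*} {z : ι → Cherednik ρ t c} {s l : ι → ℂ} (hz : ∀ i, IsQuasiCentral (z i) (s i))
    {N : Type*} [AddCommGroup N] [Module ℂ N] [Module (Cherednik ρ t c) N]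
    [IsScalarTower ℂ (Cherednik ρ t c) N] {D : Module.End ℂ N} (hD : IsGrading ρ t c D)
    (hact : ∀ i, ActsBy D (z i) (l i) (s i)) (d : ℕ) :
    IsVirtualChar (fun i => constCoeff b hc (z i)) (fun i => l i + d * s i) fun g =>
      PowerSeries.coeff d
        ((detPoly ρ g : PowerSeries ℂ) * PowerSeries.mk (fun n => hD.tr n g)) :=
  isVirtualChar_coeff_of_lt b hc hz (d + 1) 0 N D hD hact (fun n hn => absurd hn n.not_lt_zero) d
    (by omega)

end

end Cherednik

end
noncomputable section

namespace Cherednik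

/-! ### Scalars on irreducible representations -/

section

variable {G W : Type*} [Group G] [AddCommGroup W] [Module ℂ W]

theorem exists_eq_smul_of_commute [FiniteDimensional ℂ W] {τ : Representation ℂ G W}
    (hτ : τ.IsIrreducible) {T : Module.End ℂ W} (hT : ∀ g w, T (τ g w) = τ g (T w)) :
    ∃ μ : ℂ, ∀ w, T w = μ • w := by
  have := nontrivial_of_isIrreducible hτ
  obtain ⟨μ, hμ⟩ := Module.End.exists_eigenvalue T
  refine ⟨μ, fun w => ?_⟩
  have h := (submodule_eq_bot_or_top hτ (T.eigenspace μ) fun g w hw => ?_).resolve_left hμ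
  · exact Module.End.mem_eigenspace_iff.mp (h ▸ Submodule.mem_top)
  · rw [Module.End.mem_eigenspace_iff] at hw ⊢
    rw [hT, hw, map_smul]

theorem injective_of_ne_zero {U : Type*} [AddCommGroup U] [Module ℂ U] {σ : Representation ℂ G U}
    {E : Representation ℂ G W} (hσ : σ.IsIrreducible) {f : U →ₗ[ℂ] W}
    (hf : ∀ g u, f (σ g u) = E g (f u)) (hf0 : f ≠ 0) : Function.Injective f := by
  rw [← LinearMap.ker_eq_bot]
  refine (submodule_eq_bot_or_top hσ (LinearMap.ker f) fun g u hu => ?_).resolve_right fun h =>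
    hf0 (LinearMap.ker_eq_top.mp h)
  rw [LinearMap.mem_ker] at hu ⊢
  rw [hf, hu, map_zero]

theorem coeffAct_of_injective [Fintype G] {U : Type*} [AddCommGroup U] [Module ℂ U]
    {σ : Representation ℂ G U}
    {E : Representation ℂ G W} {f : U →ₗ[ℂ] W}
    (hf : ∀ g u, f (σ g u) = E g (f u)) (hinj : Function.Injective f) {a : G → ℂ} {μ : ℂ}
    (hE : ∀ w, coeffAct a E w = μ • w) (u : U) : coeffAct a σ u = μ • u :=
  hinj (by rw [map_coeffAct hf, hE, map_smul])

/-- An element of the group algebra acts by finitely many scalars. -/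
theorem finite_setOf_coeffAct_eq_smul [Fintype G] (a : G → ℂ) :
    {μ : ℂ | ∃ (n : ℕ) (E : Representation ℂ G (Fin n → ℂ)), n ≠ 0 ∧
      ∀ w, coeffAct a E w = μ • w}.Finite := by
  refine (Module.End.finite_hasEigenvalue (coeffAct a (regRep G))).subset ?_
  rintro μ ⟨n, E, hn, hE⟩
  -- The `i`-th matrix coefficient maps `E` equivariantly to the regular representation. The image
  -- of the `i`-th unit vector has value `1` at the identity, so it is an eigenvector there.
  let i : Fin n := ⟨0, Nat.pos_of_ne_zero hn⟩
  let f : (Fin n → ℂ) →ₗ[ℂ] (G → ℂ) := LinearMap.pi fun h => LinearMap.proj i ∘ₗ E h⁻¹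
  have hf : ∀ g w, f (E g w) = regRep G g (f w) := fun g w => by
    funext h
    simp [f, regRep, LinearMap.funLeft_apply]
  refine Module.End.hasEigenvalue_of_hasEigenvector (x := f (Pi.single i 1)) ⟨?_, fun h => ?_⟩
  · rw [Module.End.mem_eigenspace_iff, ← map_coeffAct hf, hE, map_smul]
  · have := congrFun h 1
    simp [f] at this

end

section

variable {G V : Type*} [Group G] [Fintype G] [AddCommGroup V] [Module ℂ V]
  [FiniteDimensional ℂ V] {r : ℕ}
  {b : Module.Basis (Fin r) ℂ (Module.Dual ℂ V)} {ρ : Representation ℂ G V} {t : ℂ} {c : G → ℂ}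
  {hc : ∀ s g : G, IsReflection ρ s → c (g * s * g⁻¹) = c s}

/-! ### The Euler element -/

/-- Both sides are the same multiple of `α(y) f(v)`. Written with `f - s f`, the group part of `[y,
x]` can be summed over dual bases, which is what the Euler element needs. -/
theorem reflForm_eq_sub {s : G} (hs : IsReflection ρ s) (y : V) (f : Module.Dual ℂ V) :
    reflForm ρ s y f = (reflD ρ s)⁻¹ * (f - ρ.dual s f) y := by
  obtain ⟨α, v, h, h0, h1, hl⟩ := exists_sub_smul_of_isReflection ρ hs
  rw [reflForm, reflDCheck, reflD, hl, dual_apply_of_sub_smul ρ h h1, h y]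
  simp only [sub_sub_cancel, map_smul, smul_eq_mul, inv_inv, sub_add_cancel_left,
    LinearMap.neg_apply, LinearMap.smul_apply]
  have h2 : (1 - (1 - α v)⁻¹) / 2 = -(α v / (2 * (1 - α v))) := by
    field_simp
    ring
  rw [h2]
  field_simp

variable (b) in
/-- The basis of `V` whose dual basis is `b`. -/
def predual : Module.Basis (Fin r) ℂ V := b.dualBasis.map (Module.evalEquiv ℂ V).symm

theorem sum_apply_predual (f : Module.Dual ℂ V) : ∑ i, f (predual b i) • b i = f := by
  have h : ∀ i, f (predual b i) = b.repr f i := fun i => by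
    rw [predual, Module.Basis.map_apply, ← Module.Dual.eval_apply, ← Module.evalEquiv_toLinearMap,
      LinearEquiv.coe_coe, LinearEquiv.apply_symm_apply, Module.Basis.dualBasis_apply]
  simp only [h, b.sum_repr]

open Classical in
variable (b ρ t c) in
/-- The Euler element of the Cherednik algebra. -/
def eulerElt : Cherednik ρ t c :=
  ∑ i, of ρ t c (.x (b i)) * of ρ t c (.y (predual b i)) -
    ∑ s : G with IsReflection ρ s, (c s / reflD ρ s) • of ρ t c (.g s)

omit [FiniteDimensional ℂ V] in
theorem sum_smul_of_x (φ : Fin r → ℂ) (h : Cherednik ρ t c) :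
    ∑ i, of ρ t c (.x (b i)) * (φ i • h) = of ρ t c (.x (∑ i, φ i • b i)) * h := by
  let ofx : Module.Dual ℂ V →ₗ[ℂ] Cherednik ρ t c :=
    { toFun := fun f => of ρ t c (.x f), map_add' := of_x_add ρ t c, map_smul' := of_x_smul ρ t c }
  have : ofx (∑ i, φ i • b i) = ∑ i, φ i • ofx (b i) := by simp
  change _ = ofx _ * h
  rw [this, Finset.sum_mul]
  refine Finset.sum_congr rfl fun i _ => ?_
  rw [mul_smul_comm, smul_mul_assoc]
  rfl

/-- Summing `x_i [y_i, f]` over dual bases gives `t f - ∑ (c_s / d_s) (f - s f) s`. The group part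
of the Euler element is chosen so that its commutator with `f` cancels the sum, because `[s, f] =
-(f - s f) s`. -/
theorem isQuasiCentral_eulerElt : IsQuasiCentral (eulerElt b ρ t c) t := by
  classical
  intro f
  let S := Finset.univ.filter fun s : G => IsReflection ρ s
  have h1 : ∀ i, of ρ t c (.x (b i)) * of ρ t c (.y (predual b i)) * of ρ t c (.x f) =
      of ρ t c (.x f) * (of ρ t c (.x (b i)) * of ρ t c (.y (predual b i))) +
      (of ρ t c (.x (b i)) * ((t * f (predual b i)) • 1) -
        ∑ s ∈ S, of ρ t c (.x (b i)) *
          ((c s * reflForm ρ s (predual b i) f) • of ρ t c (.g s))) := by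
    intro i
    have h := of_y_x (ρ := ρ) (t := t) (c := c) (predual b i) f
    rw [mul_assoc, ← sub_eq_iff_eq_add', ← mul_assoc (of ρ t c (.x f)), ← of_x_comm ρ t c (b i) f,
      mul_assoc, ← mul_sub, h, add_sub_cancel_left, mul_sub, Finset.mul_sum]
  have h2 : ∀ s ∈ S, ∑ i, of ρ t c (.x (b i)) *
      ((c s * reflForm ρ s (predual b i) f) • of ρ t c (.g s)) =
      (c s / reflD ρ s) • (of ρ t c (.x f) * of ρ t c (.g s)) -
        (c s / reflD ρ s) • (of ρ t c (.g s) * of ρ t c (.x f)) := by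
    intro s hs
    rw [sum_smul_of_x]
    have h3 : ∑ i, (c s * reflForm ρ s (predual b i) f) • b i =
        (c s / reflD ρ s) • (f - ρ.dual s f) := by
      simp only [reflForm_eq_sub (Finset.mem_filter.mp hs).2, mul_smul]
      rw [← Finset.smul_sum, ← Finset.smul_sum, sum_apply_predual, smul_smul, div_eq_mul_inv]
    rw [h3, of_x_smul, sub_eq_add_neg, of_x_add, ← neg_one_smul ℂ (ρ.dual s f), of_x_smul,
      neg_one_smul, ← sub_eq_add_neg, smul_mul_assoc, sub_mul, smul_sub, of_g_x]
  have h3 : ∑ i, of ρ t c (.x (b i)) * ((t * f (predual b i)) • (1 : Cherednik ρ t c)) =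
      t • of ρ t c (.x f) := by
    rw [sum_smul_of_x, mul_one, ← of_x_smul]
    simp only [mul_smul]
    rw [← Finset.smul_sum, sum_apply_predual]
  rw [eulerElt, sub_mul, Finset.sum_mul, Finset.sum_mul, mul_sub, Finset.mul_sum, Finset.mul_sum]
  simp only [h1]
  rw [Finset.sum_add_distrib, Finset.sum_sub_distrib, h3, Finset.sum_comm, Finset.sum_congr rfl h2,
    Finset.sum_sub_distrib]
  simp only [smul_mul_assoc, mul_smul_comm]
  change _ + (_ - (∑ s ∈ S, _ - ∑ s ∈ S, _)) - ∑ s ∈ S, _ = _ - ∑ s ∈ S, _ + _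
  abel

/-- The terms `x_i y_i` contribute no constants, so only the group part, which enters with a minus
sign, survives. -/
theorem coeffAct_constCoeff_eulerElt {W : Type*} [AddCommGroup W] [Module ℂ W]
    (E : Representation ℂ G W) (w : W) :
    coeffAct (constCoeff b hc (eulerElt b ρ t c)) E w = -omegaAct ρ c E w := by
  classical
  rw [← polyPr_smul_polyConst, eulerElt, sub_smul, Finset.sum_smul, Finset.sum_smul, map_sub,
    map_sum, map_sum, omegaAct, LinearMap.sum_apply]
  simp only [mul_smul, polyPr_x_smul, Finset.sum_const_zero, zero_sub, smul_assoc, map_smul,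
    polyPr_g_smul, polyPr_polyConst, LinearMap.smul_apply]

/-! ### Central characters -/

variable {W : Type*} [AddCommGroup W] [Module ℂ W] {τ : Representation ℂ G W}

omit [FiniteDimensional ℂ V] in
theorem isQuasiCentral_of_mem_center {z : Cherednik ρ t c}
    (hz : z ∈ Subalgebra.center ℂ (Cherednik ρ t c)) : IsQuasiCentral z 0 := fun f => by
  rw [zero_smul, add_zero, (Subalgebra.mem_center_iff.mp hz _)]

theorem coeffAct_constCoeff_of_mem_center {z : Cherednik ρ t c}
    (hz : z ∈ Subalgebra.center ℂ (Cherednik ρ t c)) (g : G) (w : W) :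
    coeffAct (constCoeff b hc z) τ (τ g w) = τ g (coeffAct (constCoeff b hc z) τ w) := by
  rw [← polyPr_smul_polyConst, ← polyPr_smul_polyConst, ← polyPr_g_smul, ← g_smul_polyConst,
    ← mul_smul, ← mul_smul, Subalgebra.mem_center_iff.mp hz]

/-- For central `z` the constant term of `z m` is `χ` times that of `m`. Applied to `h m` for every
`h`, this puts `(z - χ) m` in the radical. -/
theorem smul_simple_of_mem_center [FiniteDimensional ℂ W] (hτ : τ.IsIrreducible)
    {z : Cherednik ρ t c}
    (hz : z ∈ Subalgebra.center ℂ (Cherednik ρ t c)) {χ : ℂ}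
    (hχ : ∀ w, coeffAct (constCoeff b hc z) τ w = χ • w) (m : Simple ρ t c τ) :
    z • m = χ • m := by
  obtain ⟨m, rfl⟩ := polyToSimple_surjective (b := b) (hc := hc) m
  have h0 : ∀ m, polyPr b t hc τ (z • m) = χ • polyPr b t hc τ m := by
    intro m
    have : polyPr b t hc τ ∘ₗ Algebra.lsmul ℂ ℂ (Poly b t hc τ) z = χ • polyPr b t hc τ := by
      refine poly_ext (fun w => ?_) fun f m _ => ?_
      · rw [LinearMap.comp_apply, Algebra.lsmul_coe, polyPr_smul_polyConst, hχ,
          LinearMap.smul_apply, polyPr_polyConst]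
      · change polyPr b t hc τ (z • of ρ t c (.x f) • m) = _
        rw [← mul_smul, ← Subalgebra.mem_center_iff.mp hz, mul_smul, polyPr_x_smul, LinearMap.smul_apply,
          polyPr_x_smul, smul_zero]
    exact LinearMap.congr_fun this m
  have h1 : polyToSimple b t hc τ (z • m - χ • m) = 0 := by
    rw [polyToSimple_eq_zero_iff hτ, mem_polyRad]
    intro h
    rw [smul_sub, smul_comm h χ, ← mul_smul, Subalgebra.mem_center_iff.mp hz, mul_smul, map_sub,
      h0, (polyPr b t hc τ).map_smul χ, sub_self]
  rw [map_sub, map_smul, sub_eq_zero] at h1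
  rw [h1]
  exact ((polyToSimple b t hc τ).restrictScalars ℂ).map_smul χ m

end

end Cherednik

end
noncomputable section

namespace Cherednik

/-! ### Reduced virtual characters -/

section

variable {G : Type*} [Group G] [Fintype G] {ι : Type*} {a : ι → G → ℂ} {μ : ι → ℂ} {χ : G → ℂ}

/-- Replace `E` by the kernel and `F` by the cokernel of `f`: both lose the image of `f`, so the
difference of traces is unchanged, and the prescribed scalars pass to subrepresentations and
quotients. -/
theorem exists_smaller_of_hom_ne_zero {m n : ℕ} {E : Representation ℂ G (Fin m → ℂ)}
    {F : Representation ℂ G (Fin n → ℂ)}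
    (hE : ∀ i w, coeffAct (a i) E w = μ i • w) (hF : ∀ i w, coeffAct (a i) F w = μ i • w)
    (hχ : ∀ g, χ g = LinearMap.trace ℂ _ (E g) - LinearMap.trace ℂ _ (F g))
    {f : (Fin m → ℂ) →ₗ[ℂ] (Fin n → ℂ)} (hf : ∀ g w, f (E g w) = F g (f w)) (hf0 : f ≠ 0) :
    ∃ (m' n' : ℕ) (E' : Representation ℂ G (Fin m' → ℂ)) (F' : Representation ℂ G (Fin n' → ℂ)),
      m' + n' < m + n ∧ (∀ i w, coeffAct (a i) E' w = μ i • w) ∧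
      (∀ i w, coeffAct (a i) F' w = μ i • w) ∧
      ∀ g, χ g = LinearMap.trace ℂ _ (E' g) - LinearMap.trace ℂ _ (F' g) := by
  have hk : ∀ g, LinearMap.ker f ≤ (LinearMap.ker f).comap (E g) := fun g w hw => by
    rw [Submodule.mem_comap, LinearMap.mem_ker, hf, LinearMap.mem_ker.mp hw, map_zero]
  have hr : ∀ g, LinearMap.range f ≤ (LinearMap.range f).comap (F g) := by
    rintro g _ ⟨w, rfl⟩
    exact ⟨_, hf g w⟩
  let K := E.subrepresentation _ hk
  let C := F.quotient _ hr
  refine ⟨_, _, finRep K, finRep C, ?_, fun i => coeffAct_finRep fun w => ?_,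
    fun i => coeffAct_finRep fun w => ?_, fun g => ?_⟩
  · have h1 := f.finrank_range_add_finrank_ker
    have h2 := (LinearMap.range f).finrank_quotient_add_finrank
    rw [Module.finrank_fin_fun] at h1 h2
    have h3 : Module.finrank ℂ (LinearMap.range f) ≠ 0 := fun h =>
      hf0 (LinearMap.range_eq_bot.mp (Submodule.finrank_eq_zero.mp h))
    omega
  · exact coeffAct_of_injective (E := E) (f := (LinearMap.ker f).subtype) (fun _ _ => rfl)
      Subtype.val_injective (hE i) w
  · obtain ⟨w, rfl⟩ := (LinearMap.range f).mkQ_surjective w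
    rw [← map_coeffAct (E := F) (fun _ _ => rfl), hF, map_smul]
  · rw [trace_finRep, trace_finRep, hχ]
    have := trace_add_eq_of_exact (i := (LinearMap.ker f).subtype) (f := f)
      (q := (LinearMap.range f).mkQ) (k := K g) (a := E g) (b := F g) (c := C g)
      Subtype.val_injective (Submodule.range_subtype _).symm (Submodule.ker_mkQ _)
      (Submodule.mkQ_surjective _) rfl (LinearMap.ext (hf g)) rfl
    rw [this]
    ring

/-- A virtual character is a difference of characters of disjoint representations. -/
theorem IsVirtualChar.exists_disjoint (h : IsVirtualChar a μ χ) :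
    ∃ (m n : ℕ) (E : Representation ℂ G (Fin m → ℂ)) (F : Representation ℂ G (Fin n → ℂ)),
      (∀ i w, coeffAct (a i) E w = μ i • w) ∧ (∀ i w, coeffAct (a i) F w = μ i • w) ∧
      (∀ g, χ g = LinearMap.trace ℂ _ (E g) - LinearMap.trace ℂ _ (F g)) ∧
      (∀ f : (Fin m → ℂ) →ₗ[ℂ] (Fin n → ℂ), (∀ g w, f (E g w) = F g (f w)) → f = 0) ∧
      (∀ f : (Fin n → ℂ) →ₗ[ℂ] (Fin m → ℂ), (∀ g w, f (F g w) = E g (f w)) → f = 0) ∧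
      (χ = 0 → m = 0 ∧ n = 0) := by
  classical
  let P : ℕ → Prop := fun k => ∃ (m n : ℕ) (E : Representation ℂ G (Fin m → ℂ))
    (F : Representation ℂ G (Fin n → ℂ)), m + n = k ∧
      (∀ i w, coeffAct (a i) E w = μ i • w) ∧ (∀ i w, coeffAct (a i) F w = μ i • w) ∧
      (∀ g, χ g = LinearMap.trace ℂ _ (E g) - LinearMap.trace ℂ _ (F g))
  have hP : ∃ k, P k := by
    obtain ⟨m, n, E, F, h⟩ := h
    exact ⟨_, m, n, E, F, rfl, h⟩
  obtain ⟨m, n, E, F, hk, hE, hF, hχ⟩ := Nat.find_spec hP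
  have hmin : ∀ k, P k → m + n ≤ k := fun k hPk => hk.trans_le (Nat.find_min' hP hPk)
  refine ⟨m, n, E, F, hE, hF, hχ, fun f hf => ?_, fun f hf => ?_, fun h0 => ?_⟩
  · by_contra hf0
    obtain ⟨m', n', E', F', hlt, h'⟩ := exists_smaller_of_hom_ne_zero hE hF hχ hf hf0
    exact absurd (hmin _ ⟨m', n', E', F', rfl, h'⟩) (not_le.mpr hlt)
  · by_contra hf0
    obtain ⟨m', n', E', F', hlt, h1, h2, h3⟩ := exists_smaller_of_hom_ne_zero (χ := -χ) hF hE
      (fun g => by rw [Pi.neg_apply, hχ, neg_sub]) hf hf0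
    refine absurd (hmin (n' + m') ⟨n', m', F', E', rfl, h2, h1, fun g => ?_⟩) (by omega)
    rw [← neg_sub, ← h3, Pi.neg_apply, neg_neg]
  -- Zero representations satisfy every scalar condition, so minimality forces them when the virtual
  -- character is zero.
  · have h1 : ∀ i w, coeffAct (a i) (Representation.trivial ℂ G (Fin 0 → ℂ)) w = μ i • w :=
      fun _ _ => Subsingleton.elim _ _
    have := hmin 0 ⟨0, 0, Representation.trivial ℂ G _, Representation.trivial ℂ G _, rfl, h1, h1,
      fun g => by rw [h0, sub_self]; rfl⟩
    omega

theorem exists_finGradedRep {μ : ℤ → ι → ℂ} {χ : ℤ → G → ℂ}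
    (h : ∀ d, IsVirtualChar a (μ d) (χ d)) (hfin : {d | χ d ≠ 0}.Finite) :
    ∃ ip im : FinGradedRep G, ip.Disjoint im ∧ im.Disjoint ip ∧
      (∀ d i w, coeffAct (a i) (ip.rep d) w = μ d i • w) ∧
      (∀ d i w, coeffAct (a i) (im.rep d) w = μ d i • w) ∧
      ∀ d g, LinearMap.trace ℂ _ (ip.rep d g) - LinearMap.trace ℂ _ (im.rep d g) = χ d g := by
  choose m n E F hE hF hχ h1 h2 h0 using fun d => (h d).exists_disjoint
  -- A vanishing coefficient is realised by zero representations, so finite support of `χ` makes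
  -- both graded representations finite-dimensional.
  have hnt : ∀ k : ℤ → ℕ, (∀ d, χ d = 0 → k d = 0) →
      {d | Nontrivial (Fin (k d) → ℂ)}.Finite := fun k hk =>
    hfin.subset fun d (hd : Nontrivial (Fin (k d) → ℂ)) hd' => by
      rw [hk d hd'] at hd
      exact not_subsingleton _ (inferInstance : Subsingleton (Fin 0 → ℂ))
  exact ⟨⟨fun d => Fin (m d) → ℂ, E, hnt m fun d hd => (h0 d hd).1⟩,
    ⟨fun d => Fin (n d) → ℂ, F, hnt n fun d hd => (h0 d hd).2⟩,
    fun d f => Representation.IntertwiningMap.toLinearMap_injective _ _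
      (h1 d f.toLinearMap fun g w => LinearMap.congr_fun (f.isIntertwining' g) w),
    fun d f => Representation.IntertwiningMap.toLinearMap_injective _ _
      (h2 d f.toLinearMap fun g w => LinearMap.congr_fun (f.isIntertwining' g) w),
    hE, hF, fun d g => (hχ d g).symm⟩

end

end Cherednik

namespace FinGradedRep

variable {G : Type*} [Group G]

theorem trace_eq_zero_of_not_nontrivial {M : Type*} [AddCommGroup M] [Module ℂ M]
    (h : ¬ Nontrivial M) (f : Module.End ℂ M) : LinearMap.trace ℂ M f = 0 := by
  rw [not_nontrivial_iff_subsingleton] at h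
  rw [Subsingleton.elim f 0, map_zero]

theorem ch_eq_sum (E : FinGradedRep G) {s : Finset ℤ} (hs : E.finite_nontrivial.toFinset ⊆ s)
    (g : G) : E.ch g = ∑ d ∈ s, HahnSeries.single d (LinearMap.trace ℂ _ (E.rep d g)) := by
  refine finsum_eq_sum_of_support_subset _ fun d hd => ?_
  refine hs (E.finite_nontrivial.mem_toFinset.mpr ?_)
  by_contra h
  refine hd ?_
  beta_reduce
  rw [trace_eq_zero_of_not_nontrivial h, map_zero]

theorem coeff_ch (E : FinGradedRep G) (g : G) (d : ℤ) :
    (E.ch g).coeff d = LinearMap.trace ℂ _ (E.rep d g) := by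
  classical
  rw [ch_eq_sum E (Finset.subset_insert d _), HahnSeries.coeff_sum, Finset.sum_eq_single d]
  · rw [HahnSeries.coeff_single_same]
  · intro j _ hj
    rw [HahnSeries.coeff_single_of_ne hj.symm]
  · intro h
    exact absurd (Finset.mem_insert_self _ _) h

theorem dim_eq_sum (E : FinGradedRep G) {s : Finset ℤ} (hs : E.finite_nontrivial.toFinset ⊆ s) :
    (E.dim : ℂ) = ∑ d ∈ s, LinearMap.trace ℂ _ (E.rep d 1) := by
  have : E.dim = ∑ d ∈ s, Module.finrank ℂ (E.carrier d) := by
    refine finsum_eq_sum_of_support_subset _ fun d hd => ?_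
    refine hs (E.finite_nontrivial.mem_toFinset.mpr ?_)
    exact Module.nontrivial_of_finrank_pos (Nat.pos_of_ne_zero hd)
  rw [this]
  push_cast
  refine Finset.sum_congr rfl fun d _ => ?_
  rw [map_one, LinearMap.trace_one]

end FinGradedRep

end
noncomputable section

namespace Cherednik

/-! ### Numerators of the characters of the simple modules -/

section

variable {G V : Type*} [Group G] [Fintype G] [AddCommGroup V] [Module ℂ V]
  {ρ : Representation ℂ G V} {t : ℂ} {c : G → ℂ}

omit [Fintype G] in
theorem detSeries_ne_zero [Finite G] [FiniteDimensional ℂ V] (ρ : Representation ℂ G V) (g : G) :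
    detSeries ρ g ≠ 0 := by
  obtain ⟨b, κ, hκ⟩ := exists_eigenbasis_rep ρ.dual g rfl
  intro h
  rw [detSeries, ← map_zero (HahnSeries.ofPowerSeries ℤ ℂ)] at h
  have h1 := HahnSeries.ofPowerSeries_injective h
  rw [← Polynomial.coe_zero, Polynomial.coe_inj, detPoly_eq_prod b hκ] at h1
  have h2 := congrArg (Polynomial.eval 0) h1
  rw [Polynomial.eval_prod] at h2
  simp at h2

omit [Fintype G] in
theorem eval_one_detPoly_one [FiniteDimensional ℂ V] [Nontrivial V] (ρ : Representation ℂ G V) :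
    (detPoly ρ 1).eval 1 = 0 := by
  let b := Module.finBasis ℂ (Module.Dual ℂ V)
  have hb : ∀ i, ρ.dual 1 (b i) = (1 : ℂ) • b i := fun i => by
    rw [map_one, Module.End.one_apply, one_smul]
  have hr : 0 < Module.finrank ℂ (Module.Dual ℂ V) := by
    rw [Subspace.dual_finrank_eq]
    exact Module.finrank_pos
  rw [detPoly_eq_prod b hb, Polynomial.eval_prod]
  exact Finset.prod_eq_zero (Finset.mem_univ ⟨0, hr⟩) (by simp)

section

variable {N : Type*} [AddCommGroup N] [Module ℂ N] [Module (Cherednik ρ t c) N]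
  [IsScalarTower ℂ (Cherednik ρ t c) N] {D : Module.End ℂ N}

omit [IsScalarTower ℂ (Cherednik ρ t c) N] in
theorem IsGrading.exists_forall_eq_bot [FiniteDimensional ℂ N] (_hD : IsGrading ρ t c D) :
    ∃ M : ℕ, ∀ n ≥ M, D.eigenspace (n : ℂ) = ⊥ := by
  have h : {n : ℕ | D.eigenspace (n : ℂ) ≠ ⊥}.Finite :=
    WellFoundedGT.finite_ne_bot_of_iSupIndep (iSupIndep_eigenspace_nat D)
  obtain ⟨M, hM⟩ := h.bddAbove
  refine ⟨M + 1, fun n hn => ?_⟩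
  by_contra h
  have := hM h
  omega

theorem IsGrading.exists_polynomial [FiniteDimensional ℂ N] (hD : IsGrading ρ t c D) (g : G) :
    ∃ P : Polynomial ℂ, PowerSeries.mk (fun n => hD.tr n g) = P := by
  obtain ⟨M, hM⟩ := hD.exists_forall_eq_bot
  refine ⟨PowerSeries.trunc M (PowerSeries.mk fun n => hD.tr n g), ?_⟩
  ext n
  rw [Polynomial.coeff_coe, PowerSeries.coeff_trunc]
  split_ifs with h
  · rfl
  · rw [PowerSeries.coeff_mk, hD.tr_eq_zero (hM n (not_lt.mp h))]

/-- The coefficients of the numerator of the graded character. -/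
def IsGrading.num (hD : IsGrading ρ t c D) (d : ℤ) (g : G) : ℂ :=
  (HahnSeries.ofPowerSeries ℤ ℂ
    ((detPoly ρ g : PowerSeries ℂ) * PowerSeries.mk fun n => hD.tr n g)).coeff d

theorem IsGrading.num_natCast (hD : IsGrading ρ t c D) (n : ℕ) (g : G) :
    hD.num n g = PowerSeries.coeff n
      ((detPoly ρ g : PowerSeries ℂ) * PowerSeries.mk fun n => hD.tr n g) :=
  HahnSeries.ofPowerSeries_apply_coeff _ _

theorem IsGrading.num_of_neg (hD : IsGrading ρ t c D) {d : ℤ} (hd : d < 0) (g : G) :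
    hD.num d g = 0 := by
  rw [num, PowerSeries.coeff_coe, if_pos hd]

theorem coeff_ofPowerSeries_coe (Q : Polynomial ℂ) {d : ℤ}
    (h : d ∉ Q.support.map (Nat.castEmbedding (R := ℤ))) :
    (HahnSeries.ofPowerSeries ℤ ℂ (Q : PowerSeries ℂ)).coeff d = 0 := by
  rw [PowerSeries.coeff_coe]
  split_ifs with hd
  · rfl
  · rw [Polynomial.coeff_coe]
    by_contra hne
    refine h (Finset.mem_map.mpr ⟨d.natAbs, Polynomial.mem_support_iff.mpr hne, ?_⟩)
    rw [Nat.castEmbedding_apply]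
    omega

theorem sum_coeff_ofPowerSeries_coe (Q : Polynomial ℂ) {s : Finset ℤ}
    (hs : Q.support.map (Nat.castEmbedding (R := ℤ)) ⊆ s) :
    ∑ d ∈ s, (HahnSeries.ofPowerSeries ℤ ℂ (Q : PowerSeries ℂ)).coeff d = Q.eval 1 := by
  rw [← Finset.sum_subset hs fun d _ h => coeff_ofPowerSeries_coe Q h, Finset.sum_map,
    Polynomial.eval_eq_sum, Polynomial.sum]
  refine Finset.sum_congr rfl fun n _ => ?_
  rw [Nat.castEmbedding_apply, HahnSeries.ofPowerSeries_apply_coeff, Polynomial.coeff_coe, one_pow,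
    mul_one]

theorem IsGrading.finite_num [FiniteDimensional ℂ N] (hD : IsGrading ρ t c D) :
    {d | hD.num d ≠ 0}.Finite := by
  choose P hP using hD.exists_polynomial
  refine (Set.finite_iUnion fun g : G => ((detPoly ρ g * P g).support.map
    (Nat.castEmbedding (R := ℤ))).finite_toSet).subset fun d hd => ?_
  obtain ⟨g, hg⟩ := Function.ne_iff.mp hd
  refine Set.mem_iUnion.mpr ⟨g, ?_⟩
  by_contra h
  refine hg ?_
  rw [num, hP, ← Polynomial.coe_mul]
  exact coeff_ofPowerSeries_coe _ h

theorem IsGrading.isVirtualChar_num [FiniteDimensional ℂ V] {r : ℕ}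
    (b : Module.Basis (Fin r) ℂ (Module.Dual ℂ V))
    (hc : ∀ s g : G, IsReflection ρ s → c (g * s * g⁻¹) = c s)
    {ι : Type*} {z : ι → Cherednik ρ t c} {s l : ι → ℂ} (hz : ∀ i, IsQuasiCentral (z i) (s i))
    (hD : IsGrading ρ t c D) (hact : ∀ i, ActsBy D (z i) (l i) (s i)) (d : ℤ) :
    IsVirtualChar (fun i => constCoeff b hc (z i)) (fun i => l i + d * s i) (hD.num d) := by
  rcases lt_or_ge d 0 with h | h
  · have : hD.num d = fun _ => 0 := funext (hD.num_of_neg h)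
    rw [this]
    exact isVirtualChar_zero
  · lift d to ℕ using h
    have : hD.num d = _ := funext (hD.num_natCast d)
    rw [this]
    exact_mod_cast isVirtualChar_coeff b hc hz hD hact d

/-- A nonzero coefficient in degree `d` needs a nonzero representation on which `constCoeff` acts by
`l + d s`. Only finitely many scalars are possible, and distinct degrees give distinct ones since `s
≠ 0`. This is how the numerator is finite even if the module is infinite-dimensional. -/
theorem IsGrading.finite_num_of_ne_zero [FiniteDimensional ℂ V] {r : ℕ}
    (b : Module.Basis (Fin r) ℂ (Module.Dual ℂ V))
    (hc : ∀ s g : G, IsReflection ρ s → c (g * s * g⁻¹) = c s)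
    {z : Cherednik ρ t c} {s l : ℂ} (hz : IsQuasiCentral z s) (hs : s ≠ 0)
    (hD : IsGrading ρ t c D) (hact : ActsBy D z l s) : {d | hD.num d ≠ 0}.Finite := by
  have hinj : Function.Injective fun d : ℤ => l + d * s := fun d d' h => by
    simpa [hs] using h
  refine ((finite_setOf_coeffAct_eq_smul (constCoeff b hc z)).preimage hinj.injOn).subset
    fun d hd => ?_
  obtain ⟨m, n, E, F, hE, hF, h⟩ := hD.isVirtualChar_num b hc (ι := Unit) (fun _ => hz)
    (fun _ => hact) d
  by_cases hm : m = 0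
  · by_cases hn : n = 0
    · refine absurd (funext fun g => ?_) hd
      subst hm hn
      rw [h, Subsingleton.elim (E g) 0, Subsingleton.elim (F g) 0, map_zero, sub_self]
      rfl
    · exact ⟨n, F, hn, hF ()⟩
  · exact ⟨m, E, hm, hE ()⟩

end

variable [FiniteDimensional ℂ V] {W : Type*} [AddCommGroup W] [Module ℂ W] [FiniteDimensional ℂ W]
  {τ : Representation ℂ G W} {r : ℕ}

omit [FiniteDimensional ℂ V] [FiniteDimensional ℂ W] in
theorem omegaAct_comm (hc : ∀ s g : G, IsReflection ρ s → c (g * s * g⁻¹) = c s) (g : G) (w : W) :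
    omegaAct ρ c τ (τ g w) = τ g (omegaAct ρ c τ w) := by
  classical
  rw [omegaAct, LinearMap.sum_apply, LinearMap.sum_apply, map_sum]
  refine (Finset.sum_equiv (MulAut.conj g).toEquiv (fun s => ?_) fun s hs => ?_).symm
  · simp [isReflection_conj_iff]
  · have hs' := (Finset.mem_filter.mp hs).2
    simp only [LinearMap.smul_apply, map_smul, MulEquiv.toEquiv_eq_coe, EquivLike.coe_coe,
      MulAut.conj_apply, reflD, reflEigenvalue_conj, hc s g hs']
    rw [← Module.End.mul_apply, ← Module.End.mul_apply, ← map_mul, ← map_mul,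
      inv_mul_cancel_right]

omit [FiniteDimensional ℂ W] in
theorem actsBy_simple (b : Module.Basis (Fin r) ℂ (Module.Dual ℂ V))
    (hc : ∀ s g : G, IsReflection ρ s → c (g * s * g⁻¹) = c s)
    {D : Module.End ℂ (Simple ρ t c τ)}
    (h : ∀ m, polyToSimple b t hc τ (polyDeg b t hc τ m) = D (polyToSimple b t hc τ m))
    {z : Cherednik ρ t c} {s l : ℂ} (hz : IsQuasiCentral z s)
    (hl : ∀ w, coeffAct (constCoeff b hc z) τ w = l • w) : ActsBy D z l s := by
  have h1 : ActsBy (polyDeg b t hc τ) z l s := by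
    have := actsBy_poly (l := l) hz 0 fun w => by rw [hl, Nat.cast_zero, zero_mul, add_zero]
    rwa [Nat.cast_zero, zero_smul, add_zero] at this
  exact h1.of_surjective iSup_eigenspace_polyDeg polyToSimple_surjective h

/-- Both disjointness statements are recorded because dualising reverses the direction of
homomorphisms, and the dual numerators need one or the other according to the parity of the rank. -/
theorem exists_numerators (hc : ∀ s g : G, IsReflection ρ s → c (g * s * g⁻¹) = c s)
    (hτ : τ.IsIrreducible) {D : Module.End ℂ (Simple ρ t c τ)} (hD : IsGrading ρ t c D)
    (b : Module.Basis (Fin r) ℂ (Module.Dual ℂ V))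
    (h : ∀ m, polyToSimple b t hc τ (polyDeg b t hc τ m) = D (polyToSimple b t hc τ m)) :
    ∃ ip im : FinGradedRep G, ip.Disjoint im ∧ im.Disjoint ip ∧
      (∀ (U : Type*) [AddCommGroup U] [Module ℂ U] (σ : Representation ℂ G U),
        σ.IsIrreducible → (FinGradedRep.Occurs σ ip ∨ FinGradedRep.Occurs σ im) →
          Sim ρ t c σ τ) ∧
      ∀ d g, LinearMap.trace ℂ _ (ip.rep d g) - LinearMap.trace ℂ _ (im.rep d g) = hD.num d g := by
  by_cases ht : t = 0
  · subst ht
    have := finiteDimensional_simple_zero hc hτ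
    -- One pair of numerators must serve all central elements at once, so the whole centre is used
    -- as the index family; the scalars on `τ` come from Schur's lemma.
    choose χ hχ using fun z : Subalgebra.center ℂ (Cherednik ρ 0 c) =>
      exists_eq_smul_of_commute hτ (T := coeffAct (constCoeff b hc z.1) τ)
        (coeffAct_constCoeff_of_mem_center z.2)
    have hz := fun z : Subalgebra.center ℂ (Cherednik ρ 0 c) => isQuasiCentral_of_mem_center z.2
    obtain ⟨ip, im, h1, h2, h3, h4, h5⟩ := exists_finGradedRep
      (hD.isVirtualChar_num b hc hz fun z => actsBy_simple b hc h (hz z) (hχ z)) hD.finite_num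
    refine ⟨ip, im, h1, h2, fun U _ _ σ hσ hocc => ⟨fun h => absurd rfl h, fun _ z hz => ?_⟩, h5⟩
    refine ⟨χ ⟨z, hz⟩, ?_, smul_simple_of_mem_center hτ hz (hχ ⟨z, hz⟩)⟩
    have key : ∀ E : FinGradedRep G, (∀ d i w, coeffAct (constCoeff b hc i.1) (E.rep d) w =
        (χ i + d * 0) • w) → FinGradedRep.Occurs σ E →
        ∀ m : Simple ρ 0 c σ, z • m = χ ⟨z, hz⟩ • m := by
      rintro E hE ⟨d, f, hf⟩
      have hfe : ∀ g u, f.toLinearMap (σ g u) = E.rep d g (f.toLinearMap u) := fun g u =>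
        LinearMap.congr_fun (f.isIntertwining' g) u
      have hinj := injective_of_ne_zero hσ hfe fun h0 =>
        hf (Representation.IntertwiningMap.toLinearMap_injective _ _ h0)
      have : FiniteDimensional ℂ U := FiniteDimensional.of_injective f.toLinearMap hinj
      refine smul_simple_of_mem_center hσ hz (b := b) (hc := hc) ?_
      refine coeffAct_of_injective hfe hinj fun w => ?_
      rw [hE d ⟨z, hz⟩ w, mul_zero, add_zero]
    exact hocc.elim (key ip h3) (key im h4)
  · obtain ⟨l, hl⟩ := exists_eq_smul_of_commute hτ
      (T := coeffAct (constCoeff b hc (eulerElt b ρ t c)) τ) fun g w => by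
        rw [coeffAct_constCoeff_eulerElt, coeffAct_constCoeff_eulerElt, omegaAct_comm hc, map_neg]
    have hz : IsQuasiCentral (eulerElt b ρ t c) t := isQuasiCentral_eulerElt
    have hact := actsBy_simple b hc h hz hl
    obtain ⟨ip, im, h1, h2, h3, h4, h5⟩ := exists_finGradedRep
      (hD.isVirtualChar_num b hc (ι := Unit) (fun _ => hz) fun _ => hact)
      (hD.finite_num_of_ne_zero b hc hz ht hact)
    refine ⟨ip, im, h1, h2, fun U _ _ σ hσ hocc => ⟨fun _ => ?_, fun h => absurd h ht⟩, h5⟩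
    have key : ∀ E : FinGradedRep G, (∀ d w, coeffAct (constCoeff b hc (eulerElt b ρ t c))
        (E.rep d) w = (l + d * t) • w) → FinGradedRep.Occurs σ E → SameBlock ρ t c σ τ := by
      rintro E hE ⟨d, f, hf⟩
      have hfe : ∀ g u, f.toLinearMap (σ g u) = E.rep d g (f.toLinearMap u) := fun g u =>
        LinearMap.congr_fun (f.isIntertwining' g) u
      have hinj := injective_of_ne_zero hσ hfe fun h0 =>
        hf (Representation.IntertwiningMap.toLinearMap_injective _ _ h0)
      have hσ' := coeffAct_of_injective hfe hinj (hE d)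
      -- The Euler element acts on constants by minus the operator `omegaAct`, hence the signs; `d`
      -- is the degree in which `σ` occurs.
      refine ⟨-(l + d * t), -l, LinearMap.ext fun u => ?_, LinearMap.ext fun w => ?_, -d, ?_⟩
      · rw [← neg_neg (omegaAct ρ c σ u), ← coeffAct_constCoeff_eulerElt (b := b) (hc := hc) (t := t),
          hσ', LinearMap.smul_apply, LinearMap.id_apply, neg_smul]
      · rw [← neg_neg (omegaAct ρ c τ w), ← coeffAct_constCoeff_eulerElt (b := b) (hc := hc) (t := t),
          hl, LinearMap.smul_apply, LinearMap.id_apply, neg_smul]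
      · push_cast
        ring
    exact hocc.elim (key ip fun d => h3 d ()) (key im fun d => h4 d ())

omit [FiniteDimensional ℂ W] in
theorem simpleCh_eq_div {D : Module.End ℂ (Simple ρ t c τ)} (hD : IsGrading ρ t c D)
    (hdeg : ∀ n, simpleDeg ρ t c τ n = D.eigenspace (n : ℂ)) {ip im : FinGradedRep G}
    (h : ∀ d g, LinearMap.trace ℂ _ (ip.rep d g) - LinearMap.trace ℂ _ (im.rep d g) = hD.num d g)
    (g : G) : simpleCh ρ t c τ g = (ip.ch g - im.ch g) / detSeries ρ g := by
  rw [eq_div_iff (detSeries_ne_zero ρ g), mul_comm, simpleCh, detSeries, ← map_mul]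
  ext d
  rw [HahnSeries.coeff_sub, FinGradedRep.coeff_ch, FinGradedRep.coeff_ch, h]
  simp only [trace_simpleAct hD hdeg]
  rfl

/-- For `g = 1` the numerator is a polynomial divisible by `det(1 - q)`. Its value at `q = 1` is the
difference of the dimensions, and it is zero because `V` is nonzero. -/
theorem dim_eq_dim [Nontrivial V] {N : Type*} [AddCommGroup N] [Module ℂ N]
    [Module (Cherednik ρ t c) N] [IsScalarTower ℂ (Cherednik ρ t c) N] [FiniteDimensional ℂ N]
    {D : Module.End ℂ N} (hD : IsGrading ρ t c D) {ip im : FinGradedRep G}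
    (h : ∀ d g, LinearMap.trace ℂ _ (ip.rep d g) - LinearMap.trace ℂ _ (im.rep d g) = hD.num d g) :
    ip.dim = im.dim := by
  classical
  obtain ⟨P, hP⟩ := hD.exists_polynomial 1
  let s : Finset ℤ := ip.finite_nontrivial.toFinset ∪ im.finite_nontrivial.toFinset ∪
    (detPoly ρ 1 * P).support.map (Nat.castEmbedding (R := ℤ))
  have h1 : (ip.dim : ℂ) - im.dim = 0 := by
    rw [ip.dim_eq_sum (s := s) (Finset.subset_union_left.trans Finset.subset_union_left),
      im.dim_eq_sum (s := s) (Finset.subset_union_right.trans Finset.subset_union_left),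
      ← Finset.sum_sub_distrib]
    simp only [h, IsGrading.num, hP, ← Polynomial.coe_mul]
    rw [sum_coeff_ofPowerSeries_coe _ Finset.subset_union_right, Polynomial.eval_mul,
      eval_one_detPoly_one, zero_mul]
  exact_mod_cast sub_eq_zero.mp h1

end

end Cherednik

end
noncomputable section

namespace Cherednik

/-! ### The anti-isomorphism with the Cherednik algebra of the dual representation -/

section

variable {G V : Type*} [Group G] [AddCommGroup V] [Module ℂ V] [FiniteDimensional ℂ V]
  {ρ : Representation ℂ G V}

omit [FiniteDimensional ℂ V] in
theorem dual_apply_apply (g : G) (f : Module.Dual ℂ V) (v : V) : ρ.dual g f v = f (ρ g⁻¹ v) := rfl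

omit [FiniteDimensional ℂ V] in
theorem dual_dual_eval (g : G) (v : V) :
    ρ.dual.dual g (Module.Dual.eval ℂ V v) = Module.Dual.eval ℂ V (ρ g v) := by
  ext f
  rw [dual_apply_apply, Module.Dual.eval_apply, dual_apply_apply, inv_inv, Module.Dual.eval_apply]

omit [FiniteDimensional ℂ V] in
theorem isReflection_dual_inv (s : G) : IsReflection ρ.dual s⁻¹ ↔ IsReflection ρ s := by
  have : ρ.dual s⁻¹ - LinearMap.id = (ρ s - LinearMap.id).dualMap := by
    ext f v
    rw [LinearMap.sub_apply, LinearMap.sub_apply, dual_apply_apply, inv_inv,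
      LinearMap.dualMap_apply, LinearMap.sub_apply, map_sub]
    rfl
  rw [IsReflection, IsReflection, this, LinearMap.finrank_range_dualMap_eq_finrank_range]

/-- Passing to the dual and inverting `s` cancel in the determinant. This is why the
anti-homomorphism needs `c s⁻¹` as parameter. -/
theorem reflForm_dual_inv (s : G) (v : V) (f : Module.Dual ℂ V) :
    reflForm ρ.dual s⁻¹ f (Module.Dual.eval ℂ V v) = reflForm ρ s v f := by
  have h : ∀ g, LinearMap.det (ρ.dual g) = LinearMap.det (ρ g⁻¹) := fun g =>
    (LinearMap.det_dualMap (ρ g⁻¹))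
  have h2 : LinearMap.det (ρ.dual.dual s⁻¹) = LinearMap.det (ρ.dual s) := by
    refine (LinearMap.det_dualMap (ρ.dual s⁻¹⁻¹)).trans ?_
    rw [inv_inv]
  have h3 : (reflEigenvalue ρ.dual s⁻¹) = reflEigenvalue ρ s := h2
  rw [reflForm, reflForm, reflDCheck, reflDCheck, h3, map_sub, map_sub, Module.Dual.eval_apply,
    Module.Dual.eval_apply, dual_apply_apply, inv_inv]

variable [Fintype G] {t : ℂ} {c : G → ℂ}

variable (ρ t c) in
/-- The anti-homomorphism that exchanges vectors and covectors and inverts group elements. -/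
def flipHom : Cherednik ρ t c →ₐ[ℂ] (Cherednik ρ.dual t fun s => c s⁻¹)ᵐᵒᵖ :=
  RingQuot.liftAlgHom ℂ ⟨FreeAlgebra.lift ℂ fun
    | .y v => .op (of ρ.dual t (fun s => c s⁻¹) (.x (Module.Dual.eval ℂ V v)))
    | .x f => .op (of ρ.dual t (fun s => c s⁻¹) (.y f))
    | .g a => .op (of ρ.dual t (fun s => c s⁻¹) (.g a⁻¹)), by
    classical
    intro p q h
    induction h with
    | y_add v w => simp [of_x_add]
    | y_smul a v => simp [of_x_smul]
    | x_add v w => simp [of_y_add]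
    | x_smul a v => simp [of_y_smul]
    | g_one => simp [of_g_one]
    | g_mul a b => simp [of_g_mul]
    | y_comm v w => simp [← MulOpposite.op_mul, of_x_comm _ _ _ (Module.Dual.eval ℂ V v)]
    | x_comm v w => simp [← MulOpposite.op_mul, of_y_comm _ _ _ v]
    | g_y a v =>
      rw [map_mul, map_mul]
      simp only [FreeAlgebra.lift_ι_apply, ← MulOpposite.op_mul]
      rw [of_g_x, dual_dual_eval, ← Module.End.mul_apply (ρ a⁻¹), ← map_mul, inv_mul_cancel,
        map_one, Module.End.one_apply]
    | g_x a f =>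
      rw [map_mul, map_mul]
      simp only [FreeAlgebra.lift_ι_apply, ← MulOpposite.op_mul]
      rw [of_g_y, ← Module.End.mul_apply (ρ.dual a⁻¹), ← map_mul, inv_mul_cancel,
        map_one, Module.End.one_apply]
    | y_x v f =>
      rw [map_sub, map_mul, map_mul, map_sub, map_sum]
      simp only [map_smul, FreeAlgebra.lift_ι_apply, map_one, ← MulOpposite.op_mul,
        ← MulOpposite.op_sub]
      rw [of_y_x, add_sub_cancel_left, MulOpposite.op_sub, MulOpposite.op_smul, MulOpposite.op_one,
        Module.Dual.eval_apply]
      congr 1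
      rw [← MulOpposite.opAddEquiv_apply, map_sum]
      -- Inversion matches the reflections of the two representations, and `c (s⁻¹)⁻¹ = c s`.
      refine (Finset.sum_equiv (Equiv.inv G) (fun s => ?_) fun s _ => ?_).symm
      · simp [isReflection_dual_inv]
      · simp [reflForm_dual_inv]⟩

theorem flipHom_of (a : CherednikGen G V) : flipHom ρ t c (of ρ t c a) =
    match a with
    | .y v => .op (of ρ.dual t (fun s => c s⁻¹) (.x (Module.Dual.eval ℂ V v)))
    | .x f => .op (of ρ.dual t (fun s => c s⁻¹) (.y f))
    | .g a => .op (of ρ.dual t (fun s => c s⁻¹) (.g a⁻¹)) := by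
  have h : flipHom ρ t c (of ρ t c a) = _ :=
    (RingQuot.liftAlgHom_mkAlgHom_apply ℂ _ _ _).trans (FreeAlgebra.lift_ι_apply _ _)
  rw [h]

/-! ### Dual modules -/

/-- The dual of a module over the Cherednik algebra of the dual representation. -/
@[nolint unusedArguments]
def FlipDual (_ρ : Representation ℂ G V) (_t : ℂ) (_c : G → ℂ) (M : Type*) [AddCommGroup M]
    [Module ℂ M] : Type _ := Module.Dual ℂ M

section

variable {M : Type*} [AddCommGroup M] [Module ℂ M] [Module (Cherednik ρ.dual t fun s => c s⁻¹) M]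
  [IsScalarTower ℂ (Cherednik ρ.dual t fun s => c s⁻¹) M]

instance : AddCommGroup (FlipDual ρ t c M) := inferInstanceAs (AddCommGroup (Module.Dual ℂ M))

instance : Module ℂ (FlipDual ρ t c M) := inferInstanceAs (Module ℂ (Module.Dual ℂ M))

variable (ρ t c M) in
/-- Elements of the dual module as functionals. -/
def flipEval : FlipDual ρ t c M ≃ₗ[ℂ] Module.Dual ℂ M := LinearEquiv.refl ℂ _

instance : SMul (Cherednik ρ t c) (FlipDual ρ t c M) where
  smul h φ := (flipEval ρ t c M).symm (flipEval ρ t c M φ ∘ₗ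
    Algebra.lsmul ℂ ℂ M (flipHom ρ t c h).unop)

theorem flipEval_smul (h : Cherednik ρ t c) (φ : FlipDual ρ t c M) (m : M) :
    flipEval ρ t c M (h • φ) m = flipEval ρ t c M φ ((flipHom ρ t c h).unop • m) := rfl

omit [FiniteDimensional ℂ V] [Fintype G] [Module (Cherednik ρ.dual t fun s => c s⁻¹) M]
  [IsScalarTower ℂ (Cherednik ρ.dual t fun s => c s⁻¹) M] in
theorem flipDual_ext {φ ψ : FlipDual ρ t c M}
    (h : ∀ m, flipEval ρ t c M φ m = flipEval ρ t c M ψ m) : φ = ψ :=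
  (flipEval ρ t c M).injective (LinearMap.ext h)

instance : Module (Cherednik ρ t c) (FlipDual ρ t c M) where
  one_smul φ := flipDual_ext fun m => by rw [flipEval_smul, map_one, MulOpposite.unop_one, one_smul]
  mul_smul h h' φ := flipDual_ext fun m => by
    rw [flipEval_smul, flipEval_smul, flipEval_smul, map_mul, MulOpposite.unop_mul, mul_smul]
  smul_zero h := flipDual_ext fun m => by
    rw [flipEval_smul, map_zero, LinearMap.zero_apply, LinearMap.zero_apply]
  smul_add h φ ψ := flipDual_ext fun m => by
    rw [flipEval_smul, map_add, map_add, LinearMap.add_apply, LinearMap.add_apply, flipEval_smul,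
      flipEval_smul]
  add_smul h h' φ := flipDual_ext fun m => by
    rw [flipEval_smul, map_add, MulOpposite.unop_add, add_smul, map_add, map_add,
      LinearMap.add_apply, flipEval_smul, flipEval_smul]
  zero_smul φ := flipDual_ext fun m => by
    rw [flipEval_smul, map_zero, MulOpposite.unop_zero, zero_smul, map_zero, map_zero,
      LinearMap.zero_apply]

instance : IsScalarTower ℂ (Cherednik ρ t c) (FlipDual ρ t c M) where
  smul_assoc a h φ := flipDual_ext fun m => by
    rw [flipEval_smul, show flipHom ρ t c (a • h) = a • flipHom ρ t c h from
        (flipHom ρ t c).toLinearMap.map_smul a h,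
      MulOpposite.unop_smul, smul_assoc, (flipEval ρ t c M φ).map_smul,
      (flipEval ρ t c M).map_smul, LinearMap.smul_apply, flipEval_smul]

theorem flipEval_x_smul (f : Module.Dual ℂ V) (φ : FlipDual ρ t c M) (m : M) :
    flipEval ρ t c M (of ρ t c (.x f) • φ) m =
      flipEval ρ t c M φ (of ρ.dual t (fun s => c s⁻¹) (.y f) • m) := by
  rw [flipEval_smul, flipHom_of]; rfl

theorem flipEval_y_smul (v : V) (φ : FlipDual ρ t c M) (m : M) :
    flipEval ρ t c M (of ρ t c (.y v) • φ) m =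
      flipEval ρ t c M φ (of ρ.dual t (fun s => c s⁻¹) (.x (Module.Dual.eval ℂ V v)) • m) := by
  rw [flipEval_smul, flipHom_of]; rfl

theorem flipEval_g_smul (a : G) (φ : FlipDual ρ t c M) (m : M) :
    flipEval ρ t c M (of ρ t c (.g a) • φ) m =
      flipEval ρ t c M φ (of ρ.dual t (fun s => c s⁻¹) (.g a⁻¹) • m) := by
  rw [flipEval_smul, flipHom_of]; rfl

end

/-! ### The contravariant pairing -/

omit [FiniteDimensional ℂ V] [Fintype G] in
theorem dual_invariant (hc : ∀ s g : G, IsReflection ρ s → c (g * s * g⁻¹) = c s) (s g : G)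
    (hs : IsReflection ρ.dual s) :
    (fun s => c s⁻¹) (g * s * g⁻¹) = (fun s => c s⁻¹) s := by
  beta_reduce
  rw [← inv_inv s, isReflection_dual_inv] at hs
  rw [← hc s⁻¹ g hs]
  congr 1
  group

omit [FiniteDimensional ℂ V] [Fintype G] in
-- In finite dimension a subspace of the dual is the annihilator of its coannihilator, and the
-- latter is invariant whenever the former is.
theorem isIrreducible_dual {W : Type*} [AddCommGroup W] [Module ℂ W] [FiniteDimensional ℂ W]
    {τ : Representation ℂ G W} (hτ : τ.IsIrreducible) : τ.dual.IsIrreducible := by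
  have key : ∀ U : Subrepresentation τ.dual, U.toSubmodule = ⊥ ∨ U.toSubmodule = ⊤ := by
    intro U
    rw [← Subspace.dualCoannihilator_dualAnnihilator_eq (W := U.toSubmodule)]
    have hU : ∀ g, ∀ w ∈ U.toSubmodule.dualCoannihilator,
        τ g w ∈ U.toSubmodule.dualCoannihilator := fun g w hw => by
      rw [Submodule.mem_dualCoannihilator] at hw ⊢
      intro ξ hξ
      have h1 := hw _ (U.apply_mem_toSubmodule g⁻¹ hξ)
      rwa [dual_apply_apply, inv_inv] at h1
    rcases submodule_eq_bot_or_top hτ U.toSubmodule.dualCoannihilator hU with h | h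
    · right
      rw [h, Submodule.dualAnnihilator_bot]
    · left
      rw [h, Submodule.dualAnnihilator_top]
  have := nontrivial_of_isIrreducible hτ
  exact
    { exists_pair_ne := ⟨⊥, ⊤, fun h => bot_ne_top (congrArg Subrepresentation.toSubmodule h)⟩
      eq_bot_or_eq_top := fun U => (key U).imp (fun h => Subrepresentation.toSubmodule_injective h)
        fun h => Subrepresentation.toSubmodule_injective h }

variable {W : Type*} [AddCommGroup W] [Module ℂ W] [FiniteDimensional ℂ W]
  {τ : Representation ℂ G W} {r r' : ℕ}

/-- The contravariant pairing of the polynomial modules of `τ` and of its dual. -/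
theorem exists_polyPairing (b : Module.Basis (Fin r) ℂ (Module.Dual ℂ V))
    (b' : Module.Basis (Fin r') ℂ (Module.Dual ℂ (Module.Dual ℂ V)))
    (hc : ∀ s g : G, IsReflection ρ s → c (g * s * g⁻¹) = c s) (τ : Representation ℂ G W) :
    ∃ β : Poly b t hc τ →ₗ[ℂ] Poly (c := fun s => c s⁻¹) b' t (dual_invariant hc) τ.dual →ₗ[ℂ] ℂ,
      (∀ m, (∀ m', β m m' = 0) ↔ m ∈ polyRad b t hc τ) ∧
      (∀ m', (∀ m, β m m' = 0) ↔ m' ∈ polyRad (c := fun s => c s⁻¹) b' t (dual_invariant hc) τ.dual) ∧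
      (∀ a m m', β (of ρ t c (.g a) • m) m' =
        β m (of ρ.dual t (fun s => c s⁻¹) (.g a⁻¹) • m')) ∧
      ∀ m m', β (polyDeg b t hc τ m) m' = β m (polyDeg (c := fun s => c s⁻¹) b' t (dual_invariant hc) τ.dual m') := by
  let P' := Poly (c := fun s => c s⁻¹) b' t (dual_invariant hc) τ.dual
  let pr' := polyPr (c := fun s => c s⁻¹) b' t (dual_invariant hc) τ.dual
  -- A vector of `W` becomes the functional "evaluate the constant term". Vectors of `V` kill it,
  -- since on the dual module they act by transposed covectors, whose image has no constant term;
  -- the universal property then produces the pairing.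
  let e : W →ₗ[ℂ] FlipDual ρ t c P' :=
    (flipEval ρ t c P').symm.toLinearMap ∘ₗ pr'.dualMap ∘ₗ Module.Dual.eval ℂ W
  have he : ∀ w m', flipEval ρ t c P' (e w) m' = pr' m' w := fun w m' => rfl
  obtain ⟨Φ, hΦ⟩ := exists_polyLift (b := b) (hc := hc) (τ := τ) e
    (fun a w => flipDual_ext fun m' => by
      rw [flipEval_g_smul, he, he]
      have := congrArg (fun ξ : Module.Dual ℂ W => ξ w) (polyPr_g_smul a⁻¹ m')
      beta_reduce at this
      rw [dual_apply_apply, inv_inv] at this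
      exact this.symm)
    (fun v w => flipDual_ext fun m' => by
      rw [flipEval_y_smul, he]
      exact congrArg (fun ξ : Module.Dual ℂ W => ξ w) (polyPr_x_smul _ m'))
  let β := (flipEval ρ t c P').toLinearMap ∘ₗ Φ.restrictScalars ℂ
  have hβ : ∀ m, β m = flipEval ρ t c P' (Φ m) := fun m => rfl
  have hβc : ∀ w m', β (polyConst b t hc τ w) m' = pr' m' w := fun w m' => by rw [hβ, hΦ, he]
  have hβx : ∀ f m m', β (of ρ t c (.x f) • m) m' =
      β m (of ρ.dual t (fun s => c s⁻¹) (.y f) • m') := fun f m m' => by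
    rw [hβ, map_smul, flipEval_x_smul]; rfl
  have hβy : ∀ v m m', β (of ρ t c (.y v) • m) m' =
      β m (of ρ.dual t (fun s => c s⁻¹) (.x (Module.Dual.eval ℂ V v)) • m') := fun v m m' => by
    rw [hβ, map_smul, flipEval_y_smul]; rfl
  have hβg : ∀ a m m', β (of ρ t c (.g a) • m) m' =
      β m (of ρ.dual t (fun s => c s⁻¹) (.g a⁻¹) • m') := fun a m m' => by
    rw [hβ, map_smul, flipEval_g_smul]; rfl
  -- The construction treats the two sides differently; this formula restores the symmetry.
  have hβc' : ∀ m ξ, β m (polyConst (c := fun s => c s⁻¹) b' t (dual_invariant hc) τ.dual ξ) =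
      ξ (polyPr b t hc τ m) := by
    intro m ξ
    have : β.flip (polyConst (c := fun s => c s⁻¹) b' t (dual_invariant hc) τ.dual ξ) = ξ ∘ₗ polyPr b t hc τ := by
      refine poly_ext (fun w => ?_) fun f m _ => ?_
      · rw [LinearMap.flip_apply, hβc, LinearMap.comp_apply, polyPr_polyConst w]
        exact congrArg (fun ξ : Module.Dual ℂ W => ξ w)
          (polyPr_polyConst (c := fun s => c s⁻¹) (b := b') (hc := dual_invariant hc)
            (τ := τ.dual) (t := t) ξ)
      · rw [LinearMap.flip_apply, hβx, y_smul_polyConst, map_zero, LinearMap.comp_apply,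
          polyPr_x_smul, map_zero]
    exact LinearMap.congr_fun this m
  refine ⟨β, fun m => ⟨fun h k => ?_, fun hm => ?_⟩, fun m' => ⟨fun h k => ?_, fun hm' => ?_⟩, hβg,
    ?_⟩
  · have h1 : Φ m = 0 := flipDual_ext fun m' => by rw [← hβ, h, map_zero, LinearMap.zero_apply]
    rw [← Module.forall_dual_apply_eq_zero_iff ℂ]
    intro ξ
    rw [← hβc', hβ, map_smul, h1, smul_zero, map_zero, LinearMap.zero_apply]
  -- The orthogonal of the radical contains the constants, and it is stable under covectors because
  -- these move across the pairing to elements of the algebra preserving the radical. So it is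
  -- everything.
  · let K : Submodule ℂ P' := ⨅ m : polyRad b t hc τ, LinearMap.ker (β m)
    have hK : ∀ m', m' ∈ K ↔ ∀ m ∈ polyRad b t hc τ, β m m' = 0 := fun m' => by
      simp [K, Submodule.mem_iInf]
    have htop : K = ⊤ := by
      refine poly_eq_top K (fun ξ => ?_) fun F m' hm' => ?_
      · rw [hK]
        intro m hm
        have := hm 1
        rw [one_smul] at this
        rw [hβc', this, map_zero]
      · rw [hK] at hm' ⊢
        intro m hm
        obtain ⟨v, rfl⟩ := (Module.evalEquiv ℂ V).surjective F
        refine (hβy v m m').symm.trans (hm' _ ((polyRad b t hc τ).smul_mem _ hm))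
    exact fun m' => (hK m').mp (htop ▸ Submodule.mem_top) m hm
  · let K : Submodule ℂ P' := LinearMap.ker β.flip
    have hK : ∀ m', m' ∈ K ↔ ∀ m, β m m' = 0 := fun m' => by
      rw [LinearMap.mem_ker, LinearMap.ext_iff]; rfl
    have hKs := mem_of_gen (K := K) (fun a m' hm' => by
      rw [hK] at hm' ⊢
      intro m
      cases a with
      | x F =>
        obtain ⟨v, rfl⟩ := (Module.evalEquiv ℂ V).surjective F
        exact (hβy v m m').symm.trans (hm' _)
      | y f => rw [← hβx, hm']
      | g a =>
        have := hβg a⁻¹ m m'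
        rw [inv_inv] at this
        rw [← this, hm']) k m' ((hK m').mpr h)
    refine LinearMap.ext fun w => ?_
    exact (hβc w _).symm.trans ((hK _).mp hKs _)
  · let K : Submodule ℂ (Poly b t hc τ) :=
      ⨅ m' : polyRad (c := fun s => c s⁻¹) b' t (dual_invariant hc) τ.dual, LinearMap.ker (β.flip m')
    have hK : ∀ m, m ∈ K ↔ ∀ m' ∈ polyRad (c := fun s => c s⁻¹) b' t (dual_invariant hc) τ.dual, β m m' = 0 :=
      fun m => by simp [K, Submodule.mem_iInf]
    have htop : K = ⊤ := by
      refine poly_eq_top K (fun w => ?_) fun f m hm => ?_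
      · rw [hK]
        intro m' hm'
        have := hm' 1
        rw [one_smul] at this
        rw [hβc]
        exact congrArg (fun ξ : Module.Dual ℂ W => ξ w) this
      · rw [hK] at hm ⊢
        intro m' hm'
        rw [hβx]
        exact hm _ ((polyRad (c := fun s => c s⁻¹) b' t (dual_invariant hc) τ.dual).smul_mem _ hm')
    exact fun m => (hK m).mp (htop ▸ Submodule.mem_top) m' hm'
  -- A covector on the left, of degree `1`, moves to the right as a vector, of degree `-1`; the two
  -- shifts cancel.
  · have : β ∘ₗ polyDeg b t hc τ =
        (polyDeg (c := fun s => c s⁻¹) b' t (dual_invariant hc) τ.dual).dualMap ∘ₗ β := by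
      refine poly_ext (fun w => LinearMap.ext fun m' => ?_) fun f m hm => LinearMap.ext fun m' => ?_
      · change β (polyDeg b t hc τ (polyConst b t hc τ w)) m' =
          β (polyConst b t hc τ w) (polyDeg (c := fun s => c s⁻¹) b' t (dual_invariant hc) τ.dual m')
        rw [polyDeg_polyConst, β.map_zero, LinearMap.zero_apply, hβc]
        exact (congrArg (fun ξ : Module.Dual ℂ W => ξ w) (polyPr_polyDeg m')).symm
      · have h : ∀ m', β (polyDeg b t hc τ m) m' =
            β m (polyDeg (c := fun s => c s⁻¹) b' t (dual_invariant hc) τ.dual m') :=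
          fun m' => LinearMap.congr_fun hm m'
        change β (polyDeg b t hc τ (of ρ t c (.x f) • m)) m' = β (of ρ t c (.x f) • m)
          (polyDeg (c := fun s => c s⁻¹) b' t (dual_invariant hc) τ.dual m')
        rw [polyDeg_x_smul, β.map_add, LinearMap.add_apply, hβx, hβx, hβx, h, polyDeg_y_smul, map_sub,
          sub_add_cancel]
    exact fun m m' => LinearMap.congr_fun (LinearMap.congr_fun this m) m'

end

end Cherednik

end
noncomputable section

namespace Cherednik

/-! ### The contravariant pairing of simple modules -/

section

variable {N N' : Type*} [AddCommGroup N] [Module ℂ N] [AddCommGroup N'] [Module ℂ N']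
  {γ : N →ₗ[ℂ] N' →ₗ[ℂ] ℂ} {D : Module.End ℂ N} {D' : Module.End ℂ N'}

theorem pairing_eq_zero_of_ne (hγ : ∀ m m', γ (D m) m' = γ m (D' m')) {μ ν : ℂ} (hμν : μ ≠ ν)
    {m : N} (hm : m ∈ D.eigenspace μ) {m' : N'} (hm' : m' ∈ D'.eigenspace ν) : γ m m' = 0 := by
  have h := hγ m m'
  rw [Module.End.mem_eigenspace_iff.mp hm, Module.End.mem_eigenspace_iff.mp hm', map_smul, map_smul,
    LinearMap.smul_apply, smul_eq_mul, smul_eq_mul] at h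
  have h2 : (μ - ν) * γ m m' = 0 := by linear_combination h
  exact (mul_eq_zero.mp h2).resolve_left (sub_ne_zero.mpr hμν)

theorem eq_zero_of_pairing_eigenspace (hl : ∀ m, (∀ m', γ m m' = 0) → m = 0)
    (hγ : ∀ m m', γ (D m) m' = γ m (D' m')) (htop : ⨆ n : ℕ, D'.eigenspace (n : ℂ) = ⊤) {n : ℕ}
    {m : N} (hm : m ∈ D.eigenspace (n : ℂ)) (h : ∀ m' ∈ D'.eigenspace (n : ℂ), γ m m' = 0) :
    m = 0 := by
  refine hl m fun m' => ?_
  have : ⨆ k : ℕ, D'.eigenspace (k : ℂ) ≤ LinearMap.ker (γ m) := iSup_le fun k m' hm' => by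
    by_cases hk : n = k
    · subst hk
      exact h m' hm'
    · exact pairing_eq_zero_of_ne hγ (Nat.cast_injective.ne hk) hm hm'
  exact this (htop ▸ Submodule.mem_top)

theorem finiteDimensional_of_pairing [FiniteDimensional ℂ N]
    (hr : ∀ m', (∀ m, γ m m' = 0) → m' = 0) : FiniteDimensional ℂ N' :=
  FiniteDimensional.of_injective γ.flip ((injective_iff_map_eq_zero γ.flip).mpr fun m' hm' =>
    hr m' fun m => LinearMap.congr_fun hm' m)

/-- The kernels of the quotient maps are exactly the two radicals, so the pairing computed through
arbitrary linear sections is well defined and nondegenerate. -/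
theorem exists_pairing_of_surjective {P P' : Type*} [AddCommGroup P] [Module ℂ P] [AddCommGroup P']
    [Module ℂ P'] (β : P →ₗ[ℂ] P' →ₗ[ℂ] ℂ) {q : P →ₗ[ℂ] N} {q' : P' →ₗ[ℂ] N'}
    (hq : Function.Surjective q) (hq' : Function.Surjective q')
    (h : ∀ m, (∀ m', β m m' = 0) ↔ q m = 0) (h' : ∀ m', (∀ m, β m m' = 0) ↔ q' m' = 0) :
    ∃ γ : N →ₗ[ℂ] N' →ₗ[ℂ] ℂ, (∀ m, (∀ m', γ m m' = 0) → m = 0) ∧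
      (∀ m', (∀ m, γ m m' = 0) → m' = 0) ∧ ∀ m m', γ (q m) (q' m') = β m m' := by
  obtain ⟨σ, hσ⟩ := LinearMap.exists_rightInverse_of_surjective q (LinearMap.range_eq_top.mpr hq)
  obtain ⟨σ', hσ'⟩ :=
    LinearMap.exists_rightInverse_of_surjective q' (LinearMap.range_eq_top.mpr hq')
  have hqσ : ∀ l, q (σ l) = l := LinearMap.congr_fun hσ
  have hqσ' : ∀ l, q' (σ' l) = l := LinearMap.congr_fun hσ'
  have key : ∀ m m', β (σ (q m)) (σ' (q' m')) = β m m' := fun m m' => by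
    have h3 := (h (σ (q m) - m)).mpr (by rw [map_sub, hqσ, sub_self]) (σ' (q' m'))
    have h4 := (h' (σ' (q' m') - m')).mpr (by rw [map_sub, hqσ', sub_self]) m
    rw [map_sub, LinearMap.sub_apply, sub_eq_zero] at h3
    rw [map_sub, sub_eq_zero] at h4
    exact h3.trans h4
  refine ⟨β.compl₁₂ σ σ', fun l hl => ?_, fun l' hl' => ?_, key⟩
  · obtain ⟨m, rfl⟩ := hq l
    exact (h m).mp fun m' => (key m m').symm.trans (hl _)
  · obtain ⟨m', rfl⟩ := hq' l'
    exact (h' m').mp fun m => (key m m').symm.trans (hl' _)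

theorem pairing_apply_comm_of_surjective {P P' : Type*} [AddCommGroup P] [Module ℂ P]
    [AddCommGroup P'] [Module ℂ P'] {β : P →ₗ[ℂ] P' →ₗ[ℂ] ℂ} {q : P →ₗ[ℂ] N} {q' : P' →ₗ[ℂ] N'}
    (hq : Function.Surjective q) (hq' : Function.Surjective q')
    (hβ : ∀ m m', γ (q m) (q' m') = β m m') {E : P → P} {E' : P' → P'} {D : N → N} {D' : N' → N'}
    (hE : ∀ m m', β (E m) m' = β m (E' m')) (hD : ∀ m, q (E m) = D (q m))
    (hD' : ∀ m, q' (E' m) = D' (q' m)) (l : N) (l' : N') : γ (D l) l' = γ l (D' l') := by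
  obtain ⟨m, rfl⟩ := hq l
  obtain ⟨m', rfl⟩ := hq' l'
  rw [← hD, ← hD', hβ, hβ, hE]

/-- Different degrees are orthogonal, so the pairing restricts to a perfect pairing of the degree
`n` parts; adjoint operators for a perfect pairing have equal traces. -/
theorem trace_eigenspace_eq_of_pairing (hl : ∀ m, (∀ m', γ m m' = 0) → m = 0)
    (hr : ∀ m', (∀ m, γ m m' = 0) → m' = 0)
    (hγ : ∀ m m', γ (D m) m' = γ m (D' m')) (htop : ⨆ n : ℕ, D.eigenspace (n : ℂ) = ⊤)
    (htop' : ⨆ n : ℕ, D'.eigenspace (n : ℂ) = ⊤) (n : ℕ)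
    [FiniteDimensional ℂ (D.eigenspace (n : ℂ))] [FiniteDimensional ℂ (D'.eigenspace (n : ℂ))]
    {a : Module.End ℂ N} {a' : Module.End ℂ N'} (ha : ∀ m m', γ (a m) m' = γ m (a' m'))
    (h : ∀ m ∈ D.eigenspace (n : ℂ), a m ∈ D.eigenspace (n : ℂ))
    (h' : ∀ m ∈ D'.eigenspace (n : ℂ), a' m ∈ D'.eigenspace (n : ℂ)) :
    LinearMap.trace ℂ _ (a.restrict h) = LinearMap.trace ℂ _ (a'.restrict h') := by
  let p := γ.domRestrict₁₂ (D.eigenspace (n : ℂ)) (D'.eigenspace (n : ℂ))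
  have hp : Function.Injective p := (injective_iff_map_eq_zero p).mpr fun m hm =>
    Subtype.ext (eq_zero_of_pairing_eigenspace hl hγ htop' m.2 fun m' hm' =>
      LinearMap.congr_fun hm ⟨m', hm'⟩)
  have hp' : Function.Injective p.flip := (injective_iff_map_eq_zero p.flip).mpr fun m' hm' =>
    Subtype.ext (eq_zero_of_pairing_eigenspace (γ := γ.flip) hr (fun m' m => (hγ m m').symm) htop
      m'.2 fun m hm => LinearMap.congr_fun hm' ⟨m, hm⟩)
  have := LinearMap.IsPerfPair.of_injective hp hp'
  rw [← LinearMap.trace_transpose' (a'.restrict h'), ← LinearMap.trace_conj' _ p.toPerfPair]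
  congr 1
  ext φ m'
  obtain ⟨m, rfl⟩ := p.toPerfPair.surjective φ
  rw [LinearEquiv.conj_apply_apply, LinearEquiv.symm_apply_apply]
  exact ha m m'

end

section

variable {G V : Type*} [Group G] [Fintype G] [AddCommGroup V] [Module ℂ V] [FiniteDimensional ℂ V]
  {ρ : Representation ℂ G V} {t : ℂ} {c : G → ℂ} {W : Type*} [AddCommGroup W] [Module ℂ W]
  [FiniteDimensional ℂ W] {τ : Representation ℂ G W} {r r' : ℕ}

theorem exists_simplePairing (b : Module.Basis (Fin r) ℂ (Module.Dual ℂ V))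
    (b' : Module.Basis (Fin r') ℂ (Module.Dual ℂ (Module.Dual ℂ V)))
    (hc : ∀ s g : G, IsReflection ρ s → c (g * s * g⁻¹) = c s) (hτ : τ.IsIrreducible)
    {D : Module.End ℂ (Simple ρ t c τ)}
    (hD : ∀ m, polyToSimple b t hc τ (polyDeg b t hc τ m) = D (polyToSimple b t hc τ m))
    {D' : Module.End ℂ (Simple ρ.dual t (fun s => c s⁻¹) τ.dual)}
    (hD' : ∀ m, polyToSimple (c := fun s => c s⁻¹) b' t (dual_invariant hc) τ.dual
      (polyDeg (c := fun s => c s⁻¹) b' t (dual_invariant hc) τ.dual m) =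
        D' (polyToSimple (c := fun s => c s⁻¹) b' t (dual_invariant hc) τ.dual m)) :
    ∃ γ : Simple ρ t c τ →ₗ[ℂ] Simple ρ.dual t (fun s => c s⁻¹) τ.dual →ₗ[ℂ] ℂ,
      (∀ m, (∀ m', γ m m' = 0) → m = 0) ∧ (∀ m', (∀ m, γ m m' = 0) → m' = 0) ∧
      (∀ a m m', γ (of ρ t c (.g a) • m) m' =
        γ m (of ρ.dual t (fun s => c s⁻¹) (.g a⁻¹) • m')) ∧
      ∀ m m', γ (D m) m' = γ m (D' m') := by
  obtain ⟨β, hβ, hβ', hg, hdeg⟩ := exists_polyPairing (t := t) b b' hc τ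
  have hq := polyToSimple_surjective (b := b) (t := t) (hc := hc) (τ := τ)
  have hq' := polyToSimple_surjective (c := fun s => c s⁻¹) (b := b') (t := t)
    (hc := dual_invariant hc) (τ := τ.dual)
  obtain ⟨γ, hl, hr, hγ⟩ := exists_pairing_of_surjective β
    (q := (polyToSimple b t hc τ).restrictScalars ℂ)
    (q' := (polyToSimple (c := fun s => c s⁻¹) b' t (dual_invariant hc) τ.dual).restrictScalars ℂ)
    hq hq' (fun m => (hβ m).trans (polyToSimple_eq_zero_iff hτ).symm)
    (fun m' => (hβ' m').trans (polyToSimple_eq_zero_iff (isIrreducible_dual hτ)).symm)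
  exact ⟨γ, hl, hr, fun a => pairing_apply_comm_of_surjective hq hq' hγ (hg a)
    (fun m => (polyToSimple b t hc τ).map_smul _ m)
    (fun m => (polyToSimple (c := fun s => c s⁻¹) b' t (dual_invariant hc) τ.dual).map_smul _ m),
    pairing_apply_comm_of_surjective hq hq' hγ hdeg hD hD'⟩

omit [FiniteDimensional ℂ V] [FiniteDimensional ℂ W] in
theorem tr_dual_eq {D : Module.End ℂ (Simple ρ t c τ)} (hD : IsGrading ρ t c D)
    {D' : Module.End ℂ (Simple ρ.dual t (fun s => c s⁻¹) τ.dual)}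
    (hD' : IsGrading ρ.dual t (fun s => c s⁻¹) D')
    {γ : Simple ρ t c τ →ₗ[ℂ] Simple ρ.dual t (fun s => c s⁻¹) τ.dual →ₗ[ℂ] ℂ}
    (hl : ∀ m, (∀ m', γ m m' = 0) → m = 0) (hr : ∀ m', (∀ m, γ m m' = 0) → m' = 0)
    (hg : ∀ a m m', γ (of ρ t c (.g a) • m) m' =
      γ m (of ρ.dual t (fun s => c s⁻¹) (.g a⁻¹) • m'))
    (hγ : ∀ m m', γ (D m) m' = γ m (D' m')) (n : ℕ) (g : G) : hD'.tr n g = hD.tr n g⁻¹ := by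
  have := hD.finite n
  have := hD'.finite n
  refine (trace_eigenspace_eq_of_pairing hl hr hγ hD.iSup_eq_top hD'.iSup_eq_top n
    (a := Algebra.lsmul ℂ ℂ _ (of ρ t c (.g g⁻¹)))
    (a' := Algebra.lsmul ℂ ℂ _ (of ρ.dual t (fun s => c s⁻¹) (.g g))) (fun m m' => ?_) _ _).symm
  have := hg g⁻¹ m m'
  rwa [inv_inv] at this

end

end Cherednik

end
noncomputable section

/-! ### Graded representations: shifts and disjointness of duals -/

/-- Every equivariant map between the duals is the transpose of an equivariant map the other way, by
reflexivity of `B`. -/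
theorem Cherednik.dualHom_eq_zero {G A B : Type*} [Group G] [AddCommGroup A] [Module ℂ A]
    [AddCommGroup B] [Module ℂ B] [FiniteDimensional ℂ B] {α : Representation ℂ G A}
    {β : Representation ℂ G B} (h : ∀ e : A →ₗ[ℂ] B, (∀ g v, e (α g v) = β g (e v)) → e = 0)
    {f : Module.Dual ℂ B →ₗ[ℂ] Module.Dual ℂ A} (hf : ∀ g φ, f (β.dual g φ) = α.dual g (f φ)) :
    f = 0 := by
  let e := (Module.evalEquiv ℂ B).symm.toLinearMap ∘ₗ f.dualMap ∘ₗ Module.Dual.eval ℂ A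
  have he : ∀ v φ, φ (e v) = f φ v := fun v φ =>
    LinearMap.congr_fun
      ((Module.evalEquiv ℂ B).apply_symm_apply (f.dualMap (Module.Dual.eval ℂ A v))) φ
  have h0 : e = 0 := h e fun g v => by
    rw [← sub_eq_zero, ← Module.forall_dual_apply_eq_zero_iff ℂ]
    intro φ
    have h1 := he v (β.dual g⁻¹ φ)
    rw [hf, dual_apply_apply, dual_apply_apply, inv_inv] at h1
    rw [map_sub, he, h1, sub_self]
  refine LinearMap.ext fun φ => LinearMap.ext fun v => ?_
  rw [← he, h0, LinearMap.zero_apply, map_zero]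
  rfl

namespace FinGradedRep

variable {G : Type*} [Group G]

/-- The graded representation `E` with degrees raised by `k`. -/
def shift (E : FinGradedRep G) (k : ℤ) : FinGradedRep G where
  carrier d := E.carrier (d - k)
  rep d := E.rep (d - k)
  finite_nontrivial := E.finite_nontrivial.preimage (f := fun d : ℤ => d - k)
    (sub_left_injective.injOn)

theorem ch_eq_single_mul_ch_shift (E : FinGradedRep G) (k : ℤ) (g : G) :
    E.ch g = HahnSeries.single (-k) 1 * (E.shift k).ch g := by
  ext d
  rw [HahnSeries.coeff_single_mul, one_mul, coeff_ch, coeff_ch]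
  change _ = LinearMap.trace ℂ (E.carrier (d - -k - k)) (E.rep (d - -k - k) g)
  rw [show d - -k - k = d by ring]

variable {E F : FinGradedRep G}

theorem Disjoint.shift (h : E.Disjoint F) (k : ℤ) : (E.shift k).Disjoint (F.shift k) :=
  fun d f => h (d - k) f

theorem Disjoint.dual (h : E.Disjoint F) : F.dual.Disjoint E.dual := fun d f =>
  Representation.IntertwiningMap.toLinearMap_injective _ _ <|
    Cherednik.dualHom_eq_zero (α := E.rep (-d)) (β := F.rep (-d))
      (fun e he => congrArg Representation.IntertwiningMap.toLinearMap
        (h (-d) ⟨e, fun g => LinearMap.ext (he g)⟩))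
      fun g => LinearMap.congr_fun (f.isIntertwining' g)

theorem Disjoint.twist (h : E.Disjoint F) (χ : G →* ℂ) : (E.twist χ).Disjoint (F.twist χ) := by
  intro d f
  let e : E.carrier d →ₗ[ℂ] F.carrier d := f.toLinearMap
  have h0 := h d ⟨e, fun g => LinearMap.ext fun v => by
    have h1 : e (χ g • E.rep d g v) = χ g • F.rep d g (e v) :=
      LinearMap.congr_fun (f.isIntertwining' g) v
    have hχ : χ g ≠ 0 := left_ne_zero_of_mul_eq_one (b := χ g⁻¹) (by
      rw [← map_mul, mul_inv_cancel, map_one])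
    rw [e.map_smul] at h1
    exact smul_right_injective _ hχ h1⟩
  have h1 : e = 0 := congrArg Representation.IntertwiningMap.toLinearMap h0
  exact Representation.IntertwiningMap.toLinearMap_injective _ _ h1

theorem trace_dual_twist_shift (E : FinGradedRep G) (χ : G →* ℂ) (k d : ℤ) (g : G) :
    LinearMap.trace ℂ _ (((E.dual.twist χ).shift k).rep d g) =
      χ g * LinearMap.trace ℂ _ (E.rep (k - d) g⁻¹) := by
  change LinearMap.trace ℂ (Module.Dual ℂ (E.carrier (-(d - k))))
    (χ g • Module.Dual.transpose (E.rep (-(d - k)) g⁻¹)) = _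
  rw [map_smul, LinearMap.trace_transpose', smul_eq_mul, neg_sub]

end FinGradedRep

namespace Cherednik

/-! ### Duality of the numerators -/

section

variable {G V : Type*} [Group G] [AddCommGroup V] [Module ℂ V]
  {ρ : Representation ℂ G V}

/-- This is the product of the identities `1 - κ q = -κ q (1 - κ⁻¹ q⁻¹)`. It is stated on
coefficients because replacing `q` by `q⁻¹` does not preserve Laurent series. -/
theorem coeff_prod_one_sub_single {ι : Type*} (s : Finset ι) (κ : ι → ℂ) (hκ : ∀ i, κ i ≠ 0)
    (e : ℤ) :
    (∏ i ∈ s, (1 - HahnSeries.single (1 : ℤ) (κ i))).coeff e = (∏ i ∈ s, -κ i) *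
      (∏ i ∈ s, (1 - HahnSeries.single (1 : ℤ) (κ i)⁻¹)).coeff (s.card - e) := by
  classical
  induction s using Finset.induction_on generalizing e with
  | empty =>
    simp only [Finset.prod_empty, HahnSeries.coeff_one, Finset.card_empty, Nat.cast_zero, zero_sub,
      neg_eq_zero, one_mul]
    congr
  | insert i s hi ih =>
    rw [Finset.prod_insert hi, Finset.prod_insert hi, Finset.prod_insert hi,
      Finset.card_insert_of_notMem hi, sub_mul, sub_mul, one_mul, one_mul, HahnSeries.coeff_sub,
      HahnSeries.coeff_sub, HahnSeries.coeff_single_mul, HahnSeries.coeff_single_mul, ih, ih]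
    rw [show ((s.card : ℤ) - (e - 1)) = (s.card + 1 : ℕ) - e by push_cast; ring,
      show (((s.card + 1 : ℕ) : ℤ) - e - 1) = s.card - e by push_cast; ring]
    have := hκ i
    field_simp
    ring

theorem detSeries_eq_prod {g : G} {r : ℕ} (b : Module.Basis (Fin r) ℂ (Module.Dual ℂ V))
    {κ : Fin r → ℂ} (hκ : ∀ i, ρ.dual g (b i) = κ i • b i) :
    detSeries ρ g = ∏ i, (1 - HahnSeries.single (1 : ℤ) (κ i)) := by
  rw [detSeries, detPoly_eq_prod b hκ, ← Polynomial.coeToPowerSeries.ringHom_apply, map_prod,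
    map_prod]
  refine Finset.prod_congr rfl fun i _ => ?_
  rw [Polynomial.coeToPowerSeries.ringHom_apply, Polynomial.coe_sub, Polynomial.coe_mul,
    Polynomial.coe_one, Polynomial.coe_C, Polynomial.coe_X, map_sub, map_mul, map_one,
    HahnSeries.ofPowerSeries_C, HahnSeries.ofPowerSeries_X, HahnSeries.C_apply,
    HahnSeries.single_mul_single, zero_add, mul_one]

/-- In an eigenbasis of `g` on the dual space this is the reflection of a product, the eigenvalues
of `g⁻¹` being the inverses. It expresses `det(1 - g q) = (-q)^r det(g) det(1 - g⁻¹ q⁻¹)`. -/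
theorem coeff_detSeries [Finite G] [FiniteDimensional ℂ V] (g : G) (e : ℤ) :
    (detSeries ρ g).coeff e = (-1) ^ Module.finrank ℂ V * detDual ρ g *
      (detSeries ρ g⁻¹).coeff (Module.finrank ℂ V - e) := by
  obtain ⟨b, κ, hκ⟩ := exists_eigenbasis_rep ρ.dual g (Subspace.dual_finrank_eq (K := ℂ) (V := V))
  have hmul : ∀ v, ρ.dual g⁻¹ (ρ.dual g v) = v := fun v => by
    rw [← Module.End.mul_apply, ← map_mul, inv_mul_cancel, map_one, Module.End.one_apply]
  have hκ0 : ∀ i, κ i ≠ 0 := fun i h => by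
    have h1 := hmul (b i)
    rw [hκ, h, zero_smul, map_zero] at h1
    exact b.ne_zero i h1.symm
  have hκ' : ∀ i, ρ.dual g⁻¹ (b i) = (κ i)⁻¹ • b i := fun i => by
    rw [eq_inv_smul_iff₀ (hκ0 i), ← map_smul, ← hκ, hmul]
  rw [detSeries_eq_prod b hκ, detSeries_eq_prod b hκ', det_eq_prod b hκ,
    coeff_prod_one_sub_single _ _ hκ0, Finset.card_fin, Finset.prod_neg, Finset.card_fin]

end

section

variable {G V : Type*} [Group G] [Fintype G] [AddCommGroup V] [Module ℂ V]
  {ρ : Representation ℂ G V} {t : ℂ} {c : G → ℂ}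

theorem IsGrading.num_eq_sum {N : Type*} [AddCommGroup N] [Module ℂ N] [Module (Cherednik ρ t c) N]
    [IsScalarTower ℂ (Cherednik ρ t c) N] {D : Module.End ℂ N} (hD : IsGrading ρ t c D) {M : ℕ}
    {g : G} (hM : ∀ n ≥ M, hD.tr n g = 0) (d : ℤ) :
    hD.num d g = ∑ n ∈ Finset.range M, (detSeries ρ g).coeff (d - n) * hD.tr n g := by
  have h : HahnSeries.ofPowerSeries ℤ ℂ (PowerSeries.mk fun n => hD.tr n g) =
      ∑ n ∈ Finset.range M, HahnSeries.single (n : ℤ) (hD.tr n g) := by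
    have h1 : PowerSeries.mk (fun n => hD.tr n g) =
        ∑ n ∈ Finset.range M, PowerSeries.C (hD.tr n g) * PowerSeries.X ^ n := by
      ext k
      rw [PowerSeries.coeff_mk, map_sum]
      simp only [PowerSeries.coeff_C_mul_X_pow]
      rw [Finset.sum_ite_eq]
      split_ifs with hk
      · rfl
      · exact hM k (not_lt.mp fun h => hk (Finset.mem_range.mpr h))
    rw [h1, map_sum]
    refine Finset.sum_congr rfl fun n _ => ?_
    rw [map_mul, HahnSeries.ofPowerSeries_C, HahnSeries.ofPowerSeries_X_pow, HahnSeries.C_apply,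
      HahnSeries.single_mul_single, zero_add, mul_one]
  rw [num, map_mul, h, Finset.mul_sum, HahnSeries.coeff_sum]
  exact Finset.sum_congr rfl fun n _ => HahnSeries.coeff_mul_single

variable [FiniteDimensional ℂ V] {W : Type*} [AddCommGroup W] [Module ℂ W] [FiniteDimensional ℂ W]
  {τ : Representation ℂ G W}

omit [FiniteDimensional ℂ W] in
-- Both sides are finite convolutions over the degrees of the simple module, and they match term by
-- term through the functional equation of the determinant and the equality of traces at `g` and
-- `g⁻¹`.
theorem coeff_simpleChNeg_mul {D : Module.End ℂ (Simple ρ t c τ)} (hD : IsGrading ρ t c D)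
    {D' : Module.End ℂ (Simple ρ.dual t (fun s => c s⁻¹) τ.dual)}
    (hD' : IsGrading ρ.dual t (fun s => c s⁻¹) D')
    (hdeg : ∀ n, simpleDeg ρ.dual t (fun s => c s⁻¹) τ.dual n = D'.eigenspace (n : ℂ))
    (htr : ∀ n g, hD'.tr n g = hD.tr n g⁻¹) [FiniteDimensional ℂ (Simple ρ t c τ)] (g : G) (e : ℤ) :
    (simpleChNeg ρ.dual t (fun s => c s⁻¹) τ.dual g * detSeries ρ g).coeff e =
      (-1) ^ Module.finrank ℂ V * detDual ρ g * hD.num (Module.finrank ℂ V - e) g⁻¹ := by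
  obtain ⟨M, hM⟩ := hD.exists_forall_eq_bot
  have hM' : ∀ n ≥ M, hD.tr n g⁻¹ = 0 := fun n hn => hD.tr_eq_zero (hM n hn) _
  have h1 : simpleChNeg ρ.dual t (fun s => c s⁻¹) τ.dual g =
      ∑ n ∈ Finset.range M, HahnSeries.single (-(n : ℤ)) (hD.tr n g⁻¹) := by
    simp only [simpleChNeg, trace_simpleAct hD' hdeg, htr]
    refine finsum_eq_sum_of_support_subset _ fun n hn => ?_
    rw [Finset.coe_range, Set.mem_Iio]
    by_contra h
    refine hn ?_
    beta_reduce
    rw [hM' n (not_lt.mp h), map_zero]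
  rw [h1, Finset.sum_mul, HahnSeries.coeff_sum, hD.num_eq_sum hM', Finset.mul_sum]
  refine Finset.sum_congr rfl fun n _ => ?_
  rw [HahnSeries.coeff_single_mul, coeff_detSeries, sub_neg_eq_add, ← sub_sub]
  ring

omit [FiniteDimensional ℂ W] in
-- The new numerators are the duals, twisted by the determinant and shifted by the rank, so the
-- required identities hold by construction. Only the formula for the character is left, and its
-- sign `(-1)^r` dictates which one is the positive part.
theorem exists_dual_numerators {D : Module.End ℂ (Simple ρ t c τ)} (hD : IsGrading ρ t c D)
    {D' : Module.End ℂ (Simple ρ.dual t (fun s => c s⁻¹) τ.dual)}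
    (hD' : IsGrading ρ.dual t (fun s => c s⁻¹) D')
    (hdeg : ∀ n, simpleDeg ρ.dual t (fun s => c s⁻¹) τ.dual n = D'.eigenspace (n : ℂ))
    (htr : ∀ n g, hD'.tr n g = hD.tr n g⁻¹) [FiniteDimensional ℂ (Simple ρ t c τ)]
    {ip im : FinGradedRep G} (hd : ip.Disjoint im) (hd' : im.Disjoint ip)
    (h : ∀ d g, LinearMap.trace ℂ _ (ip.rep d g) - LinearMap.trace ℂ _ (im.rep d g) =
      hD.num d g) :
    ∃ jp jm : FinGradedRep G,
      (∀ g : G, simpleChNeg ρ.dual t (fun s => c s⁻¹) τ.dual g =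
        (jp.ch g - jm.ch g) / detSeries ρ g) ∧
      jp.Disjoint jm ∧
      (Even (Module.finrank ℂ V) → ∀ g : G,
        (ip.dual.twist (detDual ρ)).ch g =
          HahnSeries.single (-(Module.finrank ℂ V : ℤ)) 1 * jp.ch g ∧
        (im.dual.twist (detDual ρ)).ch g =
          HahnSeries.single (-(Module.finrank ℂ V : ℤ)) 1 * jm.ch g) ∧
      (Odd (Module.finrank ℂ V) → ∀ g : G,
        (ip.dual.twist (detDual ρ)).ch g =
          HahnSeries.single (-(Module.finrank ℂ V : ℤ)) 1 * jm.ch g ∧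
        (im.dual.twist (detDual ρ)).ch g =
          HahnSeries.single (-(Module.finrank ℂ V : ℤ)) 1 * jp.ch g) := by
  have hch := coeff_simpleChNeg_mul hD hD' hdeg htr
  let F : FinGradedRep G → FinGradedRep G := fun E =>
    (E.dual.twist (detDual ρ)).shift (Module.finrank ℂ V)
  have hF : ∀ (E : FinGradedRep G) g, (E.dual.twist (detDual ρ)).ch g =
      HahnSeries.single (-(Module.finrank ℂ V : ℤ)) 1 * (F E).ch g := fun E g =>
    FinGradedRep.ch_eq_single_mul_ch_shift _ _ g
  have hsub : ∀ g e, ((F ip).ch g - (F im).ch g).coeff e =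
      detDual ρ g * hD.num (Module.finrank ℂ V - e) g⁻¹ := fun g e => by
    rw [HahnSeries.coeff_sub, FinGradedRep.coeff_ch, FinGradedRep.coeff_ch,
      FinGradedRep.trace_dual_twist_shift, FinGradedRep.trace_dual_twist_shift, ← mul_sub, h]
  rcases Nat.even_or_odd (Module.finrank ℂ V) with hr | hr
  · refine ⟨F ip, F im, fun g => ?_, (hd'.dual.twist _).shift _, fun _ g => ⟨hF ip g, hF im g⟩,
      fun ho => absurd hr (Nat.not_even_iff_odd.mpr ho)⟩
    rw [eq_div_iff (detSeries_ne_zero ρ g)]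
    ext e
    rw [hch, hsub, hr.neg_one_pow, one_mul]
  · refine ⟨F im, F ip, fun g => ?_, (hd.dual.twist _).shift _,
      fun he => absurd he (Nat.not_even_iff_odd.mpr hr), fun _ g => ⟨hF ip g, hF im g⟩⟩
    rw [eq_div_iff (detSeries_ne_zero ρ g), ← neg_sub]
    ext e
    rw [hch, HahnSeries.coeff_neg, hsub, hr.neg_one_pow]
    ring

end

end Cherednik

end

/-! ### The proposition. -/

theorem propositionp {G V W : Type*} [Group G] [Fintype G]
    [AddCommGroup V] [Module ℂ V] [FiniteDimensional ℂ V]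
    [AddCommGroup W] [Module ℂ W] [FiniteDimensional ℂ W]
    (ρ : Representation ℂ G V) (hfaithful : Function.Injective ρ)
    (hrefl : Subgroup.closure {s : G | IsReflection ρ s} = ⊤)
    (hirr : ρ.IsIrreducible)
    (t : ℂ) (c : G → ℂ)
    (hc : ∀ s g : G, IsReflection ρ s → c (g * s * g⁻¹) = c s)
    (τ : Representation ℂ G W) (hτ : τ.IsIrreducible) :
    -- `L_{t,c}(τ)` is graded with finite-dimensional components
    DirectSum.IsInternal (Cherednik.simpleDeg ρ t c τ) ∧
    (∀ n, FiniteDimensional ℂ (Cherednik.simpleDeg ρ t c τ n)) ∧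
    (t = 0 → FiniteDimensional ℂ (Cherednik.Simple ρ t c τ)) ∧
    ∃ ip im : FinGradedRep G,
      (∀ g : G, Cherednik.simpleCh ρ t c τ g = (ip.ch g - im.ch g) / detSeries ρ g) ∧
      ip.Disjoint im ∧
      (∀ (U : Type*) [AddCommGroup U] [Module ℂ U] (σ : Representation ℂ G U),
        σ.IsIrreducible → (FinGradedRep.Occurs σ ip ∨ FinGradedRep.Occurs σ im) →
          Sim ρ t c σ τ) ∧
      (FiniteDimensional ℂ (Cherednik.Simple ρ t c τ) →
        ip.dim = im.dim ∧
        -- the module `L_{t,č}(τ*)` of `H_{t,č}(G, V*)` and its numerators `jp`, `jm`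
        FiniteDimensional ℂ (Cherednik.Simple ρ.dual t (fun s => c s⁻¹) τ.dual) ∧
        ∃ jp jm : FinGradedRep G,
          (∀ g : G, Cherednik.simpleChNeg ρ.dual t (fun s => c s⁻¹) τ.dual g =
            (jp.ch g - jm.ch g) / detSeries ρ g) ∧
          jp.Disjoint jm ∧
          (Even (Module.finrank ℂ V) → ∀ g : G,
            (ip.dual.twist (detDual ρ)).ch g =
              HahnSeries.single (-(Module.finrank ℂ V : ℤ)) 1 * jp.ch g ∧
            (im.dual.twist (detDual ρ)).ch g =
              HahnSeries.single (-(Module.finrank ℂ V : ℤ)) 1 * jm.ch g) ∧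
          (Odd (Module.finrank ℂ V) → ∀ g : G,
            (ip.dual.twist (detDual ρ)).ch g =
              HahnSeries.single (-(Module.finrank ℂ V : ℤ)) 1 * jm.ch g ∧
            (im.dual.twist (detDual ρ)).ch g =
              HahnSeries.single (-(Module.finrank ℂ V : ℤ)) 1 * jp.ch g)) := by
  let b := Module.finBasis ℂ (Module.Dual ℂ V)
  let b' := Module.finBasis ℂ (Module.Dual ℂ (Module.Dual ℂ V))
  obtain ⟨D, hD, hpoly, hdeg⟩ := Cherednik.exists_simpleGr (t := t) b hc hτ
  -- An irreducible `V` is nonzero, which is what the equality of dimensions needs.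
  have := Cherednik.nontrivial_of_isIrreducible hirr
  obtain ⟨ip, im, hd, hd', hsim, hnum⟩ := Cherednik.exists_numerators hc hτ hD b hpoly
  refine ⟨?_, fun n => hdeg n ▸ hD.finite n, ?_, ip, im, Cherednik.simpleCh_eq_div hD hdeg hnum, hd,
    hsim, fun hfin => ⟨Cherednik.dim_eq_dim hD hnum, ?_⟩⟩
  · rw [funext hdeg]
    exact DirectSum.isInternal_submodule_of_iSupIndep_of_iSup_eq_top
      (Cherednik.iSupIndep_eigenspace_nat D) hD.iSup_eq_top
  · rintro rfl
    exact Cherednik.finiteDimensional_simple_zero hc hτ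
  · obtain ⟨D', hD', hpoly', hdeg'⟩ := Cherednik.exists_simpleGr (c := fun s => c s⁻¹) (t := t) b'
      (Cherednik.dual_invariant hc) (Cherednik.isIrreducible_dual hτ)
    obtain ⟨γ, hl, hr, hg, hγ⟩ := Cherednik.exists_simplePairing b b' hc hτ hpoly hpoly'
    exact ⟨Cherednik.finiteDimensional_of_pairing hr, Cherednik.exists_dual_numerators hD hD' hdeg'
      (Cherednik.tr_dual_eq hD hD' hl hr hg hγ) hd hd' hnum⟩
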